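/- A knot is an oriented smoothly embedded circle in the oriented sphere $S^3$, and $-K$ denotes $K$ with the reversed orientation. A diagram of a link is a planar projection of it (stereographic projection from a point off the link, followed by an orthogonal projection to a plane) which is an immersion with finitely many crossings, all of them transversal double points, together with the over/under information at the crossings. For disjoint knots $J,K$, the linking number $lk(J,K)$ is one half of the sum of the signs of the crossings between $J$ and $K$ (self-crossings are not counted) in a diagram of the link $J\cup K$. A connected sum $K_1\# K_2$ of disjoint knots is a knot obtained by removing an arc from each of $K_1$, $K_2$ and joining the two remaining arcs, consistently with their orientations, by two new arcs, such that the union of the new arcs and the removed arcs is the boundary of a topologically embedded closed disc $D\subset S^3$ which meets $K_1\cup K_2$ only along the removed arcs. For knots $K_1,K_2$ disjoint from $K_3$, we say that $K_2$ is obtained from $K_1$ by a single crossing change (in the presence of $K_3$) if, up to ambient isotopy of oriented two-component links, the links $K_1\cup K_3$ and $K_2\cup K_3$ have diagrams that differ only in that over and under are interchanged at one crossing of the first component with itself. **Theorem.** Any two disjoint knots $J,K$ in $S^3$ have a diagram, and $lk(J,K)$ is a well-defined integer: in every diagram of $J\cup K$ the sum of the signs of the crossings between $J$ and $K$ equals $2\,lk(J,K)$.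 Moreover: 1. If $K_1,K_2,K_3$ are pairwise disjoint and $K_1\# K_2$ is formed along a disc $D$ that is disjoint from $K_3$, then $lk(K_1\# K_2,K_3)=lk(K_1,K_3)+lk(K_2,K_3)$. 2. If $K_1,K_2$ are disjoint, then $lk(K_1,-K_2)=lk(-K_1,K_2)=-lk(K_1,K_2)$. 3. If $K_1$ and $K_2$ are disjoint from $K_3$ and $K_2$ is obtained from $K_1$ by a single crossing change in the presence of $K_3$, then $lk(K_1,K_3)=lk(K_2,K_3)$. -/

import Mathlib

open scoped Manifold ContDiff

noncomputable section

namespace KnotTheory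

/-- The 3-sphere, as the unit sphere of Euclidean 4-space. -/
abbrev S3 : Type := Metric.sphere (0 : EuclideanSpace ℝ (Fin 4)) 1

instance factFinrankFour : Fact (Module.finrank ℝ (EuclideanSpace ℝ (Fin 4)) = 3 + 1) :=
  ⟨by simp⟩

/-- An oriented smooth knot in `S3`: a smooth embedding (injective immersion) of the circle
`ℝ / ℤ`, written as a 1-periodic map on `ℝ`.  The orientation is the direction of increasing
parameter. -/
structure Knot where
  toFun : ℝ → S3
  periodic : Function.Periodic toFun 1
  smooth : ContDiff ℝ ∞ (fun t => (toFun t : EuclideanSpace ℝ (Fin 4)))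
  immersive : ∀ t, deriv (fun t => (toFun t : EuclideanSpace ℝ (Fin 4))) t ≠ 0
  injective : ∀ s t, toFun s = toFun t → ∃ n : ℤ, s - t = n

instance : CoeFun Knot (fun _ => ℝ → S3) := ⟨Knot.toFun⟩

/-- The two knots have no common point. -/
def Knot.Disjoint (J K : Knot) : Prop := ∀ s t, J s ≠ K t

/-- The knot `-K`: the same curve with the reversed orientation. -/
def Knot.reverse (K : Knot) : Knot where
  toFun t := K (-t)
  periodic t := by
    have h := K.periodic (-(t + 1))
    have e : -(t + 1) + 1 = -t := by ring
    rw [e] at h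
    exact h.symm
  smooth := K.smooth.comp contDiff_neg
  immersive t := by
    have h := deriv_comp_neg (fun t => (K t : EuclideanSpace ℝ (Fin 4))) t
    rw [h]
    exact neg_ne_zero.mpr (K.immersive (-t))
  injective s t h := by
    obtain ⟨n, hn⟩ := K.injective _ _ h
    exact ⟨-n, by push_cast; linarith⟩

/-! ### Diagrams -/

/-- The rotations of 4-space. -/
abbrev Rotation : Type := Matrix.specialOrthogonalGroup (Fin 4) ℝ

/-- The four coordinates of the rotated point `A x`. -/
def rotate (A : Rotation) (x : S3) : Fin 4 → ℝ :=
  A.1.mulVec (x : EuclideanSpace ℝ (Fin 4)).ofLp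

/-- Coordinates `0, 1, 2` in 3-space of the image of `x` under the rotation `A` followed by the
stereographic projection from the pole `(0, 0, 0, 1)`; meaningful if `A x` is not the pole. As `A`
varies, one gets the stereographic projections of the oriented 3-sphere from all points, composed
with all rotations of 3-space. -/
def stereo (A : Rotation) (x : S3) (i : Fin 3) : ℝ :=
  rotate A x i.castSucc / (1 - rotate A x 3)

/-- The projection of the knot to the plane of the first two coordinates. -/
def shadow (A : Rotation) (K : Knot) (t : ℝ) : ℝ × ℝ :=
  (stereo A (K t) 0, stereo A (K t) 1)

/-- The height of a point of the knot above the plane of projection. -/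
def height (A : Rotation) (K : Knot) (t : ℝ) : ℝ := stereo A (K t) 2

/-- The determinant of two plane vectors. -/
def planeDet (v w : ℝ × ℝ) : ℝ := v.1 * w.2 - v.2 * w.1

/-- The pairs of distinct points `(i, s)`, `(j, t)` of the link with components `L i` which have the
same projection. The parameter of a point of the link is taken in `[0, 1)`. -/
def doublePoints {ι : Type} (A : Rotation) (L : ι → Knot) : Set ((ι × ℝ) × (ι × ℝ)) :=
  {q | q.1.2 ∈ Set.Ico (0 : ℝ) 1 ∧ q.2.2 ∈ Set.Ico (0 : ℝ) 1 ∧ q.1 ≠ q.2 ∧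
    shadow A (L q.1.1) q.1.2 = shadow A (L q.2.1) q.2.2}

/-- The projection belonging to `A` yields a diagram of the link with components `L i`: the link
misses the centre of the stereographic projection, its planar projection is an immersion with
finitely many crossings, at each crossing exactly two points of the link meet, and they cross
transversally. -/
structure IsDiagram {ι : Type} (A : Rotation) (L : ι → Knot) : Prop where
  misses_pole : ∀ i t, rotate A (L i t) 3 ≠ 1
  immersion : ∀ i t, deriv (shadow A (L i)) t ≠ 0
  finite : (doublePoints A L).Finite
  transversal : ∀ q ∈ doublePoints A L,
    planeDet (deriv (shadow A (L q.1.1)) q.1.2) (deriv (shadow A (L q.2.1)) q.2.2) ≠ 0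
  no_triple : ∀ x y z, (x, y) ∈ doublePoints A L → (x, z) ∈ doublePoints A L → y = z

/-- The crossings between `J` and `K`: a crossing is given by the parameters in `[0, 1)` of its
point on `J` and of its point on `K`. -/
def crossings (A : Rotation) (J K : Knot) : Set (ℝ × ℝ) :=
  {p | p.1 ∈ Set.Ico (0 : ℝ) 1 ∧ p.2 ∈ Set.Ico (0 : ℝ) 1 ∧ shadow A J p.1 = shadow A K p.2}

/-- The sign of a crossing between `J` and `K`, by the right hand rule: it is `+1` if the direction
of the over-strand followed by that of the under-strand is a positively oriented basis of the plane,
and `-1` if it is a negatively oriented one. -/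
def crossingSign (A : Rotation) (J K : Knot) (p : ℝ × ℝ) : ℤ :=
  if height A K p.2 < height A J p.1 then
    (SignType.sign (planeDet (deriv (shadow A J) p.1) (deriv (shadow A K) p.2)) : ℤ)
  else
    (SignType.sign (planeDet (deriv (shadow A K) p.2) (deriv (shadow A J) p.1)) : ℤ)

/-- The sum of the signs of all crossings between `J` and `K`; self-crossings do not count. -/
def crossingSum (A : Rotation) (J K : Knot) : ℤ :=
  ∑ᶠ p ∈ crossings A J K, crossingSign A J K p

open Classical in
/-- The linking number: one half of the sum of the signs of the crossings between `J` and `K` in a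
diagram of the link with components `J`, `K`. -/
def lk (J K : Knot) : ℤ :=
  if h : ∃ A, IsDiagram A ![J, K] then crossingSum h.choose J K / 2 else 0

/-! ### Connected sums -/

/-- On `[s, t]`, the curve `f` runs through the part of the curve `g` between the parameters `u` and
`v`, in the same direction. -/
def Traces (f : ℝ → S3) (s t : ℝ) (g : ℝ → S3) (u v : ℝ) : Prop :=
  ∃ φ : ℝ → ℝ, ContinuousOn φ (Set.Icc s t) ∧ StrictMonoOn φ (Set.Icc s t) ∧
    φ s = u ∧ φ t = v ∧ ∀ x ∈ Set.Icc s t, f x = g (φ x)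

/-- The unit square, a model of the closed disc. -/
def unitSquare : Set (ℝ × ℝ) := Set.Icc (0 : ℝ) 1 ×ˢ Set.Icc (0 : ℝ) 1

/-- `K` is the oriented connected sum of the disjoint knots `K₁` and `K₂` formed along the
topological disc `D(unitSquare)`. The arcs `K₁ [a, b]` and `K₂ [c, d]`, which are the left side
(run through upwards) and the right side (run through downwards) of the disc, are removed, and the
remaining arcs are joined by the lower and the upper side; the disc meets `K₁` and `K₂` only
along the removed arcs. -/
def IsConnectedSumAlong (D : ℝ × ℝ → S3) (K₁ K₂ K : Knot) : Prop :=
  ContinuousOn D unitSquare ∧ Set.InjOn D unitSquare ∧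
  (∀ q ∈ unitSquare, D q ∈ Set.range K₁ → q.1 = 0) ∧
  (∀ q ∈ unitSquare, D q ∈ Set.range K₂ → q.1 = 1) ∧
  ∃ a b c d p₀ p₁ p₂ p₃ : ℝ,
    a < b ∧ b < a + 1 ∧ c < d ∧ d < c + 1 ∧
    p₀ < p₁ ∧ p₁ < p₂ ∧ p₂ < p₃ ∧ p₃ < p₀ + 1 ∧
    (∀ t ∈ Set.Icc (0 : ℝ) 1, D (0, t) = K₁ (a + t * (b - a))) ∧
    (∀ t ∈ Set.Icc (0 : ℝ) 1, D (1, 1 - t) = K₂ (c + t * (d - c))) ∧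
    Traces K p₀ p₁ K₁ b (a + 1) ∧
    (∀ t ∈ Set.Icc (0 : ℝ) 1, K (p₁ + t * (p₂ - p₁)) = D (t, 0)) ∧
    Traces K p₂ p₃ K₂ d (c + 1) ∧
    (∀ t ∈ Set.Icc (0 : ℝ) 1, K (p₃ + t * (p₀ + 1 - p₃)) = D (1 - t, 1))

/-! ### Ambient isotopy and crossing changes -/

/-- The links with components `L i` and `L' i` are (smoothly) ambient isotopic as oriented
links: a smooth family of diffeomorphisms of the sphere, which starts at the identity, ends with
a diffeomorphism that carries each `L i` to `L' i`. -/
def AmbientIsotopic {ι : Type} (L L' : ι → Knot) : Prop :=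
  ∃ H : ℝ → Diffeomorph (𝓡 3) (𝓡 3) S3 S3 ∞,
    ContMDiff (𝓘(ℝ, ℝ).prod (𝓡 3)) (𝓡 3) ∞ (fun p : ℝ × S3 => H p.1 p.2) ∧
    (∀ x, H 0 x = x) ∧ ∀ i t, H 1 (L i t) = L' i t

/-- In the projection belonging to `A`, the diagrams of `L` and `L'` differ exactly in that over and
under are interchanged at one crossing, and this is a crossing of the component `i` with
itself. -/
def DiffersByCrossingChange {ι : Type} (A : Rotation) (L L' : ι → Knot) (i : ι) : Prop :=
  IsDiagram A L ∧ IsDiagram A L' ∧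
  (∀ j t, shadow A (L j) t = shadow A (L' j) t) ∧
  ∃ s₀ t₀ : ℝ, ((i, s₀), (i, t₀)) ∈ doublePoints A L ∧
    height A (L i) t₀ < height A (L i) s₀ ∧ height A (L' i) s₀ < height A (L' i) t₀ ∧
    ∀ x y, (x, y) ∈ doublePoints A L →
      (x, y) ≠ ((i, s₀), (i, t₀)) → (x, y) ≠ ((i, t₀), (i, s₀)) →
      (height A (L x.1) x.2 < height A (L y.1) y.2 ↔
        height A (L' x.1) x.2 < height A (L' y.1) y.2)

/-- In the presence of the knot `M`, the knot `K` is obtained from `J` by a single crossing change: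
up to ambient isotopy of links, `K ∪ M` arises from `J ∪ M` by changing one crossing of the
first component with itself in a diagram. -/
def IsCrossingChange (J K M : Knot) : Prop :=
  ∃ (A : Rotation) (L L' : Fin 2 → Knot),
    AmbientIsotopic ![J, M] L ∧ AmbientIsotopic ![K, M] L' ∧ DiffersByCrossingChange A L L' 0

end KnotTheory

end

open KnotTheory

/-!
The linking number is computed by an integral. Let `h` be a function on `ℝ⁴ ∖ {0}`, homogeneous of
degree `-4`, so that `h` times the contraction of the volume form with the radial field is a closed
conical 3-form. Pull it back along `(s, t, r) ↦ (1 - r) X s - r Y t` for two closed curves `X`, `Y`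
which never point in the same direction, and integrate (`gaussIntegral`). Integrating out `r` and
`t` leaves a 1-form in the position of `X` (`linkForm`), which is locally exact off the cone over
`Y`; so the integral does not change when `X` moves off that cone, nor, by symmetry, when `Y` moves.

For knots in the unit sphere the integral is thus a link homotopy invariant, and it may be computed
on the stereographic images: these are the knots seen from the pole, so that one has only to move
the apex of the cone from the origin to the pole and to rescale. If `h` is concentrated near the
vertical direction, only the crossings at which `X` runs above `Y` contribute, each by its sign
times a constant. Reflections reverse the sign of the integral and connect all directions, so the
direction does not matter; taking the opposite one exchanges over- and undercrossings. Hence the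
signs of the overcrossings and those of the undercrossings have the same sum, which is the linking
number, in every diagram.

Additivity holds because `linkForm` has no integral over the boundary of a disc which is disjoint
from `K₃`, and this boundary is the difference of `K₁ # K₂` and `K₁ ∪ K₂`. A crossing change affects
only self-crossings, and ambient isotopies are link homotopies. Diagrams exist because almost every
oblique projection of a space curve is generic, by Sard's theorem.
-/

noncomputable section

open scoped Manifold ContDiff Topology
open MeasureTheory Set Filter

set_option maxSynthPendingDepth 3

namespace KnotTheory

/-! ### Integrals depending on a parameter -/

section ParametricIntegral

variable {X F : Type*} [NormedAddCommGroup F]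

theorem exists_eventually_norm_le_of_isCompact {Y : Type*} [TopologicalSpace X]
    [TopologicalSpace Y] {f : X → Y → F} {U : Set X} {K : Set Y} (hK : IsCompact K)
    (hf : ContinuousOn f.uncurry (U ×ˢ K)) {x₀ : X} (hx : x₀ ∈ U) :
    ∃ M, ∀ᶠ x in 𝓝[U] x₀, ∀ y ∈ K, ‖f x y‖ ≤ M := by
  obtain ⟨M, hM⟩ := hK.exists_bound_of_continuousOn (f := f x₀)
    (hf.uncurry_left x₀ hx)
  obtain ⟨V, hV, hclose⟩ := hK.mem_uniformity_of_prod hf hx (Metric.dist_mem_uniformity one_pos)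
  refine ⟨M + 1, eventually_of_mem hV fun x hxV y hy => ?_⟩
  have hdist : ‖f x y - f x₀ y‖ < 1 := by
    rw [← dist_eq_norm]
    exact hclose x hxV y hy
  linarith [hM y hy, norm_le_norm_add_norm_sub (f x₀ y) (f x y), norm_sub_rev (f x₀ y) (f x y)]

variable {a b : ℝ} (hab : a ≤ b)

include hab in
theorem intervalIntegrable_of_continuousOn_uncurry [TopologicalSpace X] {f : X → ℝ → F}
    {U : Set X} (hf : ContinuousOn f.uncurry (U ×ˢ Icc a b)) {x : X} (hx : x ∈ U) :
    IntervalIntegrable (f x) volume a b :=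
  (hf.uncurry_left x hx).intervalIntegrable_of_Icc hab

variable [NormedSpace ℝ F]

include hab in
theorem continuousOn_intervalIntegral_of_continuousOn_uncurry [TopologicalSpace X]
    [FirstCountableTopology X] {f : X → ℝ → F} {U : Set X}
    (hf : ContinuousOn f.uncurry (U ×ˢ Icc a b)) :
    ContinuousOn (fun x => ∫ t in a..b, f x t) U := by
  intro x₀ hx
  have hΙ : uIoc a b ⊆ Icc a b := uIoc_of_le hab ▸ Ioc_subset_Icc_self
  obtain ⟨M, hM⟩ := exists_eventually_norm_le_of_isCompact isCompact_Icc hf hx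
  refine intervalIntegral.continuousWithinAt_of_dominated_interval (bound := fun _ => M) ?_ ?_
    intervalIntegrable_const (ae_of_all _ fun t ht => hf.uncurry_right t (hΙ ht) x₀ hx)
  · filter_upwards [self_mem_nhdsWithin] with x h
    exact (intervalIntegrable_of_continuousOn_uncurry hab hf h).aestronglyMeasurable_restrict_uIoc
  · filter_upwards [hM] with x h
    exact ae_of_all _ fun t ht => h t (hΙ ht)

include hab in
theorem hasFDerivAt_intervalIntegral_of_continuousOn_uncurry [NormedAddCommGroup X]
    [NormedSpace ℝ X] {f : X → ℝ → F} {f' : X → ℝ → X →L[ℝ] F} {U : Set X} (hU : IsOpen U)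
    (hf : ContinuousOn f.uncurry (U ×ˢ Icc a b)) (hf' : ContinuousOn f'.uncurry (U ×ˢ Icc a b))
    (hd : ∀ x ∈ U, ∀ t ∈ Icc a b, HasFDerivAt (fun x => f x t) (f' x t) x) {x₀ : X}
    (hx : x₀ ∈ U) :
    HasFDerivAt (fun x => ∫ t in a..b, f x t) (∫ t in a..b, f' x₀ t) x₀ := by
  have hΙ : uIoc a b ⊆ Icc a b := uIoc_of_le hab ▸ Ioc_subset_Icc_self
  have hUx := hU.mem_nhds hx
  obtain ⟨M, hM⟩ := exists_eventually_norm_le_of_isCompact isCompact_Icc hf' hx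
  rw [hU.nhdsWithin_eq hx] at hM
  refine intervalIntegral.hasFDerivAt_integral_of_dominated_of_fderiv_le (bound := fun _ => M)
    (s := {x | x ∈ U ∧ ∀ t ∈ Icc a b, ‖f' x t‖ ≤ M}) (inter_mem hUx hM) ?_
    (intervalIntegrable_of_continuousOn_uncurry hab hf hx)
    (intervalIntegrable_of_continuousOn_uncurry hab hf' hx).aestronglyMeasurable_restrict_uIoc
    (ae_of_all _ fun t ht x h => h.2 t (hΙ ht)) intervalIntegrable_const
    (ae_of_all _ fun t ht x h => hd x h.1 t (hΙ ht))
  filter_upwards [hUx] with x h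
  exact (intervalIntegrable_of_continuousOn_uncurry hab hf h).aestronglyMeasurable_restrict_uIoc

end ParametricIntegral

/-! ### The determinant of four vectors -/

/-- Euclidean 4-space. -/
abbrev E4 : Type := EuclideanSpace ℝ (Fin 4)

/-- The oriented volume of the parallelepiped spanned by four vectors of 4-space. -/
def det4 (x y v w : E4) : ℝ := (Matrix.of ![x.ofLp, y.ofLp, v.ofLp, w.ofLp]).det

theorem det4_eq_minors (x y v w : E4) : det4 x y v w =
    (x 0 * y 1 - x 1 * y 0) * (v 2 * w 3 - v 3 * w 2) -
    (x 0 * y 2 - x 2 * y 0) * (v 1 * w 3 - v 3 * w 1) +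
    (x 0 * y 3 - x 3 * y 0) * (v 1 * w 2 - v 2 * w 1) +
    (x 1 * y 2 - x 2 * y 1) * (v 0 * w 3 - v 3 * w 0) -
    (x 1 * y 3 - x 3 * y 1) * (v 0 * w 2 - v 2 * w 0) +
    (x 2 * y 3 - x 3 * y 2) * (v 0 * w 1 - v 1 * w 0) := by
  simp [det4, Matrix.det_succ_row_zero, Fin.sum_univ_succ, Fin.succAbove]
  ring

theorem det4_mulVec (M : Matrix (Fin 4) (Fin 4) ℝ) (x y v w : E4) :
    det4 (WithLp.toLp 2 (M.mulVec x.ofLp)) (WithLp.toLp 2 (M.mulVec y.ofLp))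
      (WithLp.toLp 2 (M.mulVec v.ofLp)) (WithLp.toLp 2 (M.mulVec w.ofLp)) =
      M.det * det4 x y v w := by
  rw [det4, det4, ← Matrix.det_transpose M, mul_comm, ← Matrix.det_mul]
  congr 1
  ext i j
  fin_cases i <;> simp [Matrix.mul_apply, Matrix.mulVec, dotProduct, mul_comm]

/-- The linear form `v ↦ det4 x y v z`. -/
def det4L (x y z : E4) : E4 →L[ℝ] ℝ :=
  LinearMap.toContinuousLinearMap
    { toFun := fun v => det4 x y v z
      map_add' := by intro a b; simp [det4_eq_minors]; ring
      map_smul' := by intro a b; simp [det4_eq_minors]; ring }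

@[simp] theorem det4L_apply (x y z v : E4) : det4L x y z v = det4 x y v z := rfl

/-- The bilinear form `(x, v) ↦ det4 x y v z`. -/
def det4LL (y z : E4) : E4 →L[ℝ] E4 →L[ℝ] ℝ :=
  LinearMap.toContinuousLinearMap
    { toFun := fun x => det4L x y z
      map_add' := by intro a b; ext v; simp [det4_eq_minors]; ring
      map_smul' := by intro a b; ext v; simp [det4_eq_minors]; ring }

@[simp] theorem det4LL_apply (x y z : E4) : det4LL y z x = det4L x y z := rfl

@[fun_prop]
theorem continuous_det4 {α : Type*} [TopologicalSpace α] {x y v w : α → E4} (hx : Continuous x)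
    (hy : Continuous y) (hv : Continuous v) (hw : Continuous w) :
    Continuous fun a => det4 (x a) (y a) (v a) (w a) := by
  simp only [det4_eq_minors]
  fun_prop

theorem continuous_det4L : Continuous fun p : E4 × E4 × E4 => det4L p.1 p.2.1 p.2.2 := by
  rw [continuous_clm_apply]
  intro v
  simp only [det4L_apply]
  fun_prop

theorem continuous_det4LL : Continuous fun p : E4 × E4 => det4LL p.1 p.2 := by
  rw [continuous_clm_apply]
  intro v
  simp only [det4LL_apply]
  exact continuous_det4L.comp (f := fun p : E4 × E4 => (v, p.1, p.2)) (by fun_prop)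

theorem cramer_det4 (g : E4 →L[ℝ] ℝ) (x y u v w : E4) :
    g x * det4 y u v w - g y * det4 x u v w + g u * det4 x y v w - g v * det4 x y u w
      + g w * det4 x y u v = 0 := by
  have hvec : det4 y u v w • x - det4 x u v w • y + det4 x y v w • u - det4 x y u w • v
      + det4 x y u v • w = 0 := by
    ext i
    fin_cases i <;> simp [det4_eq_minors] <;> ring
  have hg := congrArg g hvec
  simp only [map_add, map_sub, map_smul, smul_eq_mul, map_zero] at hg
  linarith

/-! ### Homogeneous kernels and their segment integrals -/

section Kernel

variable {E : Type*} [NormedAddCommGroup E] [NormedSpace ℝ E]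

/-- The pairs of vectors which do not lie on a common closed ray from the origin. -/
def unalignedPairs : Set (E × E) := {p | ¬SameRay ℝ p.1 p.2}

theorem swap_mem_unalignedPairs {x y : E} (h : (x, y) ∈ unalignedPairs) :
    (y, x) ∈ unalignedPairs := fun hyx => h hyx.symm

theorem smul_smul_mem_unalignedPairs {x y : E} (h : (x, y) ∈ unalignedPairs) {a b : ℝ}
    (ha : 0 < a) (hb : 0 < b) : (a • x, b • y) ∈ unalignedPairs := fun hab => h <| by
  simpa only [inv_smul_smul₀ ha.ne', inv_smul_smul₀ hb.ne'] using
    (hab.pos_smul_left (inv_pos.2 ha)).pos_smul_right (inv_pos.2 hb)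

theorem mem_unalignedPairs_iff_segment_ne_zero {x y : E} :
    (x, y) ∈ unalignedPairs ↔ ∀ r ∈ Icc (0 : ℝ) 1, (1 - r) • x - r • y ≠ 0 := by
  change ¬SameRay ℝ x y ↔ _
  refine ⟨fun h r hr h0 => h ?_, fun h hray => ?_⟩
  · rw [sub_eq_zero] at h0
    rcases hr.1.eq_or_lt with rfl | hr0
    · exact Or.inl (by simpa using h0)
    rcases hr.2.eq_or_lt with rfl | hr1
    · exact Or.inr (Or.inl (by simpa using h0.symm))
    · exact Or.inr (Or.inr ⟨1 - r, r, sub_pos.2 hr1, hr0, h0⟩)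
  · obtain ⟨a, b, ha, hb, hab, hx, hy⟩ := hray.exists_eq_smul_add
    refine h a ⟨ha, by linarith⟩ ?_
    rw [← hab, add_sub_cancel_left, sub_eq_zero]
    conv_lhs => rw [hx]
    conv_rhs => rw [hy]
    exact smul_comm b a _

theorem segment_ne_zero {p : E × E} (hp : p ∈ unalignedPairs) {r : ℝ} (hr : r ∈ Icc (0 : ℝ) 1) :
    (1 - r) • p.1 - r • p.2 ≠ 0 := mem_unalignedPairs_iff_segment_ne_zero.1 hp r hr

theorem isOpen_unalignedPairs : IsOpen (unalignedPairs : Set (E × E)) := by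
  simp only [unalignedPairs, sameRay_iff_norm_smul_eq]
  exact isOpen_ne_fun (by fun_prop) (by fun_prop)

/-- A function on `E` which off the origin is continuously differentiable and homogeneous of degree
`-4`, as expressed by Euler's identity. On 4-space, `h` is then the coefficient of a closed conical
3-form. -/
structure IsGaussKernel (h : E → ℝ) : Prop where
  smooth : ContDiffOn ℝ 1 h {0}ᶜ
  euler : ∀ v, v ≠ 0 → fderiv ℝ h v v = -4 * h v

/-- The integral of `h` with weight `m` over the segment from `p.1` to `-p.2`. -/
def segmentIntegral (m : ℝ → ℝ) (h : E → ℝ) (p : E × E) : ℝ :=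
  ∫ r in (0 : ℝ)..1, m r * h ((1 - r) • p.1 - r • p.2)

/-- The integral of the derivative of `h` with weight `m` over the segment from `p.1` to `-p.2`. -/
def segmentFDeriv (m : ℝ → ℝ) (h : E → ℝ) (p : E × E) : E →L[ℝ] ℝ :=
  ∫ r in (0 : ℝ)..1, m r • fderiv ℝ h ((1 - r) • p.1 - r • p.2)

namespace IsGaussKernel

variable {h : E → ℝ} (hh : IsGaussKernel h)

include hh

theorem continuousOn_fderiv : ContinuousOn (fderiv ℝ h) {0}ᶜ :=
  hh.smooth.continuousOn_fderiv_of_isOpen isOpen_compl_singleton le_rfl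

theorem hasFDerivAt {v : E} (hv : v ≠ 0) : HasFDerivAt h (fderiv ℝ h v) v :=
  ((hh.smooth.contDiffAt (isOpen_compl_singleton.mem_nhds hv)).differentiableAt
    one_ne_zero).hasFDerivAt

theorem comp_clm {L : E →L[ℝ] E} (hL : Function.Injective L) : IsGaussKernel fun v => h (L v) where
  smooth := hh.smooth.comp L.contDiff.contDiffOn fun v hv => (map_ne_zero_iff L hL).2 hv
  euler v hv := by
    have hLv : L v ≠ 0 := (map_ne_zero_iff L hL).2 hv
    have hderiv : HasFDerivAt (fun v => h (L v)) _ v :=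
      (hh.hasFDerivAt hLv).comp v L.hasFDerivAt
    rw [hderiv.fderiv]
    exact hh.euler (L v) hLv

theorem comp_neg : IsGaussKernel fun v => h (-v) :=
  hh.comp_clm (L := -ContinuousLinearMap.id ℝ E) neg_injective

theorem continuousOn_segment {m : ℝ → ℝ} (hm : Continuous m) :
    ContinuousOn (Function.uncurry fun (p : E × E) r => m r * h ((1 - r) • p.1 - r • p.2))
      (unalignedPairs ×ˢ Icc (0 : ℝ) 1) :=
  ContinuousOn.mul (by fun_prop) (hh.smooth.continuousOn.comp
    (f := fun z : (E × E) × ℝ => (1 - z.2) • z.1.1 - z.2 • z.1.2) (by fun_prop)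
    fun _ hz => segment_ne_zero hz.1 hz.2)

theorem continuousOn_fderiv_segment {m : ℝ → ℝ} (hm : Continuous m) :
    ContinuousOn (Function.uncurry fun (p : E × E) r =>
      m r • fderiv ℝ h ((1 - r) • p.1 - r • p.2)) (unalignedPairs ×ˢ Icc (0 : ℝ) 1) :=
  ContinuousOn.smul (f := fun z : (E × E) × ℝ => m z.2) (by fun_prop)
    (hh.continuousOn_fderiv.comp
      (f := fun z : (E × E) × ℝ => (1 - z.2) • z.1.1 - z.2 • z.1.2) (by fun_prop)
      fun _ hz => segment_ne_zero hz.1 hz.2)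

theorem continuousOn_segmentIntegral {m : ℝ → ℝ} (hm : Continuous m) :
    ContinuousOn (segmentIntegral m h) unalignedPairs :=
  continuousOn_intervalIntegral_of_continuousOn_uncurry zero_le_one (hh.continuousOn_segment hm)

theorem continuousOn_segmentFDeriv {m : ℝ → ℝ} (hm : Continuous m) :
    ContinuousOn (segmentFDeriv m h) unalignedPairs :=
  continuousOn_intervalIntegral_of_continuousOn_uncurry zero_le_one
    (hh.continuousOn_fderiv_segment hm)

theorem hasFDerivAt_integral_comp_affine {m c : ℝ → ℝ} {b : ℝ → E} (hm : Continuous m)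
    (hc : Continuous c) (hb : Continuous b) {U : Set E} (hU : IsOpen U)
    (hne : ∀ x ∈ U, ∀ r ∈ Icc (0 : ℝ) 1, c r • x + b r ≠ 0) {x : E} (hx : x ∈ U) :
    HasFDerivAt (fun x => ∫ r in (0 : ℝ)..1, m r * h (c r • x + b r))
      (∫ r in (0 : ℝ)..1, (m r * c r) • fderiv ℝ h (c r • x + b r)) x := by
  have hcont : Continuous fun z : E × ℝ => c z.2 • z.1 + b z.2 := by fun_prop
  have hmaps : MapsTo (fun z : E × ℝ => c z.2 • z.1 + b z.2) (U ×ˢ Icc 0 1) {0}ᶜ :=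
    fun z hz => hne z.1 hz.1 z.2 hz.2
  refine hasFDerivAt_intervalIntegral_of_continuousOn_uncurry zero_le_one
    (f := fun x r => m r * h (c r • x + b r))
    (f' := fun x r => (m r * c r) • fderiv ℝ h (c r • x + b r)) hU
    (ContinuousOn.mul (by fun_prop) (hh.smooth.continuousOn.comp hcont.continuousOn hmaps))
    (ContinuousOn.smul (f := fun z : E × ℝ => m z.2 * c z.2) (by fun_prop)
      (hh.continuousOn_fderiv.comp hcont.continuousOn hmaps)) (fun x hx r hr => ?_) hx
  have haffine : HasFDerivAt (fun x : E => c r • x + b r) (c r • ContinuousLinearMap.id ℝ E) x :=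
    ((hasFDerivAt_id x).const_smul (c r)).add_const _
  refine (((hh.hasFDerivAt (hne x hx r hr)).comp x haffine).const_mul (m r)).congr_fderiv ?_
  ext v
  simp [mul_assoc]

theorem hasFDerivAt_segmentIntegral_left {m : ℝ → ℝ} (hm : Continuous m) {p : E × E}
    (hp : p ∈ unalignedPairs) :
    HasFDerivAt (fun x => segmentIntegral m h (x, p.2))
      (segmentFDeriv (fun r => m r * (1 - r)) h p) p.1 := by
  have hU : IsOpen {x : E | (x, p.2) ∈ unalignedPairs} :=
    isOpen_unalignedPairs.preimage (by fun_prop : Continuous fun x : E => (x, p.2))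
  simp only [segmentIntegral, segmentFDeriv, sub_eq_add_neg _ (_ • p.2)]
  exact hh.hasFDerivAt_integral_comp_affine hm (c := fun r => 1 - r) (b := fun r => -(r • p.2))
    (by fun_prop) (by fun_prop) hU
    (fun x hx r hr => sub_eq_add_neg ((1 - r) • x) _ ▸ segment_ne_zero hx hr) hp

theorem hasFDerivAt_segmentIntegral_right {m : ℝ → ℝ} (hm : Continuous m) {p : E × E}
    (hp : p ∈ unalignedPairs) :
    HasFDerivAt (fun y => segmentIntegral m h (p.1, y))
      (segmentFDeriv (fun r => m r * -r) h p) p.2 := by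
  have hU : IsOpen {y : E | (p.1, y) ∈ unalignedPairs} :=
    isOpen_unalignedPairs.preimage (by fun_prop : Continuous fun y : E => (p.1, y))
  have hsub : ∀ (r : ℝ) (y : E), (1 - r) • p.1 - r • y = -r • y + (1 - r) • p.1 := fun r y => by
    module
  simp only [segmentIntegral, segmentFDeriv, hsub]
  exact hh.hasFDerivAt_integral_comp_affine hm (c := fun r => -r) (b := fun r => (1 - r) • p.1)
    (by fun_prop) (by fun_prop) hU (fun y hy r hr => hsub r y ▸ segment_ne_zero hy hr) hp

theorem segmentIntegral_add {m n : ℝ → ℝ} (hm : Continuous m) (hn : Continuous n) {p : E × E}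
    (hp : p ∈ unalignedPairs) :
    segmentIntegral (fun r => m r + n r) h p = segmentIntegral m h p + segmentIntegral n h p := by
  simp only [segmentIntegral, add_mul]
  exact intervalIntegral.integral_add
    (intervalIntegrable_of_continuousOn_uncurry zero_le_one (hh.continuousOn_segment hm) hp)
    (intervalIntegrable_of_continuousOn_uncurry zero_le_one (hh.continuousOn_segment hn) hp)

theorem segmentFDeriv_apply {m : ℝ → ℝ} (hm : Continuous m) {p : E × E}
    (hp : p ∈ unalignedPairs) (w : E) : segmentFDeriv m h p w =
      ∫ r in (0 : ℝ)..1, m r * fderiv ℝ h ((1 - r) • p.1 - r • p.2) w := by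
  rw [segmentFDeriv, ContinuousLinearMap.intervalIntegral_apply
    (intervalIntegrable_of_continuousOn_uncurry zero_le_one (hh.continuousOn_fderiv_segment hm) hp)]
  rfl

theorem intervalIntegrable_fderiv_segment_apply {m : ℝ → ℝ} (hm : Continuous m) {p : E × E}
    (hp : p ∈ unalignedPairs) (w : E) :
    IntervalIntegrable (fun r => m r * fderiv ℝ h ((1 - r) • p.1 - r • p.2) w) volume 0 1 :=
  (((hh.continuousOn_fderiv_segment hm).uncurry_left p hp).clm_apply
    continuousOn_const).intervalIntegrable_of_Icc zero_le_one

/-- Integration by parts: the segment from `p.1` to `-p.2` has velocity `-(p.1 + p.2)`. -/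
theorem segmentFDeriv_apply_add {n n' : ℝ → ℝ} (hn : ∀ r, HasDerivAt n (n' r) r)
    (hn' : Continuous n') (h0 : n 0 = 0) (h1 : n 1 = 0) {p : E × E} (hp : p ∈ unalignedPairs) :
    segmentFDeriv n h p (p.1 + p.2) = segmentIntegral n' h p := by
  have hnc : Continuous n := continuous_iff_continuousAt.2 fun r => (hn r).continuousAt
  have hderiv : ∀ r ∈ uIcc (0 : ℝ) 1, HasDerivAt (fun r => n r * h ((1 - r) • p.1 - r • p.2))
      (n' r * h ((1 - r) • p.1 - r • p.2) -
        n r * fderiv ℝ h ((1 - r) • p.1 - r • p.2) (p.1 + p.2)) r := fun r hr => by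
    rw [uIcc_of_le zero_le_one] at hr
    have hsegment : HasDerivAt (fun r : ℝ => (1 - r) • p.1 - r • p.2) (-(p.1 + p.2)) r :=
      ((((hasDerivAt_id r).const_sub 1).smul_const p.1).sub
        ((hasDerivAt_id r).smul_const p.2)).congr_deriv (by module)
    refine ((hn r).mul
      ((hh.hasFDerivAt (segment_ne_zero hp hr)).comp_hasDerivAt r hsegment)).congr_deriv ?_
    rw [map_neg, Function.comp_apply]
    ring
  have hint := intervalIntegrable_of_continuousOn_uncurry zero_le_one
    (hh.continuousOn_segment hn') hp
  have hint' := hh.intervalIntegrable_fderiv_segment_apply hnc hp (p.1 + p.2)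
  have hftc := intervalIntegral.integral_eq_sub_of_hasDerivAt hderiv (hint.sub hint')
  rw [h0, h1, zero_mul, zero_mul, sub_zero, intervalIntegral.integral_sub hint hint',
    sub_eq_zero] at hftc
  rw [hh.segmentFDeriv_apply hnc hp, ← hftc, segmentIntegral]

/-- At `v = (1 - r) • p.1 - r • p.2` one has `p.1 = v + r • (p.1 + p.2)`; apply Euler's identity
to the first summand. -/
theorem segmentFDeriv_apply_fst {m : ℝ → ℝ} (hm : Continuous m) {p : E × E}
    (hp : p ∈ unalignedPairs) : segmentFDeriv m h p p.1 =
      segmentIntegral (fun r => -4 * m r) h p +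
        segmentFDeriv (fun r => r * m r) h p (p.1 + p.2) := by
  rw [hh.segmentFDeriv_apply hm hp, hh.segmentFDeriv_apply (by fun_prop) hp, segmentIntegral,
    ← intervalIntegral.integral_add
      (intervalIntegrable_of_continuousOn_uncurry zero_le_one
        (hh.continuousOn_segment (by fun_prop)) hp)
      (hh.intervalIntegrable_fderiv_segment_apply (by fun_prop) hp _)]
  refine intervalIntegral.integral_congr fun r hr => ?_
  rw [uIcc_of_le zero_le_one] at hr
  have heuler := hh.euler _ (segment_ne_zero hp hr)
  have hsplit : p.1 = ((1 - r) • p.1 - r • p.2) + r • (p.1 + p.2) := by module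
  have happly := congrArg (fderiv ℝ h ((1 - r) • p.1 - r • p.2)) hsplit
  rw [map_add _ ((1 - r) • p.1 - r • p.2), heuler, map_smul, smul_eq_mul] at happly
  rw [happly]
  ring

theorem segmentFDeriv_apply_snd {m : ℝ → ℝ} (hm : Continuous m) {p : E × E}
    (hp : p ∈ unalignedPairs) : segmentFDeriv m h p p.2 =
      segmentIntegral (fun r => 4 * m r) h p +
        segmentFDeriv (fun r => (1 - r) * m r) h p (p.1 + p.2) := by
  rw [hh.segmentFDeriv_apply hm hp, hh.segmentFDeriv_apply (by fun_prop) hp, segmentIntegral,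
    ← intervalIntegral.integral_add
      (intervalIntegrable_of_continuousOn_uncurry zero_le_one
        (hh.continuousOn_segment (by fun_prop)) hp)
      (hh.intervalIntegrable_fderiv_segment_apply (by fun_prop) hp _)]
  refine intervalIntegral.integral_congr fun r hr => ?_
  rw [uIcc_of_le zero_le_one] at hr
  have heuler := hh.euler _ (segment_ne_zero hp hr)
  have hsplit : p.2 = (1 - r) • (p.1 + p.2) - ((1 - r) • p.1 - r • p.2) := by module
  have happly := congrArg (fderiv ℝ h ((1 - r) • p.1 - r • p.2)) hsplit
  rw [map_sub _ _ ((1 - r) • p.1 - r • p.2), heuler, map_smul, smul_eq_mul] at happly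
  rw [happly]
  ring

end IsGaussKernel

/-- The coefficient of the linking form: the integral of the 3-form with coefficient `h` over the
triangles joining a line element at `p.1` to one at `-p.2`. -/
def linkCoeff (h : E → ℝ) : E × E → ℝ := segmentIntegral (fun r => r * (1 - r)) h

/-- The derivative of `linkCoeff` in the first variable. -/
def linkCoeffDeriv (h : E → ℝ) : E × E → E →L[ℝ] ℝ := segmentFDeriv (fun r => r * (1 - r) ^ 2) h

/-- The coefficient of a primitive, along the second curve, of the exterior derivative of the
linking form. -/
def linkPrimitive (h : E → ℝ) : E × E → ℝ := segmentIntegral (fun r => (1 - r) ^ 2) h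

theorem linkCoeff_swap (h : E → ℝ) (x y : E) :
    linkCoeff h (x, y) = linkCoeff (fun v => h (-v)) (y, x) := by
  unfold linkCoeff segmentIntegral
  have hsubst := intervalIntegral.integral_comp_sub_left (a := 0) (b := 1)
    (fun r => r * (1 - r) * h ((1 - r) • x - r • y)) 1
  rw [sub_self, sub_zero] at hsubst
  rw [← hsubst]
  refine intervalIntegral.integral_congr fun r _ => ?_
  beta_reduce
  rw [neg_sub, sub_sub_cancel, mul_comm (1 - r) r]

namespace IsGaussKernel

variable {h : E → ℝ} (hh : IsGaussKernel h)

include hh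

theorem continuousOn_linkCoeff : ContinuousOn (linkCoeff h) unalignedPairs :=
  hh.continuousOn_segmentIntegral (by fun_prop)

theorem continuousOn_linkCoeffDeriv : ContinuousOn (linkCoeffDeriv h) unalignedPairs :=
  hh.continuousOn_segmentFDeriv (by fun_prop)

theorem hasFDerivAt_linkCoeff {p : E × E} (hp : p ∈ unalignedPairs) :
    HasFDerivAt (fun x => linkCoeff h (x, p.2)) (linkCoeffDeriv h p) p.1 := by
  have hweight : ∀ r : ℝ, r * (1 - r) ^ 2 = r * (1 - r) * (1 - r) := fun r => by ring
  simp only [linkCoeffDeriv, hweight]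
  exact hh.hasFDerivAt_segmentIntegral_left (by fun_prop) hp

theorem hasFDerivAt_linkPrimitive {p : E × E} (hp : p ∈ unalignedPairs) :
    HasFDerivAt (fun y => linkPrimitive h (p.1, y)) (-linkCoeffDeriv h p) p.2 := by
  refine (hh.hasFDerivAt_segmentIntegral_right (by fun_prop) hp).congr_fderiv ?_
  rw [linkCoeffDeriv, segmentFDeriv, segmentFDeriv, ← intervalIntegral.integral_neg]
  congr! 2 with r
  have hweight : (1 - r) ^ 2 * -r = -(r * (1 - r) ^ 2) := by ring
  rw [hweight]
  exact neg_smul _ _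

theorem linkCoeffDeriv_apply_fst {p : E × E} (hp : p ∈ unalignedPairs) :
    linkCoeffDeriv h p p.1 = -2 * linkCoeff h p := by
  have hparts := hh.segmentFDeriv_apply_add (n := fun r => r * (r * (1 - r) ^ 2))
    (n' := fun r => 2 * r * (1 - r) ^ 2 - 2 * r ^ 2 * (1 - r))
    (fun r => ((hasDerivAt_id r).mul ((hasDerivAt_id r).mul
      (((hasDerivAt_id r).const_sub 1).pow 2))).congr_deriv (by simp; ring))
    (by fun_prop) (by norm_num) (by norm_num) hp
  rw [linkCoeffDeriv, hh.segmentFDeriv_apply_fst (by fun_prop) hp, hparts,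
    ← hh.segmentIntegral_add (by fun_prop) (by fun_prop) hp, linkCoeff, segmentIntegral,
    segmentIntegral, ← intervalIntegral.integral_const_mul]
  congr! 2
  ring

theorem linkCoeffDeriv_apply_snd {p : E × E} (hp : p ∈ unalignedPairs) :
    linkCoeffDeriv h p p.2 = linkPrimitive h p := by
  have hparts := hh.segmentFDeriv_apply_add (n := fun r => (1 - r) * (r * (1 - r) ^ 2))
    (n' := fun r => (1 - r) ^ 3 - 3 * r * (1 - r) ^ 2)
    (fun r => (((hasDerivAt_id r).const_sub 1).mul ((hasDerivAt_id r).mul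
      (((hasDerivAt_id r).const_sub 1).pow 2))).congr_deriv (by simp; ring))
    (by fun_prop) (by norm_num) (by norm_num) hp
  rw [linkCoeffDeriv, hh.segmentFDeriv_apply_snd (by fun_prop) hp, hparts,
    ← hh.segmentIntegral_add (by fun_prop) (by fun_prop) hp, linkPrimitive]
  congr! 2 with r
  ring

end IsGaussKernel

end Kernel

/-! ### The linking form of a loop -/

/-- A closed continuously differentiable curve in 4-space, written as a 1-periodic map. -/
structure IsLoop (X : ℝ → E4) : Prop where
  periodic : Function.Periodic X 1
  contDiff : ContDiff ℝ 1 X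

theorem exists_mem_Icc_of_periodic {α : Type*} {f : ℝ → α} (hf : Function.Periodic f 1) (t : ℝ) :
    ∃ s ∈ Icc (0 : ℝ) 1, f t = f s :=
  let ⟨s, hs, h⟩ := hf.exists_mem_Ico₀ one_pos t
  ⟨s, Ico_subset_Icc_self hs, h⟩

namespace IsLoop

variable {X : ℝ → E4} (hX : IsLoop X)

include hX

theorem continuous : Continuous X := hX.contDiff.continuous

theorem continuous_deriv : Continuous (deriv X) := hX.contDiff.continuous_deriv le_rfl

theorem hasDerivAt (t : ℝ) : HasDerivAt X (deriv X t) t :=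
  (hX.contDiff.differentiable one_ne_zero t).hasDerivAt

theorem deriv_periodic : Function.Periodic (deriv X) 1 := fun t => by
  rw [← deriv_comp_add_const, funext hX.periodic]

theorem continuous_prodMk : Continuous fun z : E4 × ℝ => (z.1, X z.2) := by
  have := hX.continuous
  fun_prop

theorem continuous_det4L_deriv : Continuous fun z : E4 × ℝ => det4L z.1 (X z.2) (deriv X z.2) := by
  have := hX.continuous
  have := hX.continuous_deriv
  exact continuous_det4L.comp (f := fun z : E4 × ℝ => (z.1, X z.2, deriv X z.2)) (by fun_prop)

theorem continuous_det4LL_deriv : Continuous fun z : E4 × ℝ => det4LL (X z.2) (deriv X z.2) := by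
  have := hX.continuous
  have := hX.continuous_deriv
  exact continuous_det4LL.comp (f := fun z : E4 × ℝ => (X z.2, deriv X z.2)) (by fun_prop)

end IsLoop

/-- The complement of the cone over the curve `Y`: the points not aligned with any point of `Y`. -/
def coneCompl (Y : ℝ → E4) : Set E4 := {x | ∀ t, (x, Y t) ∈ unalignedPairs}

theorem isOpen_coneCompl {Y : ℝ → E4} (hY : IsLoop Y) : IsOpen (coneCompl Y) := by
  refine isOpen_iff_mem_nhds.2 fun x hx => ?_
  have hunaligned : ∀ᶠ z in 𝓝 x, ∀ t ∈ Icc (0 : ℝ) 1, (z, Y t) ∈ unalignedPairs :=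
    isCompact_Icc.eventually_forall_of_forall_eventually fun t _ =>
      hY.continuous_prodMk.continuousAt.eventually_mem (isOpen_unalignedPairs.mem_nhds (hx t))
  filter_upwards [hunaligned] with z hz t
  obtain ⟨s, hs, hst⟩ := exists_mem_Icc_of_periodic hY.periodic t
  exact hst ▸ hz s hs

/-- The linking form of the curve `Y` with kernel `h`, a closed 1-form on the complement of the
cone over `Y`. -/
def linkForm (h : E4 → ℝ) (Y : ℝ → E4) (x : E4) : E4 →L[ℝ] ℝ :=
  ∫ t in (0 : ℝ)..1, linkCoeff h (x, Y t) • det4L x (Y t) (deriv Y t)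

/-- The derivative, with respect to `x`, of the integrand of the linking form. -/
def linkFormDeriv (h : E4 → ℝ) (Y : ℝ → E4) (x : E4) (t : ℝ) : E4 →L[ℝ] E4 →L[ℝ] ℝ :=
  linkCoeff h (x, Y t) • det4LL (Y t) (deriv Y t) +
    (linkCoeffDeriv h (x, Y t)).smulRight (det4L x (Y t) (deriv Y t))

/-- The 1-form `η` is exact near each point of `U`. -/
def LocallyExact {E : Type*} [NormedAddCommGroup E] [NormedSpace ℝ E] (η : E → E →L[ℝ] ℝ)
    (U : Set E) : Prop :=
  ∀ x ∈ U, ∃ f : E → ℝ, ∀ᶠ y in 𝓝 x, HasFDerivAt f (η y) y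

section LinkForm

variable {h : E4 → ℝ} (hh : IsGaussKernel h) {Y : ℝ → E4} (hY : IsLoop Y)

include hh hY

theorem continuousOn_linkForm_integrand :
    ContinuousOn (Function.uncurry fun x t => linkCoeff h (x, Y t) • det4L x (Y t) (deriv Y t))
      (coneCompl Y ×ˢ Icc (0 : ℝ) 1) :=
  ContinuousOn.smul (hh.continuousOn_linkCoeff.comp hY.continuous_prodMk.continuousOn
    fun z hz => hz.1 z.2) hY.continuous_det4L_deriv.continuousOn

theorem continuousOn_linkFormDeriv :
    ContinuousOn (linkFormDeriv h Y).uncurry (coneCompl Y ×ˢ Icc (0 : ℝ) 1) := by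
  have hpair : MapsTo (fun z : E4 × ℝ => (z.1, Y z.2)) (coneCompl Y ×ˢ Icc (0 : ℝ) 1)
      unalignedPairs := fun z hz => hz.1 z.2
  have hcoeff := hh.continuousOn_linkCoeff.comp hY.continuous_prodMk.continuousOn hpair
  have hcoeffDeriv := hh.continuousOn_linkCoeffDeriv.comp hY.continuous_prodMk.continuousOn hpair
  refine (hcoeff.smul hY.continuous_det4LL_deriv.continuousOn).add (f := fun z : E4 × ℝ => _)
    (g := fun z : E4 × ℝ =>
      (linkCoeffDeriv h (z.1, Y z.2)).smulRight (det4L z.1 (Y z.2) (deriv Y z.2))) ?_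
  rw [continuousOn_clm_apply]
  intro v
  simp only [ContinuousLinearMap.smulRight_apply]
  exact (hcoeffDeriv.clm_apply continuousOn_const).smul hY.continuous_det4L_deriv.continuousOn

theorem continuousOn_linkForm : ContinuousOn (linkForm h Y) (coneCompl Y) :=
  continuousOn_intervalIntegral_of_continuousOn_uncurry zero_le_one
    (continuousOn_linkForm_integrand hh hY)

theorem hasFDerivAt_linkForm {x : E4} (hx : x ∈ coneCompl Y) :
    HasFDerivAt (linkForm h Y) (∫ t in (0 : ℝ)..1, linkFormDeriv h Y x t) x :=
  hasFDerivAt_intervalIntegral_of_continuousOn_uncurry zero_le_one (isOpen_coneCompl hY)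
    (continuousOn_linkForm_integrand hh hY) (continuousOn_linkFormDeriv hh hY)
    (fun x hx t _ => HasFDerivAt.smul (hh.hasFDerivAt_linkCoeff (p := (x, Y t)) (hx t))
      (det4LL (Y t) (deriv Y t)).hasFDerivAt) hx

theorem intervalIntegrable_linkFormDeriv_apply {x : E4} (hx : x ∈ coneCompl Y) (u v : E4) :
    IntervalIntegrable (fun t => linkFormDeriv h Y x t u v) volume 0 1 :=
  ((((continuousOn_linkFormDeriv hh hY).uncurry_left x hx).clm_apply
    continuousOn_const).clm_apply continuousOn_const).intervalIntegrable_of_Icc zero_le_one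

theorem integral_linkFormDeriv_apply {x : E4} (hx : x ∈ coneCompl Y) (u v : E4) :
    (∫ t in (0 : ℝ)..1, linkFormDeriv h Y x t) u v =
      ∫ t in (0 : ℝ)..1, linkFormDeriv h Y x t u v := by
  have hcont := (continuousOn_linkFormDeriv hh hY).uncurry_left x hx
  rw [ContinuousLinearMap.intervalIntegral_apply (hcont.intervalIntegrable_of_Icc zero_le_one),
    ContinuousLinearMap.intervalIntegral_apply
      ((hcont.clm_apply continuousOn_const).intervalIntegrable_of_Icc zero_le_one)]

/-- The identity comes from expanding the dependent vectors `x`, `Y t`, `u`, `v`, `deriv Y t` by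
Cramer's rule under `linkCoeffDeriv`. -/
theorem hasDerivAt_linkPrimitive_mul_det4 {x : E4} (hx : x ∈ coneCompl Y) (u v : E4) (t : ℝ) :
    HasDerivAt (fun t => linkPrimitive h (x, Y t) * det4 x (Y t) u v)
      (linkFormDeriv h Y x t u v - linkFormDeriv h Y x t v u) t := by
  have hprim : HasDerivAt (fun t => linkPrimitive h (x, Y t))
      (-linkCoeffDeriv h (x, Y t) (deriv Y t)) t :=
    (hh.hasFDerivAt_linkPrimitive (p := (x, Y t)) (hx t)).comp_hasDerivAt t (hY.hasDerivAt t)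
  have hperm : ∀ y : E4, det4 x y u v = det4L u x v y := fun y => by
    simp only [det4L_apply, det4_eq_minors]; ring
  have hdet : HasDerivAt (fun t => det4 x (Y t) u v) (det4 x (deriv Y t) u v) t := by
    simp only [hperm]
    exact (det4L u x v).hasFDerivAt.comp_hasDerivAt t (hY.hasDerivAt t)
  refine (hprim.mul hdet).congr_deriv ?_
  have hcramer := cramer_det4 (linkCoeffDeriv h (x, Y t)) x (Y t) u v (deriv Y t)
  rw [hh.linkCoeffDeriv_apply_fst (p := (x, Y t)) (hx t),
    hh.linkCoeffDeriv_apply_snd (p := (x, Y t)) (hx t)] at hcramer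
  have hY' : det4 x (deriv Y t) u v = det4 x u v (deriv Y t) := by
    simp only [det4_eq_minors]; ring
  have hu : det4 u (Y t) v (deriv Y t) = -det4 (Y t) u v (deriv Y t) := by
    simp only [det4_eq_minors]; ring
  have hv : det4 v (Y t) u (deriv Y t) = det4 (Y t) u v (deriv Y t) := by
    simp only [det4_eq_minors]; ring
  simp only [linkFormDeriv, add_apply, smul_apply, ContinuousLinearMap.smulRight_apply,
    det4LL_apply, det4L_apply, smul_eq_mul, hY', hu, hv]
  linarith

theorem integral_linkFormDeriv_symm {x : E4} (hx : x ∈ coneCompl Y) (u v : E4) :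
    (∫ t in (0 : ℝ)..1, linkFormDeriv h Y x t) u v =
      (∫ t in (0 : ℝ)..1, linkFormDeriv h Y x t) v u := by
  have huv := intervalIntegrable_linkFormDeriv_apply hh hY hx u v
  have hvu := intervalIntegrable_linkFormDeriv_apply hh hY hx v u
  have hclosed : Y 1 = Y 0 := by simpa only [zero_add] using hY.periodic 0
  rw [integral_linkFormDeriv_apply hh hY hx, integral_linkFormDeriv_apply hh hY hx, ← sub_eq_zero,
    ← intervalIntegral.integral_sub huv hvu, intervalIntegral.integral_eq_sub_of_hasDerivAt
      (fun t _ => hasDerivAt_linkPrimitive_mul_det4 hh hY hx u v t) (huv.sub hvu), hclosed,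
    sub_self]

theorem locallyExact_linkForm : LocallyExact (linkForm h Y) (coneCompl Y) := by
  intro x hx
  obtain ⟨ε, hε, hball⟩ := Metric.isOpen_iff.1 (isOpen_coneCompl hY) x hx
  obtain ⟨f, hf⟩ : ∃ f : E4 → ℝ, ∀ a ∈ Metric.ball x ε, HasFDerivAt f (linkForm h Y a) a :=
    (convex_ball x ε).exists_forall_hasFDerivAt_of_fderiv_symmetric Metric.isOpen_ball
      (fun y hy => (hasFDerivAt_linkForm hh hY (hball hy)).differentiableAt.differentiableWithinAt)
      fun y hy u v => by
        rw [(hasFDerivAt_linkForm hh hY (hball hy)).fderiv]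
        exact integral_linkFormDeriv_symm hh hY (hball hy) u v
  exact ⟨f, eventually_of_mem (Metric.ball_mem_nhds x hε) hf⟩

end LinkForm

/-! ### Primitives of a locally exact form along a map -/

section Primitive

variable {E : Type*} [NormedAddCommGroup E] [NormedSpace ℝ E]

/-- On `S`, the function `F` is a primitive of the form `η` pulled back by the map `D`: locally it
is the composition of `D` with a primitive of `η`. -/
def PrimitiveOn {α : Type*} [TopologicalSpace α] (η : E → E →L[ℝ] ℝ) (D : α → E) (F : α → ℝ)
    (S : Set α) : Prop :=
  ∀ a ∈ S, ∃ f : E → ℝ,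
    (∀ᶠ y in 𝓝 (D a), HasFDerivAt f (η y) y) ∧ ∀ᶠ b in 𝓝[S] a, F b = f (D b)

variable {α β : Type*} [TopologicalSpace α] [TopologicalSpace β] {η : E → E →L[ℝ] ℝ}

theorem PrimitiveOn.mono {D : α → E} {F : α → ℝ} {S T : Set α} (hF : PrimitiveOn η D F S)
    (hT : T ⊆ S) : PrimitiveOn η D F T := fun a ha =>
  let ⟨f, hf, hFf⟩ := hF a (hT ha)
  ⟨f, hf, hFf.filter_mono (nhdsWithin_mono a hT)⟩

theorem PrimitiveOn.comp {D : α → E} {F : α → ℝ} {S : Set α} (hF : PrimitiveOn η D F S)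
    {φ : β → α} {T : Set β} (hφ : ContinuousOn φ T) (hT : MapsTo φ T S) :
    PrimitiveOn η (D ∘ φ) (F ∘ φ) T := fun b hb =>
  let ⟨f, hf, hFf⟩ := hF (φ b) (hT hb)
  ⟨f, hf, ((hφ b hb).tendsto_nhdsWithin hT).eventually hFf⟩

theorem PrimitiveOn.congr_map {D D' : α → E} {F : α → ℝ} {S : Set α} (hF : PrimitiveOn η D F S)
    (h : EqOn D D' S) : PrimitiveOn η D' F S := fun a ha => by
  obtain ⟨f, hf, hFf⟩ := hF a ha
  refine ⟨f, h ha ▸ hf, ?_⟩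
  filter_upwards [hFf, self_mem_nhdsWithin] with b hb hS
  rw [hb, h hS]

theorem eventually_sub_eq_const {f g : E → ℝ} {x : E}
    (hf : ∀ᶠ y in 𝓝 x, HasFDerivAt f (η y) y) (hg : ∀ᶠ y in 𝓝 x, HasFDerivAt g (η y) y) :
    ∀ᶠ y in 𝓝 x, f y - g y = f x - g x := by
  obtain ⟨ε, hε, hball⟩ := Metric.eventually_nhds_iff_ball.1 (hf.and hg)
  have hderiv : ∀ z ∈ Metric.ball x ε, HasFDerivAt (fun y => f y - g y) (0 : E →L[ℝ] ℝ) z :=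
    fun z hz => ((hball z hz).1.sub (hball z hz).2).congr_fderiv (sub_self _)
  filter_upwards [Metric.ball_mem_nhds x hε] with y hy
  exact (convex_ball x ε).is_const_of_fderivWithin_eq_zero (𝕜 := ℝ) (f := fun y => f y - g y)
    (fun z hz => (hderiv z hz).differentiableAt.differentiableWithinAt)
    (fun z hz => (hderiv z hz).hasFDerivWithinAt.fderivWithin
      (Metric.isOpen_ball.uniqueDiffOn z hz)) hy (Metric.mem_ball_self hε)

theorem PrimitiveOn.sub_eq_const {D : α → E} {F G : α → ℝ} {S : Set α} (hS : IsPreconnected S)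
    (hD : ContinuousOn D S) (hF : PrimitiveOn η D F S) (hG : PrimitiveOn η D G S) {a b : α}
    (ha : a ∈ S) (hb : b ∈ S) : F a - G a = F b - G b := by
  have := isPreconnected_iff_preconnectedSpace.1 hS
  have hconst : IsLocallyConstant fun a : S => F a - G a := by
    rw [IsLocallyConstant.iff_eventually_eq]
    rintro ⟨a, ha⟩
    rw [eventually_nhds_subtype_iff S ⟨a, ha⟩ fun b => F b - G b = F a - G a]
    obtain ⟨f, hf, hFf⟩ := hF a ha
    obtain ⟨g, hg, hGg⟩ := hG a ha
    filter_upwards [hFf, hGg, (hD a ha).eventually (eventually_sub_eq_const hf hg)]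
      with b hFb hGb hfg
    rw [hFb, hGb, hFf.self_of_nhdsWithin ha, hGg.self_of_nhdsWithin ha, hfg]
  exact hconst.apply_eq_of_preconnectedSpace ⟨a, ha⟩ ⟨b, hb⟩

end Primitive

section Union

variable {E α : Type*} [NormedAddCommGroup E] [NormedSpace ℝ E] [TopologicalSpace α]
  {η : E → E →L[ℝ] ℝ} {D : α → E} {F G : α → ℝ} {S T : Set α}

theorem PrimitiveOn.congr (hF : PrimitiveOn η D F S) (h : EqOn G F S) : PrimitiveOn η D G S :=
  fun a ha => by
    obtain ⟨f, hf, hFf⟩ := hF a ha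
    refine ⟨f, hf, ?_⟩
    filter_upwards [hFf, self_mem_nhdsWithin] with b hb hS
    rw [h hS, hb]

theorem PrimitiveOn.add_const (hF : PrimitiveOn η D F S) (k : ℝ) :
    PrimitiveOn η D (fun a => F a + k) S := fun a ha => by
  obtain ⟨f, hf, hFf⟩ := hF a ha
  exact ⟨fun y => f y + k, hf.mono fun y hy => hy.add_const k,
    hFf.mono fun b hb => congrArg (· + k) hb⟩

theorem PrimitiveOn.eventually_eq_union (hT : IsClosed T) (hD : ContinuousOn D T)
    (hFS : PrimitiveOn η D F S) (hFT : PrimitiveOn η D F T) {a : α} (ha : a ∈ S) :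
    ∃ f : E → ℝ, (∀ᶠ y in 𝓝 (D a), HasFDerivAt f (η y) y) ∧
      ∀ᶠ b in 𝓝[S ∪ T] a, F b = f (D b) := by
  obtain ⟨f, hf, hFf⟩ := hFS a ha
  refine ⟨f, hf, ?_⟩
  rw [nhdsWithin_union, eventually_sup]
  refine ⟨hFf, ?_⟩
  by_cases haT : a ∈ T
  · obtain ⟨g, hg, hFg⟩ := hFT a haT
    have hfa := hFf.self_of_nhdsWithin ha
    have hga := hFg.self_of_nhdsWithin haT
    filter_upwards [hFg, (hD a haT).eventually (eventually_sub_eq_const hf hg)] with b hb hfg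
    linarith
  · rw [notMem_closure_iff_nhdsWithin_eq_bot.1 (by rwa [hT.closure_eq])]
    exact eventually_bot

theorem PrimitiveOn.union (hS : IsClosed S) (hT : IsClosed T) (hD : ContinuousOn D (S ∪ T))
    (hFS : PrimitiveOn η D F S) (hFT : PrimitiveOn η D F T) : PrimitiveOn η D F (S ∪ T) := by
  rintro a (ha | ha)
  · exact hFS.eventually_eq_union hT (hD.mono subset_union_right) hFT ha
  · rw [union_comm]
    exact hFT.eventually_eq_union hS (hD.mono subset_union_left) hFS ha

theorem PrimitiveOn.exists_union (hS : IsClosed S) (hT : IsClosed T)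
    (hST : IsPreconnected (S ∩ T)) (hD : ContinuousOn D (S ∪ T)) (hF : PrimitiveOn η D F S)
    (hG : PrimitiveOn η D G T) : ∃ H, PrimitiveOn η D H (S ∪ T) := by
  classical
  obtain ⟨k, hk⟩ : ∃ k, ∀ a ∈ S ∩ T, F a = G a + k := by
    rcases (S ∩ T).eq_empty_or_nonempty with hempty | ⟨c, hc⟩
    · exact ⟨0, fun a ha => absurd ha (hempty ▸ notMem_empty a)⟩
    · exact ⟨F c - G c, fun a ha => by
        linarith [(hF.mono inter_subset_left).sub_eq_const hST
          (hD.mono (inter_subset_left.trans subset_union_left)) (hG.mono inter_subset_right) ha hc]⟩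
  refine ⟨S.piecewise F fun a => G a + k, PrimitiveOn.union hS hT hD
    (hF.congr fun a ha => piecewise_eq_of_mem _ _ _ ha) ((hG.add_const k).congr fun a ha => ?_)⟩
  by_cases haS : a ∈ S
  · rw [piecewise_eq_of_mem _ _ _ haS, hk a ⟨haS, ha⟩]
  · exact piecewise_eq_of_notMem _ _ _ haS

theorem unitInterval_induction {q : ℝ → ℝ → Prop}
    (hadd : ∀ a b c, 0 ≤ a → a ≤ b → b ≤ c → c ≤ 1 → q a b → q b c → q a c)
    (hloc : ∀ x ∈ Icc (0 : ℝ) 1, ∃ ε > 0, ∀ a b, 0 ≤ a → a ≤ b → b ≤ 1 → x - ε < a → b < x + ε →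
      q a b) : q 0 1 := by
  choose! ε hε hq using hloc
  obtain ⟨t, ht0, hmono, ⟨m, hm⟩, hcover⟩ := exists_monotone_Icc_subset_open_cover_Icc
    (zero_le_one' ℝ) (c := fun x : Icc (0 : ℝ) 1 => {y | (y : ℝ) ∈ Metric.ball (x : ℝ) (ε x)})
    (fun x => Metric.isOpen_ball.preimage continuous_subtype_val)
    fun x _ => mem_iUnion.2 ⟨x, Metric.mem_ball_self (hε x x.2)⟩
  have hsub : ∀ n, q (t n) (t (n + 1)) := fun n => by
    obtain ⟨x, hx⟩ := hcover n
    have hle := hmono (Nat.le_succ n)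
    have hleft : (t n : ℝ) ∈ Metric.ball (x : ℝ) (ε x) := hx (left_mem_Icc.2 hle)
    have hright : (t (n + 1) : ℝ) ∈ Metric.ball (x : ℝ) (ε x) := hx (right_mem_Icc.2 hle)
    rw [Real.ball_eq_Ioo] at hleft hright
    exact hq x x.2 _ _ (t n).2.1 hle (t (n + 1)).2.2 hleft.1 hright.2
  have hinit : ∀ n, q 0 (t (n + 1)) := fun n => by
    induction n with
    | zero => simpa only [ht0] using hsub 0
    | succ n ih =>
      exact hadd _ _ _ le_rfl (t (n + 1)).2.1 (hmono (Nat.le_succ _)) (t _).2.2 ih (hsub (n + 1))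
  simpa only [hm (m + 1) (Nat.le_succ m)] using hinit m

end Union

section Square

variable {E : Type*} [NormedAddCommGroup E] [NormedSpace ℝ E] {η : E → E →L[ℝ] ℝ}
  {D : ℝ × ℝ → E} {F G : ℝ × ℝ → ℝ} {a b c : ℝ} {R : Set ℝ}

theorem PrimitiveOn.exists_Icc_prod (hab : a ≤ b) (hbc : b ≤ c) (hR : IsClosed R)
    (hR' : IsPreconnected R) (hD : ContinuousOn D (Icc a c ×ˢ R))
    (hF : PrimitiveOn η D F (Icc a b ×ˢ R)) (hG : PrimitiveOn η D G (Icc b c ×ˢ R)) :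
    ∃ H, PrimitiveOn η D H (Icc a c ×ˢ R) := by
  rw [← Icc_union_Icc_eq_Icc hab hbc, union_prod] at hD ⊢
  refine hF.exists_union (isClosed_Icc.prod hR) (isClosed_Icc.prod hR) ?_ hD hG
  rw [← inter_prod, Icc_inter_Icc]
  exact isPreconnected_Icc.prod hR'

theorem PrimitiveOn.exists_prod_Icc (hab : a ≤ b) (hbc : b ≤ c) (hR : IsClosed R)
    (hR' : IsPreconnected R) (hD : ContinuousOn D (R ×ˢ Icc a c))
    (hF : PrimitiveOn η D F (R ×ˢ Icc a b)) (hG : PrimitiveOn η D G (R ×ˢ Icc b c)) :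
    ∃ H, PrimitiveOn η D H (R ×ˢ Icc a c) := by
  rw [← Icc_union_Icc_eq_Icc hab hbc, prod_union] at hD ⊢
  refine hF.exists_union (hR.prod isClosed_Icc) (hR.prod isClosed_Icc) ?_ hD hG
  rw [← prod_inter, Icc_inter_Icc]
  exact hR'.prod isPreconnected_Icc

namespace LocallyExact

variable {U : Set E} (hη : LocallyExact η U) (hD : ContinuousOn D unitSquare)
  (hDU : MapsTo D unitSquare U)

include hη hD hDU

theorem exists_primitiveOn_ball {p : ℝ × ℝ} (hp : p ∈ unitSquare) :
    ∃ ε > 0, ∃ F, PrimitiveOn η D F (Metric.ball p ε ∩ unitSquare) := by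
  obtain ⟨f, hf⟩ := hη (D p) (hDU hp)
  obtain ⟨ε, hε, hball⟩ := Metric.mem_nhdsWithin_iff.1
    ((hD p hp).eventually (eventually_eventually_nhds.2 hf))
  exact ⟨ε, hε, f ∘ D, fun q hq => ⟨f, hball hq, Eventually.of_forall fun _ => rfl⟩⟩

theorem exists_primitiveOn_strip {y : ℝ} (hy : y ∈ Icc (0 : ℝ) 1) :
    ∃ ε > 0, ∀ c d, 0 ≤ c → c ≤ d → d ≤ 1 → y - ε < c → d < y + ε →
      ∃ F, PrimitiveOn η D F (Icc 0 1 ×ˢ Icc c d) := by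
  refine unitInterval_induction (q := fun a b => ∃ ε > 0, ∀ c d, 0 ≤ c → c ≤ d → d ≤ 1 →
    y - ε < c → d < y + ε → ∃ F, PrimitiveOn η D F (Icc a b ×ˢ Icc c d)) ?_ ?_
  · rintro a b c h0 hab hbc h1 ⟨ε, hε, hleft⟩ ⟨ε', hε', hright⟩
    refine ⟨min ε ε', lt_min hε hε', fun u v hu huv hv huy hvy => ?_⟩
    obtain ⟨F, hF⟩ := hleft u v hu huv hv (by linarith [min_le_left ε ε'])
      (by linarith [min_le_left ε ε'])
    obtain ⟨G, hG⟩ := hright u v hu huv hv (by linarith [min_le_right ε ε'])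
      (by linarith [min_le_right ε ε'])
    exact hF.exists_Icc_prod hab hbc isClosed_Icc isPreconnected_Icc
      (hD.mono (prod_mono (Icc_subset_Icc h0 h1) (Icc_subset_Icc hu hv))) hG
  · intro x hx
    obtain ⟨ε, hε, F, hF⟩ := hη.exists_primitiveOn_ball hD hDU (p := (x, y)) ⟨hx, hy⟩
    refine ⟨ε, hε, fun a b h0 _ h1 hxa hbx =>
      ⟨ε, hε, fun c d hc _ hd hyc hdy => ⟨F, hF.mono ?_⟩⟩⟩
    refine subset_inter ?_ (prod_mono (Icc_subset_Icc h0 h1) (Icc_subset_Icc hc hd))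
    rw [← ball_prod_same, Real.ball_eq_Ioo, Real.ball_eq_Ioo]
    exact prod_mono (Icc_subset_Ioo hxa hbx) (Icc_subset_Ioo hyc hdy)

theorem exists_primitiveOn_square : ∃ F, PrimitiveOn η D F unitSquare := by
  refine unitInterval_induction (q := fun c d => ∃ F, PrimitiveOn η D F (Icc 0 1 ×ˢ Icc c d)) ?_
    fun y hy => hη.exists_primitiveOn_strip hD hDU hy
  rintro a b c h0 hab hbc h1 ⟨F, hF⟩ ⟨G, hG⟩
  exact hF.exists_prod_Icc hab hbc isClosed_Icc isPreconnected_Icc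
    (hD.mono (prod_mono subset_rfl (Icc_subset_Icc h0 h1))) hG

end LocallyExact

theorem primitiveOn_integral {U : Set E} (hη : LocallyExact η U) (hηU : ContinuousOn η U)
    {X : ℝ → E} (hX : ContDiff ℝ 1 X) (hXU : ∀ t, X t ∈ U) :
    PrimitiveOn η X (fun s => ∫ t in (0 : ℝ)..s, η (X t) (deriv X t)) univ := by
  have hcont : Continuous fun t => η (X t) (deriv X t) :=
    (hηU.comp_continuous hX.continuous hXU).clm_apply (hX.continuous_deriv le_rfl)
  intro s _
  obtain ⟨f, hf⟩ := hη (X s) (hXU s)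
  set F : ℝ → ℝ := fun s => ∫ t in (0 : ℝ)..s, η (X t) (deriv X t)
  have hF : ∀ s, HasDerivAt F (η (X s) (deriv X s)) s := fun s =>
    (hcont.integral_hasStrictDerivAt 0 s).hasDerivAt
  refine ⟨fun y => f y + (F s - f (X s)), hf.mono fun y hy => hy.add_const _, ?_⟩
  obtain ⟨ε, hε, hball⟩ :=
    Metric.eventually_nhds_iff_ball.1 (hX.continuous.continuousAt.eventually hf)
  have hderiv : ∀ t ∈ Metric.ball s ε, HasDerivAt (fun t => F t - f (X t)) 0 t := fun t ht =>
    ((hF t).sub ((hball t ht).comp_hasDerivAt t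
      (hX.differentiable one_ne_zero t).hasDerivAt)).congr_deriv (sub_self _)
  rw [nhdsWithin_univ]
  filter_upwards [Metric.ball_mem_nhds s hε] with b hb
  have hconst : F b - f (X b) = F s - f (X s) := Metric.isOpen_ball.is_const_of_deriv_eq_zero
    (convex_ball s ε).isPreconnected
    (fun t ht => (hderiv t ht).differentiableAt.differentiableWithinAt)
    (fun t ht => (hderiv t ht).deriv) hb (Metric.mem_ball_self hε)
  linarith

theorem LocallyExact.integral_eq_sub_of_primitiveOn {U : Set E} (hη : LocallyExact η U)
    (hηU : ContinuousOn η U) {X : ℝ → E} (hX : ContDiff ℝ 1 X) (hXU : ∀ t, X t ∈ U) {F : ℝ → ℝ}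
    (hF : PrimitiveOn η X F (Icc 0 1)) :
    ∫ t in (0 : ℝ)..1, η (X t) (deriv X t) = F 1 - F 0 := by
  have hconst := ((primitiveOn_integral hη hηU hX hXU).mono (subset_univ _)).sub_eq_const
    isPreconnected_Icc hX.continuous.continuousOn hF (left_mem_Icc.2 zero_le_one)
    (right_mem_Icc.2 zero_le_one)
  rw [intervalIntegral.integral_same] at hconst
  linarith

theorem LocallyExact.integral_eq_of_homotopy {U : Set E} (hη : LocallyExact η U)
    (hηU : ContinuousOn η U) {X X' : ℝ → E} (hX : ContDiff ℝ 1 X) (hX' : ContDiff ℝ 1 X')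
    (hXU : ∀ t, X t ∈ U) (hXU' : ∀ t, X' t ∈ U) (hD : Continuous D) (hDU : MapsTo D unitSquare U)
    (hD0 : ∀ t, D (0, t) = X t) (hD1 : ∀ t, D (1, t) = X' t)
    (hclosed : ∀ r, D (r, 1) = D (r, 0)) :
    ∫ t in (0 : ℝ)..1, η (X t) (deriv X t) = ∫ t in (0 : ℝ)..1, η (X' t) (deriv X' t) := by
  obtain ⟨F, hF⟩ := hη.exists_primitiveOn_square hD.continuousOn hDU
  have h0 : (0 : ℝ) ∈ Icc (0 : ℝ) 1 := left_mem_Icc.2 zero_le_one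
  have h1 : (1 : ℝ) ∈ Icc (0 : ℝ) 1 := right_mem_Icc.2 zero_le_one
  have hleft := (hF.comp (φ := fun t => ((0 : ℝ), t)) (by fun_prop)
    fun t ht => mk_mem_prod h0 ht).congr_map fun t _ => hD0 t
  have hright := (hF.comp (φ := fun t => ((1 : ℝ), t)) (by fun_prop)
    fun t ht => mk_mem_prod h1 ht).congr_map fun t _ => hD1 t
  have hbottom := hF.comp (φ := fun r => (r, (0 : ℝ))) (T := Icc 0 1) (by fun_prop)
    fun r hr => mk_mem_prod hr h0
  have htop := (hF.comp (φ := fun r => (r, (1 : ℝ))) (by fun_prop)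
    fun r hr => mk_mem_prod hr h1).congr_map fun r _ => hclosed r
  have hsides := htop.sub_eq_const isPreconnected_Icc (by fun_prop) hbottom h0 h1
  rw [hη.integral_eq_sub_of_primitiveOn hηU hX hXU hleft,
    hη.integral_eq_sub_of_primitiveOn hηU hX' hXU' hright]
  simp only [Function.comp_apply] at hsides ⊢
  linarith

end Square

/-! ### The Gauss integral and its homotopy invariance -/

/-- The Gauss integral of two closed curves in 4-space with kernel `h`. -/
def gaussIntegral (h : E4 → ℝ) (X Y : ℝ → E4) : ℝ :=
  ∫ s in (0 : ℝ)..1, linkForm h Y (X s) (deriv X s)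

/-- No point of the first curve lies on a common closed ray from the origin with a point of the
second. -/
def UnalignedCurves (X Y : ℝ → E4) : Prop := ∀ s t, (X s, Y t) ∈ unalignedPairs

theorem UnalignedCurves.symm {X Y : ℝ → E4} (h : UnalignedCurves X Y) : UnalignedCurves Y X :=
  fun s t => swap_mem_unalignedPairs (h t s)

theorem UnalignedCurves.exists_thickening {X Y : ℝ → E4} (h : UnalignedCurves X Y)
    (hX : IsLoop X) (hY : IsLoop Y) :
    ∃ δ > 0, ∀ x y s t, dist x (X s) < δ → dist y (Y t) < δ → (x, y) ∈ unalignedPairs := by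
  have := hX.continuous
  have := hY.continuous
  obtain ⟨δ, hδ, hsub⟩ := ((isCompact_Icc (a := (0 : ℝ)) (b := 1)).prod
      (isCompact_Icc (a := (0 : ℝ)) (b := 1))).image
    (f := fun z : ℝ × ℝ => (X z.1, Y z.2)) (by fun_prop) |>.exists_thickening_subset_open
    isOpen_unalignedPairs (image_subset_iff.2 fun z _ => h z.1 z.2)
  refine ⟨δ, hδ, fun x y s t hx hy => ?_⟩
  obtain ⟨s', hs', hs⟩ := exists_mem_Icc_of_periodic hX.periodic s
  obtain ⟨t', ht', ht⟩ := exists_mem_Icc_of_periodic hY.periodic t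
  exact hsub (Metric.mem_thickening_iff.2
    ⟨(X s, Y t), ⟨(s', t'), ⟨hs', ht'⟩, by rw [hs, ht]⟩, max_lt hx hy⟩)

theorem eventually_forall_dist_lt_of_periodic {T M : Type*} [TopologicalSpace T]
    [PseudoMetricSpace M] {Z : T → ℝ → M} (hZ : Continuous (Function.uncurry Z))
    (hper : ∀ τ, Function.Periodic (Z τ) 1) (τ₀ : T) {δ : ℝ} (hδ : 0 < δ) :
    ∀ᶠ τ in 𝓝 τ₀, ∀ s, dist (Z τ s) (Z τ₀ s) < δ := by
  have hdist : Continuous fun z : T × ℝ => dist (Z z.1 z.2) (Z τ₀ z.2) :=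
    hZ.dist (hZ.comp (f := fun z : T × ℝ => (τ₀, z.2)) (by fun_prop))
  filter_upwards [isCompact_Icc.eventually_forall_of_forall_eventually
    (P := fun τ s => dist (Z τ s) (Z τ₀ s) < δ) (K := Icc (0 : ℝ) 1) fun s _ =>
      hdist.continuousAt.eventually_lt_const (by simpa only [dist_self])] with τ hτ s
  obtain ⟨s', hs', hss'⟩ := exists_mem_Icc_of_periodic
    (f := fun s => dist (Z τ s) (Z τ₀ s)) (fun s => congrArg₂ dist (hper τ s) (hper τ₀ s)) s
  exact hss'.trans_lt (hτ s' hs')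

section GaussIntegral

variable {h : E4 → ℝ} (hh : IsGaussKernel h) {X X' Y : ℝ → E4} (hX : IsLoop X) (hX' : IsLoop X')
  (hY : IsLoop Y)

include hh hX hY in
theorem continuous_gaussIntegrand (hXY : UnalignedCurves X Y) :
    Continuous fun z : ℝ × ℝ =>
      linkCoeff h (X z.1, Y z.2) * det4 (X z.1) (Y z.2) (deriv X z.1) (deriv Y z.2) := by
  have := hX.continuous
  have := hY.continuous
  have := hX.continuous_deriv
  have := hY.continuous_deriv
  exact (hh.continuousOn_linkCoeff.comp_continuous (f := fun z : ℝ × ℝ => (X z.1, Y z.2))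
    (by fun_prop) fun z => hXY _ _).mul (by fun_prop)

include hh hY in
theorem gaussIntegral_eq (hXY : UnalignedCurves X Y) :
    gaussIntegral h X Y = ∫ s in (0 : ℝ)..1, ∫ t in (0 : ℝ)..1,
      linkCoeff h (X s, Y t) * det4 (X s) (Y t) (deriv X s) (deriv Y t) :=
  intervalIntegral.integral_congr fun s _ => ContinuousLinearMap.intervalIntegral_apply
    (intervalIntegrable_of_continuousOn_uncurry zero_le_one
      (continuousOn_linkForm_integrand hh hY) (hXY s)) _

include hh hX hY in
theorem gaussIntegral_swap (hXY : UnalignedCurves X Y) :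
    gaussIntegral h X Y = gaussIntegral (fun v => h (-v)) Y X := by
  have hint : IntegrableOn (Function.uncurry fun s t => linkCoeff h (X s, Y t) *
      det4 (X s) (Y t) (deriv X s) (deriv Y t)) (uIoc 0 1 ×ˢ uIoc 0 1) := by
    rw [uIoc_of_le zero_le_one]
    exact ((continuous_gaussIntegrand hh hX hY hXY).continuousOn.integrableOn_compact
      (isCompact_Icc.prod isCompact_Icc)).mono_set
      (prod_mono Ioc_subset_Icc_self Ioc_subset_Icc_self)
  rw [gaussIntegral_eq hh hY hXY, gaussIntegral_eq hh.comp_neg hX hXY.symm,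
    intervalIntegral_intervalIntegral_swap hint]
  refine intervalIntegral.integral_congr fun t _ => intervalIntegral.integral_congr fun s _ => ?_
  simp only [linkCoeff_swap h (X s), det4_eq_minors]
  ring

include hh hX hX' hY in
theorem gaussIntegral_eq_of_segment_subset (hs : ∀ s, segment ℝ (X s) (X' s) ⊆ coneCompl Y) :
    gaussIntegral h X Y = gaussIntegral h X' Y := by
  have := hX.continuous
  have := hX'.continuous
  refine (locallyExact_linkForm hh hY).integral_eq_of_homotopy (continuousOn_linkForm hh hY)
    (D := fun p => (1 - p.1) • X p.2 + p.1 • X' p.2) hX.contDiff hX'.contDiff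
    (fun s => hs s (left_mem_segment ℝ _ _)) (fun s => hs s (right_mem_segment ℝ _ _))
    (by fun_prop) (fun p hp => hs p.2 ⟨1 - p.1, p.1, sub_nonneg.2 hp.1.2, hp.1.1, by ring, rfl⟩)
    (fun t => by simp) (fun t => by simp) fun r => ?_
  simp only [← hX.periodic 0, ← hX'.periodic 0, zero_add]

end GaussIntegral

theorem gaussIntegral_eq_of_homotopy {h : E4 → ℝ} (hh : IsGaussKernel h) {T : Type*}
    [TopologicalSpace T] [PreconnectedSpace T] {X Y : T → ℝ → E4}
    (hX : Continuous (Function.uncurry X)) (hY : Continuous (Function.uncurry Y))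
    (hXloop : ∀ τ, IsLoop (X τ)) (hYloop : ∀ τ, IsLoop (Y τ))
    (hXY : ∀ τ, UnalignedCurves (X τ) (Y τ)) (τ τ' : T) :
    gaussIntegral h (X τ) (Y τ) = gaussIntegral h (X τ') (Y τ') := by
  suffices hconst : IsLocallyConstant fun τ => gaussIntegral h (X τ) (Y τ) from
    hconst.apply_eq_of_preconnectedSpace τ τ'
  rw [IsLocallyConstant.iff_eventually_eq]
  intro τ₀
  obtain ⟨δ, hδ, hthick⟩ := (hXY τ₀).exists_thickening (hXloop τ₀) (hYloop τ₀)
  have hsegment : ∀ {a b x : E4}, dist a b < δ → x ∈ segment ℝ a b → dist x b < δ :=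
    fun hab hx => (convex_ball _ δ).segment_subset hab (Metric.mem_ball_self hδ) hx
  have hself : ∀ x : E4, dist x x < δ := fun x => by rwa [dist_self]
  filter_upwards [eventually_forall_dist_lt_of_periodic hX (fun τ => (hXloop τ).periodic) τ₀ hδ,
    eventually_forall_dist_lt_of_periodic hY (fun τ => (hYloop τ).periodic) τ₀ hδ] with τ hXτ hYτ
  calc gaussIntegral h (X τ) (Y τ)
    _ = gaussIntegral h (X τ₀) (Y τ) :=
      gaussIntegral_eq_of_segment_subset hh (hXloop τ) (hXloop τ₀) (hYloop τ) fun s x hx t =>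
        hthick _ _ s t (hsegment (hXτ s) hx) (hYτ t)
    _ = gaussIntegral (fun v => h (-v)) (Y τ) (X τ₀) :=
      gaussIntegral_swap hh (hXloop τ₀) (hYloop τ) fun s t => hthick _ _ s t (hself _) (hYτ t)
    _ = gaussIntegral (fun v => h (-v)) (Y τ₀) (X τ₀) :=
      gaussIntegral_eq_of_segment_subset hh.comp_neg (hYloop τ) (hYloop τ₀) (hXloop τ₀)
        fun t y hy s => swap_mem_unalignedPairs (hthick _ _ s t (hself _) (hsegment (hYτ t) hy))
    _ = gaussIntegral h (X τ₀) (Y τ₀) :=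
      (gaussIntegral_swap hh (hXloop τ₀) (hYloop τ₀) (hXY τ₀)).symm

/-! ### Linear changes of coordinates -/

theorem det4_map (L : E4 →L[ℝ] E4) (x y v w : E4) :
    det4 (L x) (L y) (L v) (L w) = L.det * det4 x y v w := by
  obtain ⟨M, hM⟩ := Matrix.toEuclideanLin.surjective (L : E4 →ₗ[ℝ] E4)
  have hdet : L.det = M.det := by
    rw [ContinuousLinearMap.det, ← hM]
    exact (congrArg LinearMap.det (DFunLike.congr_fun (Matrix.toLpLin_eq_toLin 2 2) M)).trans
      (LinearMap.det_toLin _ _)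
  have happly : ∀ z, L z = WithLp.toLp 2 (M.mulVec z.ofLp) := fun z => DFunLike.congr_fun hM.symm z
  simp only [happly, hdet, det4_mulVec]

theorem IsLoop.clm_comp {X : ℝ → E4} (hX : IsLoop X) (L : E4 →L[ℝ] E4) :
    IsLoop fun t => L (X t) where
  periodic t := congrArg L (hX.periodic t)
  contDiff := L.contDiff.comp hX.contDiff

theorem UnalignedCurves.clm_comp {X Y : ℝ → E4} (h : UnalignedCurves X Y) {L : E4 →L[ℝ] E4}
    (hL : Function.Injective L) : UnalignedCurves (fun t => L (X t)) fun t => L (Y t) :=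
  fun s t => mt hL.sameRay_map_iff.1 (h s t)

theorem linkCoeff_map (h : E4 → ℝ) (L : E4 →L[ℝ] E4) (x y : E4) :
    linkCoeff h (L x, L y) = linkCoeff (fun v => h (L v)) (x, y) := by
  simp only [linkCoeff, segmentIntegral, map_sub, map_smul]

theorem gaussIntegral_map {h : E4 → ℝ} (hh : IsGaussKernel h) {L : E4 →L[ℝ] E4}
    (hL : Function.Injective L) {X Y : ℝ → E4} (hX : IsLoop X) (hY : IsLoop Y)
    (hXY : UnalignedCurves X Y) :
    gaussIntegral h (fun t => L (X t)) (fun t => L (Y t)) =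
      L.det * gaussIntegral (fun v => h (L v)) X Y := by
  have hderiv : ∀ {Z : ℝ → E4}, IsLoop Z → ∀ t, deriv (fun t => L (Z t)) t = L (deriv Z t) :=
    fun hZ t => (L.hasFDerivAt.comp_hasDerivAt t (hZ.hasDerivAt t)).deriv
  rw [gaussIntegral_eq hh (hY.clm_comp L) (hXY.clm_comp hL),
    gaussIntegral_eq (hh.comp_clm hL) hY hXY]
  simp only [← intervalIntegral.integral_const_mul, hderiv hX, hderiv hY, det4_map, linkCoeff_map,
    mul_left_comm]

/-! ### Kernels concentrated near a direction -/

section ConeKernel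

variable {E : Type*} [NormedAddCommGroup E] [InnerProductSpace ℝ E]

/-- The kernel with angular profile `θ` around the direction `u`: its value at a unit vector `v` is
`θ ⟪u, v⟫`, and it is homogeneous of degree `-4`. -/
def coneKernel (θ : ℝ → ℝ) (u v : E) : ℝ := θ (inner ℝ u v / ‖v‖) / ‖v‖ ^ 4

theorem coneKernel_smul (θ : ℝ → ℝ) (u v : E) {c : ℝ} (hc : 0 < c) :
    coneKernel θ u (c • v) = coneKernel θ u v / c ^ 4 := by
  unfold coneKernel
  rw [inner_smul_right, norm_smul, Real.norm_of_nonneg hc.le, mul_div_mul_left _ _ hc.ne', mul_pow,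
    div_div, mul_comm (c ^ 4)]

theorem coneKernel_neg (θ : ℝ → ℝ) (u v : E) : coneKernel θ u (-v) = coneKernel θ (-u) v := by
  simp only [coneKernel, inner_neg_left, inner_neg_right, norm_neg]

theorem coneKernel_map (θ : ℝ → ℝ) (L : E →ₗᵢ[ℝ] E) (u v : E) :
    coneKernel θ (L u) (L v) = coneKernel θ u v := by
  simp only [coneKernel, L.inner_map_map, L.norm_map]

variable {θ : ℝ → ℝ} (hθ : ContDiff ℝ 1 θ) (u : E)

include hθ

theorem contDiffAt_coneKernel {v : E} (hv : v ≠ 0) : ContDiffAt ℝ 1 (coneKernel θ u) v := by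
  have hnorm : ContDiffAt ℝ 1 (fun v : E => ‖v‖) v := contDiffAt_norm ℝ hv
  have hinner : ContDiffAt ℝ 1 (fun v : E => inner ℝ u v) v :=
    contDiffAt_const.inner ℝ contDiffAt_id
  exact (hθ.contDiffAt.comp v (hinner.div hnorm (norm_ne_zero_iff.2 hv))).div (hnorm.pow 4)
    (pow_ne_zero 4 (norm_ne_zero_iff.2 hv))

theorem fderiv_coneKernel_apply_self {v : E} (hv : v ≠ 0) :
    fderiv ℝ (coneKernel θ u) v v = -4 * coneKernel θ u v := by
  have hline : HasDerivAt (fun c : ℝ => c • v) v 1 := by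
    simpa only [id, one_smul] using (hasDerivAt_id (1 : ℝ)).smul_const v
  have hkernel : HasFDerivAt (coneKernel θ u) (fderiv ℝ (coneKernel θ u) v) ((1 : ℝ) • v) := by
    rw [one_smul]
    exact ((contDiffAt_coneKernel hθ u hv).differentiableAt one_ne_zero).hasFDerivAt
  have hpow : HasDerivAt (fun c : ℝ => coneKernel θ u v / c ^ 4) (-4 * coneKernel θ u v) 1 :=
    ((hasDerivAt_const (1 : ℝ) (coneKernel θ u v)).div (hasDerivAt_pow 4 (1 : ℝ))
      (by norm_num)).congr_deriv (by norm_num; ring)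
  refine (hkernel.comp_hasDerivAt 1 hline).unique (hpow.congr_of_eventuallyEq ?_)
  filter_upwards [lt_mem_nhds (zero_lt_one' ℝ)] with c hc using coneKernel_smul θ u v hc

theorem isGaussKernel_coneKernel : IsGaussKernel (coneKernel θ u) where
  smooth _ hv := (contDiffAt_coneKernel hθ u hv).contDiffWithinAt
  euler _ hv := fderiv_coneKernel_apply_self hθ u hv

end ConeKernel

theorem gaussIntegral_coneKernel_map {θ : ℝ → ℝ} (hθ : ContDiff ℝ 1 θ) (u : E4)
    (L : E4 →ₗᵢ[ℝ] E4) {X Y : ℝ → E4} (hX : IsLoop X) (hY : IsLoop Y)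
    (hXY : UnalignedCurves X Y) :
    gaussIntegral (coneKernel θ (L u)) (fun t => L (X t)) (fun t => L (Y t)) =
      LinearMap.det L.toLinearMap * gaussIntegral (coneKernel θ u) X Y := by
  rw [← funext (coneKernel_map θ L u)]
  exact gaussIntegral_map (isGaussKernel_coneKernel hθ (L u)) (L := L.toContinuousLinearMap)
    L.injective hX hY hXY

/-! ### Independence of the direction -/

section Reflection

variable {E : Type*} [NormedAddCommGroup E] [InnerProductSpace ℝ E]

theorem reflection_orthogonal_singleton_apply (v x : E) :
    (ℝ ∙ v)ᗮ.reflection x = x - (2 * (inner ℝ v x / ‖v‖ ^ 2)) • v := by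
  rw [Submodule.reflection_orthogonal_apply, Submodule.reflection_singleton_apply]
  simp only [RCLike.ofReal_real_eq_id, id]
  module

theorem det_reflection_orthogonal_singleton [FiniteDimensional ℝ E] {v : E} (hv : v ≠ 0) :
    LinearMap.det ((ℝ ∙ v)ᗮ.reflection.toLinearMap : E →ₗ[ℝ] E) = -1 := by
  rw [Submodule.det_reflection, Submodule.orthogonal_orthogonal, finrank_span_singleton hv, pow_one]

end Reflection

theorem exists_ne_zero_inner_eq_zero (u : E4) : ∃ v : E4, v ≠ 0 ∧ inner ℝ u v = 0 := by
  have hrank : 0 < Module.finrank ℝ (ℝ ∙ u)ᗮ := by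
    have := (ℝ ∙ u).finrank_add_finrank_orthogonal
    have := finrank_span_le_card (R := ℝ) {u}
    rw [toFinset_singleton, Finset.card_singleton] at this
    rw [finrank_euclideanSpace_fin] at *
    omega
  have := Module.finrank_pos_iff.1 hrank
  obtain ⟨v, hv⟩ := exists_ne (0 : (ℝ ∙ u)ᗮ)
  exact ⟨v, by simpa using hv, Submodule.mem_orthogonal_singleton_iff_inner_right.1 v.2⟩

theorem gaussIntegral_coneKernel_reflection {θ : ℝ → ℝ} (hθ : ContDiff ℝ 1 θ) (u : E4)
    {X Y : ℝ → E4} (hX : IsLoop X) (hY : IsLoop Y) (hXY : UnalignedCurves X Y) {v w : E4}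
    (hv : v ≠ 0) (hw : w ≠ 0) :
    gaussIntegral (coneKernel θ ((ℝ ∙ v)ᗮ.reflection u)) X Y =
      gaussIntegral (coneKernel θ ((ℝ ∙ w)ᗮ.reflection u)) X Y := by
  have : PreconnectedSpace ({0}ᶜ : Set E4) :=
    isPreconnected_iff_preconnectedSpace.1 (isConnected_compl_singleton_of_one_lt_rank
      (by rw [← Module.finrank_eq_rank, finrank_euclideanSpace_fin]; norm_num) 0).isPreconnected
  have hneg : ∀ v : ({0}ᶜ : Set E4),
      gaussIntegral (coneKernel θ ((ℝ ∙ (v : E4))ᗮ.reflection u)) X Y =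
        -gaussIntegral (coneKernel θ u) (fun t => (ℝ ∙ (v : E4))ᗮ.reflection (X t))
          fun t => (ℝ ∙ (v : E4))ᗮ.reflection (Y t) := fun v => by
    have hmap := gaussIntegral_coneKernel_map hθ ((ℝ ∙ (v : E4))ᗮ.reflection u)
      (ℝ ∙ (v : E4))ᗮ.reflection.toLinearIsometry hX hY hXY
    simp only [LinearIsometryEquiv.coe_toLinearIsometry, Submodule.reflection_reflection] at hmap
    exact (neg_eq_iff_eq_neg.2 (hmap.trans ((congrArg (· * _)
      (det_reflection_orthogonal_singleton v.2)).trans (neg_one_mul _)))).symm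
  have hcont : ∀ {Z : ℝ → E4}, IsLoop Z → Continuous (Function.uncurry
      fun (v : ({0}ᶜ : Set E4)) t => (ℝ ∙ (v : E4))ᗮ.reflection (Z t)) := fun hZ => by
    have := hZ.continuous
    simp only [Function.uncurry_def, reflection_orthogonal_singleton_apply]
    have : ∀ z : ({0}ᶜ : Set E4) × ℝ, ‖(z.1 : E4)‖ ^ 2 ≠ 0 := fun z =>
      pow_ne_zero 2 (norm_ne_zero_iff.2 z.1.2)
    fun_prop (disch := assumption)
  rw [hneg ⟨v, hv⟩, hneg ⟨w, hw⟩]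
  exact congrArg Neg.neg (gaussIntegral_eq_of_homotopy (isGaussKernel_coneKernel hθ u)
    (hcont hX) (hcont hY) (fun v => hX.clm_comp (ℝ ∙ (v : E4))ᗮ.reflection.toContinuousLinearEquiv)
    (fun v => hY.clm_comp (ℝ ∙ (v : E4))ᗮ.reflection.toContinuousLinearEquiv)
    (fun v => hXY.clm_comp (L := (ℝ ∙ (v : E4))ᗮ.reflection.toContinuousLinearEquiv)
      (ℝ ∙ (v : E4))ᗮ.reflection.injective) ⟨v, hv⟩ ⟨w, hw⟩)

theorem gaussIntegral_coneKernel_eq {θ : ℝ → ℝ} (hθ : ContDiff ℝ 1 θ) {u u' : E4} (hu : ‖u‖ = ‖u'‖)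
    {X Y : ℝ → E4} (hX : IsLoop X) (hY : IsLoop Y) (hXY : UnalignedCurves X Y) :
    gaussIntegral (coneKernel θ u) X Y = gaussIntegral (coneKernel θ u') X Y := by
  rcases eq_or_ne u u' with rfl | hne
  · rfl
  obtain ⟨w, hw, huw⟩ := exists_ne_zero_inner_eq_zero u
  have hfix : (ℝ ∙ w)ᗮ.reflection u = u := Submodule.reflection_mem_subspace_eq_self
    (Submodule.mem_orthogonal_singleton_iff_inner_left.2 huw)
  have hind := gaussIntegral_coneKernel_reflection hθ u hX hY hXY hw (sub_ne_zero.2 hne)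
  rwa [hfix, Submodule.reflection_sub hu] at hind

/-! ### Moving the apex and rescaling -/

theorem smul_sub_ne_smul_sub_of_norm_eq {E : Type*} [NormedAddCommGroup E] [NormedSpace ℝ E]
    [StrictConvexSpace ℝ E] {x y c : E} (hxy : ‖x‖ = ‖y‖) (hc : ‖c‖ ≤ ‖x‖) (hxc : x ≠ c)
    (hne : x ≠ y) {a b : ℝ} (ha : 0 < a) (hab : a ≤ b) : a • (x - c) ≠ b • (y - c) := fun heq => by
  have hb : 0 < b := ha.trans_le hab
  rcases hab.eq_or_lt with rfl | hlt
  · exact hne (sub_left_injective (smul_right_injective E ha.ne' heq))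
  have hy : (a / b) • x + (1 - a / b) • c = y := by
    have : y - c = (a / b) • (x - c) := by
      rw [div_eq_inv_mul, mul_smul, heq, inv_smul_smul₀ hb.ne']
    rw [← sub_eq_zero, sub_eq_iff_eq_add.1 this]
    module
  refine (norm_combo_lt_of_ne le_rfl hc hxc (div_pos ha hb)
    (sub_pos.2 ((div_lt_one hb).2 hlt)) (add_sub_cancel _ _)).ne ?_
  rw [hy, hxy]

theorem sub_mem_unalignedPairs_of_norm_eq {E : Type*} [NormedAddCommGroup E] [NormedSpace ℝ E]
    [StrictConvexSpace ℝ E] {x y c : E} (hxy : ‖x‖ = ‖y‖) (hc : ‖c‖ ≤ ‖x‖) (hxc : x ≠ c)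
    (hyc : y ≠ c) (hne : x ≠ y) : (x - c, y - c) ∈ unalignedPairs := fun hray => by
  obtain ⟨a, b, ha, hb, heq⟩ := hray.exists_pos (sub_ne_zero.2 hxc) (sub_ne_zero.2 hyc)
  rcases le_total a b with hab | hba
  · exact smul_sub_ne_smul_sub_of_norm_eq hxy hc hxc hne ha hab heq
  · exact smul_sub_ne_smul_sub_of_norm_eq hxy.symm (hxy ▸ hc) hyc hne.symm hb hba heq.symm

theorem gaussIntegral_sub_const {h : E4 → ℝ} (hh : IsGaussKernel h) {X Y : ℝ → E4} (hX : IsLoop X)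
    (hY : IsLoop Y) (hXnorm : ∀ t, ‖X t‖ = 1) (hYnorm : ∀ t, ‖Y t‖ = 1) {c : E4} (hc : ‖c‖ ≤ 1)
    (hXc : ∀ t, X t ≠ c) (hYc : ∀ t, Y t ≠ c) (hXY : ∀ s t, X s ≠ Y t) :
    gaussIntegral h (fun t => X t - c) (fun t => Y t - c) = gaussIntegral h X Y := by
  have := hX.continuous
  have := hY.continuous
  have hloop : ∀ {Z : ℝ → E4}, IsLoop Z → ∀ σ : unitInterval, IsLoop fun t => Z t - (σ : ℝ) • c :=
    fun hZ σ => ⟨fun t => congrArg (· - (σ : ℝ) • c) (hZ.periodic t),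
      hZ.contDiff.sub contDiff_const⟩
  have hnorm : ∀ σ : unitInterval, ‖(σ : ℝ) • c‖ ≤ 1 := fun σ => by
    rw [norm_smul, Real.norm_of_nonneg σ.2.1]
    exact mul_le_one₀ σ.2.2 (norm_nonneg c) hc
  have hne : ∀ {x : E4}, ‖x‖ = 1 → x ≠ c → ∀ σ : unitInterval, x ≠ (σ : ℝ) • c := by
    rintro x hx hxc σ rfl
    rw [norm_smul, Real.norm_of_nonneg σ.2.1] at hx
    have hσ : (σ : ℝ) = 1 := le_antisymm σ.2.2 (by nlinarith [σ.2.1])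
    exact hxc (by rw [hσ, one_smul])
  simpa using gaussIntegral_eq_of_homotopy hh (T := unitInterval)
    (X := fun σ t => X t - (σ : ℝ) • c) (Y := fun σ t => Y t - (σ : ℝ) • c)
    (by fun_prop) (by fun_prop) (hloop hX) (hloop hY)
    (fun σ s t => sub_mem_unalignedPairs_of_norm_eq ((hXnorm s).trans (hYnorm t).symm)
      ((hnorm σ).trans_eq (hXnorm s).symm) (hne (hXnorm s) (hXc s) σ) (hne (hYnorm t) (hYc t) σ)
      (hXY s t)) 1 0

theorem gaussIntegral_smul {h : E4 → ℝ} (hh : IsGaussKernel h) {X Y : ℝ → E4} (hX : IsLoop X)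
    (hY : IsLoop Y) (hXY : UnalignedCurves X Y) {a b : ℝ → ℝ} (ha : ContDiff ℝ 1 a)
    (hb : ContDiff ℝ 1 b) (haper : Function.Periodic a 1) (hbper : Function.Periodic b 1)
    (hapos : ∀ t, 0 < a t) (hbpos : ∀ t, 0 < b t) :
    gaussIntegral h (fun t => a t • X t) (fun t => b t • Y t) = gaussIntegral h X Y := by
  have := hX.continuous
  have := hY.continuous
  have := ha.continuous
  have := hb.continuous
  have hloop : ∀ {Z : ℝ → E4} {c : ℝ → ℝ}, IsLoop Z → ContDiff ℝ 1 c → Function.Periodic c 1 →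
      ∀ σ : unitInterval, IsLoop fun t => ((1 - (σ : ℝ)) + σ * c t) • Z t := fun hZ hc hper σ =>
    ⟨fun t => by simp only [hZ.periodic t, hper t],
      (contDiff_const.add (contDiff_const.mul hc)).smul hZ.contDiff⟩
  have hpos : ∀ (σ : unitInterval) {c : ℝ}, 0 < c → 0 < (1 - (σ : ℝ)) + σ * c := fun σ c hc =>
    convex_Ioi (0 : ℝ) one_pos hc (sub_nonneg.2 σ.2.2) σ.2.1 (sub_add_cancel _ _) |>.trans_eq
      (by simp)
  simpa using gaussIntegral_eq_of_homotopy hh (T := unitInterval)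
    (X := fun σ t => ((1 - (σ : ℝ)) + σ * a t) • X t)
    (Y := fun σ t => ((1 - (σ : ℝ)) + σ * b t) • Y t)
    (by fun_prop) (by fun_prop) (hloop hX ha haper) (hloop hY hb hbper)
    (fun σ s t => smul_smul_mem_unalignedPairs (hXY s t) (hpos σ (hapos s)) (hpos σ (hbpos t))) 1 0

/-! ### Integrals near a nondegenerate zero -/

section Localization

variable {E : Type*} [NormedAddCommGroup E] [NormedSpace ℝ E] {Q : E → E} {z : E}

theorem eventually_sign_det_fderiv_eq (hQ : ContDiffAt ℝ 1 Q z) (hd : (fderiv ℝ Q z).det ≠ 0) :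
    ∀ᶠ x in 𝓝 z, SignType.sign (fderiv ℝ Q x).det = SignType.sign (fderiv ℝ Q z).det := by
  have hdet : ContinuousAt (fun x => (fderiv ℝ Q x).det) z :=
    ContinuousLinearMap.continuous_det.continuousAt.comp
      (hQ.fderiv_right (m := 0) le_rfl).continuousAt
  have hsign := (continuousAt_sign_of_ne_zero hd).comp (f := fun x => (fderiv ℝ Q x).det) hdet
  exact hsign.eventually_mem ((isOpen_discrete {SignType.sign (fderiv ℝ Q z).det}).mem_nhds rfl)

variable [FiniteDimensional ℝ E]

theorem exists_isOpen_injOn_of_det_fderiv_ne_zero (hQ : ContDiffAt ℝ 1 Q z)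
    (hd : (fderiv ℝ Q z).det ≠ 0) {V : Set E} (hV : V ∈ 𝓝 z) :
    ∃ N ⊆ V, IsOpen N ∧ z ∈ N ∧ InjOn Q N ∧ IsOpen (Q '' N) ∧
      ∀ x ∈ N, DifferentiableAt ℝ Q x := by
  have hinv : HasStrictFDerivAt Q
      ((fderiv ℝ Q z).toContinuousLinearEquivOfDetNeZero hd : E →L[ℝ] E) z := by
    simpa only [ContinuousLinearMap.coe_toContinuousLinearEquivOfDetNeZero] using
      hQ.hasStrictFDerivAt one_ne_zero
  let e := hinv.toOpenPartialHomeomorph Q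
  have hdiff : ∀ᶠ x in 𝓝 z, DifferentiableAt ℝ Q x :=
    (hQ.eventually (by simp)).mono fun x hx => hx.differentiableAt one_ne_zero
  have hsource : ∀ᶠ x in 𝓝 z, x ∈ e.source :=
    e.open_source.mem_nhds hinv.mem_toOpenPartialHomeomorph_source
  obtain ⟨N, hN, hNo, hzN⟩ := eventually_nhds_iff.1 (hsource.and (hdiff.and hV))
  exact ⟨N, fun x hx => (hN x hx).2.2, hNo, hzN, e.injOn.mono fun x hx => (hN x hx).1,
    e.isOpen_image_of_subset_source hNo fun x hx => (hN x hx).1, fun x hx => (hN x hx).2.1⟩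

theorem exists_isOpen_setIntegral_comp_mul_det [MeasurableSpace E] [BorelSpace E] (μ : Measure E)
    [μ.IsAddHaarMeasure] (hQ : ContDiffAt ℝ 1 Q z) (hz : Q z = 0) (hd : (fderiv ℝ Q z).det ≠ 0)
    {V : Set E} (hV : V ∈ 𝓝 z) :
    ∃ N ⊆ V, IsOpen N ∧ z ∈ N ∧ ∃ ε > 0, ∀ Ψ : E → ℝ, (∀ q, ε ≤ ‖q‖ → Ψ q = 0) →
      ∫ x in N, Ψ (Q x) * (fderiv ℝ Q x).det ∂μ =
        (SignType.sign (fderiv ℝ Q z).det : ℝ) * ∫ q, Ψ q ∂μ := by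
  obtain ⟨N, hNV, hNo, hzN, hinj, himage, hdiff⟩ := exists_isOpen_injOn_of_det_fderiv_ne_zero hQ hd
    (inter_mem hV (eventually_sign_det_fderiv_eq hQ hd))
  obtain ⟨ε, hε, hball⟩ := Metric.isOpen_iff.1 himage 0 ⟨z, hzN, hz⟩
  refine ⟨N, fun x hx => (hNV hx).1, hNo, hzN, ε, hε, fun Ψ hΨ => ?_⟩
  have hsupport : ∫ q in Q '' N, Ψ q ∂μ = ∫ q, Ψ q ∂μ :=
    setIntegral_eq_integral_of_forall_compl_eq_zero fun q hq => hΨ q <| not_lt.1 fun hlt =>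
      hq (hball (mem_ball_zero_iff.2 hlt))
  rw [← hsupport, integral_image_eq_integral_abs_det_fderiv_smul μ hNo.measurableSet
    (fun x hx => (hdiff x hx).hasFDerivAt.hasFDerivWithinAt) hinj Ψ, ← integral_const_mul]
  refine setIntegral_congr_fun hNo.measurableSet fun x hx => ?_
  have hsign : SignType.sign (fderiv ℝ Q x).det = SignType.sign (fderiv ℝ Q z).det := (hNV hx).2
  rw [← hsign, smul_eq_mul, ← mul_assoc, sign_mul_abs, mul_comm]

theorem setIntegral_eq_sum_of_eq_zero {α ι : Type*} [MeasurableSpace α] {μ : Measure α}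
    {g : α → ℝ} {B : Set α} {P : Finset ι} {N : ι → Set α} (hB : MeasurableSet B)
    (hg : IntegrableOn g B μ) (hN : ∀ i ∈ P, MeasurableSet (N i)) (hNB : ∀ i ∈ P, N i ⊆ B)
    (hd : (P : Set ι).PairwiseDisjoint N) (h0 : ∀ x ∈ B, (∀ i ∈ P, x ∉ N i) → g x = 0) :
    ∫ x in B, g x ∂μ = ∑ i ∈ P, ∫ x in N i, g x ∂μ := by
  rw [← integral_biUnion_finset P hN hd fun i hi => hg.mono_set (hNB i hi)]
  refine setIntegral_eq_of_subset_of_forall_sdiff_eq_zero hB (iUnion₂_subset hNB) ?_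
  rintro x ⟨hx, hxN⟩
  exact h0 x hx fun i hi hxi => hxN (mem_biUnion hi hxi)

end Localization

/-! ### An affine chart of projective 3-space -/

/-- The direction of projection in 3-space. -/
def vertical : E4 := EuclideanSpace.single 2 1

theorem norm_vertical : ‖vertical‖ = 1 := by simp [vertical]

theorem inner_vertical (v : E4) : inner ℝ vertical v = v 2 := by
  simp [vertical, EuclideanSpace.inner_single_left]

/-- The affine chart of projective 3-space centred at the vertical direction. -/
def chart (v : E4) : ℝ × ℝ × ℝ := (v 0 / v 2, v 1 / v 2, v 3 / v 2)

/-- The vector with chart coordinates `q` and third coordinate `1`. -/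
def chartInv (q : ℝ × ℝ × ℝ) : E4 := !₂[q.1, q.2.1, 1, q.2.2]

theorem continuous_chartInv : Continuous chartInv :=
  (PiLp.continuous_toLp 2 _).comp (continuous_pi fun i => by
    fin_cases i
    exacts [continuous_fst, continuous_snd.fst, continuous_const, continuous_snd.snd])

theorem smul_chartInv_chart {v : E4} (hv : v 2 ≠ 0) : v 2 • chartInv (chart v) = v := by
  ext i
  fin_cases i <;> simp [chart, chartInv] <;> field_simp

theorem one_add_norm_sq_le_norm_chartInv_sq (q : ℝ × ℝ × ℝ) :
    1 + ‖q‖ ^ 2 ≤ ‖chartInv q‖ ^ 2 := by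
  have hnorm : ‖chartInv q‖ ^ 2 = 1 + (q.1 ^ 2 + q.2.1 ^ 2 + q.2.2 ^ 2) := by
    rw [EuclideanSpace.real_norm_sq_eq]
    simp [Fin.sum_univ_four, chartInv]
    ring
  have hmax : ‖q‖ = |q.1| ∨ ‖q‖ = |q.2.1| ∨ ‖q‖ = |q.2.2| := by
    rcases max_choice ‖q.1‖ ‖q.2‖ with h | h
    · exact Or.inl h
    · exact Or.inr ((max_choice ‖q.2.1‖ ‖q.2.2‖).imp h.trans h.trans)
  rw [hnorm]
  rcases hmax with h | h | h <;> rw [h, sq_abs] <;> nlinarith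

theorem chartInv_ne_zero (q : ℝ × ℝ × ℝ) : chartInv q ≠ 0 := fun h => by
  have := one_add_norm_sq_le_norm_chartInv_sq q
  rw [h, norm_zero] at this
  nlinarith

theorem det_prod_three (L : ℝ × ℝ × ℝ →ₗ[ℝ] ℝ × ℝ × ℝ) {a b c : ℝ × ℝ × ℝ}
    (ha : L (1, 0, 0) = a) (hb : L (0, 1, 0) = b) (hc : L (0, 0, 1) = c) :
    LinearMap.det L = a.1 * (b.2.1 * c.2.2 - b.2.2 * c.2.1) -
      b.1 * (a.2.1 * c.2.2 - a.2.2 * c.2.1) + c.1 * (a.2.1 * b.2.2 - a.2.2 * b.2.1) := by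
  let e : (ℝ × ℝ × ℝ) ≃ₗ[ℝ] (Fin 3 → ℝ) :=
    { toFun := fun p => ![p.1, p.2.1, p.2.2]
      invFun := fun v => (v 0, v 1, v 2)
      map_add' := fun _ _ => by ext i; fin_cases i <;> rfl
      map_smul' := fun _ _ => by ext i; fin_cases i <;> rfl
      left_inv := fun _ => rfl
      right_inv := fun v => by ext i; fin_cases i <;> rfl }
  have he_apply : ∀ x, e x = ![x.1, x.2.1, x.2.2] := fun _ => rfl
  have hentry : ∀ i j, LinearMap.toMatrix (.ofEquivFun e) (.ofEquivFun e) L i j =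
      ![![a.1, b.1, c.1], ![a.2.1, b.2.1, c.2.1], ![a.2.2, b.2.2, c.2.2]] i j := by
    intro i j
    rw [LinearMap.toMatrix_apply]
    have he : ∀ j, e.symm (Pi.single j 1) = ![(1, 0, 0), (0, 1, 0), (0, 0, 1)] j := by
      intro j
      rw [LinearEquiv.symm_apply_eq, he_apply]
      fin_cases j <;> ext k <;> fin_cases k <;> simp
    rw [Module.Basis.ofEquivFun_repr_apply, Module.Basis.coe_ofEquivFun, he_apply]
    simp only [he]
    fin_cases i <;> fin_cases j <;> simp [ha, hb, hc]
  rw [← LinearMap.det_toMatrix (.ofEquivFun e), Matrix.det_fin_three]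
  simp only [hentry, Matrix.cons_val]
  ring

theorem det_fderiv_chart_comp {F : ℝ × ℝ × ℝ → E4} {p : ℝ × ℝ × ℝ} (hF : DifferentiableAt ℝ F p)
    (h2 : F p 2 ≠ 0) :
    (fderiv ℝ (fun x => chart (F x)) p).det * F p 2 ^ 4 =
      det4 (F p) (fderiv ℝ F p (1, 0, 0)) (fderiv ℝ F p (0, 1, 0)) (fderiv ℝ F p (0, 0, 1)) := by
  have hcoord : ∀ i, HasFDerivAt (fun x => F x i) ((EuclideanSpace.proj i).comp (fderiv ℝ F p)) p :=
    fun i => (EuclideanSpace.proj i : E4 →L[ℝ] ℝ).hasFDerivAt.comp p hF.hasFDerivAt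
  have hquot : ∀ i, HasFDerivAt (fun x => F x i / F x 2)
      (F p i • (-(F p 2 ^ 2)⁻¹ • (EuclideanSpace.proj 2).comp (fderiv ℝ F p)) +
        (F p 2)⁻¹ • (EuclideanSpace.proj i).comp (fderiv ℝ F p)) p := fun i => by
    simp only [div_eq_mul_inv]
    exact (hcoord i).mul ((hasDerivAt_inv h2).comp_hasFDerivAt p (hcoord 2))
  have hchart : HasFDerivAt (fun x => chart (F x)) _ p :=
    (hquot 0).prodMk ((hquot 1).prodMk (hquot 3))
  rw [hchart.fderiv, ContinuousLinearMap.det, det_prod_three _ rfl rfl rfl, det4_eq_minors]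
  simp
  field_simp
  ring

/-! ### Concentrated kernels count vertical chords -/

/-- The contribution of a single transversal crossing to the Gauss integral with the kernel
`coneKernel θ vertical`, up to sign. -/
def coneMass (θ : ℝ → ℝ) : ℝ := ∫ q : ℝ × ℝ × ℝ, coneKernel θ vertical (chartInv q)

theorem inner_vertical_div_norm_chartInv_le {ε : ℝ} (hε : 0 ≤ ε) {q : ℝ × ℝ × ℝ} (hq : ε ≤ ‖q‖) :
    inner ℝ vertical (chartInv q) / ‖chartInv q‖ ≤ (√(1 + ε ^ 2))⁻¹ := by
  have hle : √(1 + ε ^ 2) ≤ ‖chartInv q‖ := Real.sqrt_le_iff.2 ⟨norm_nonneg _,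
    le_trans (by gcongr) (one_add_norm_sq_le_norm_chartInv_sq q)⟩
  have hone : inner ℝ vertical (chartInv q) = 1 := inner_vertical _
  rw [hone, one_div]
  exact inv_anti₀ (Real.sqrt_pos.2 (by positivity)) hle

theorem eventually_forall_coneKernel_chartInv_eq_zero {ε : ℝ} (hε : 0 < ε) :
    ∀ᶠ κ in 𝓝[<] (1 : ℝ), ∀ θ : ℝ → ℝ, (∀ x ≤ κ, θ x = 0) → ∀ q, ε ≤ ‖q‖ →
      coneKernel θ vertical (chartInv q) = 0 := by
  have hlt : (√(1 + ε ^ 2))⁻¹ < 1 :=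
    inv_lt_one_of_one_lt₀ (Real.lt_sqrt_of_sq_lt (by linarith [pow_pos hε 2]))
  filter_upwards [nhdsWithin_le_nhds (lt_mem_nhds hlt)] with κ hκ θ hθ q hq
  rw [coneKernel, hθ _ ((inner_vertical_div_norm_chartInv_le hε.le hq).trans hκ.le), zero_div]

theorem eventually_forall_inner_div_norm_le {E : Type*} [NormedAddCommGroup E]
    [InnerProductSpace ℝ E] {u : E} (hu : ‖u‖ = 1) {C : Set E} (hC : IsCompact C)
    (hray : ∀ v ∈ C, ¬SameRay ℝ u v) :
    ∀ᶠ κ in 𝓝[<] (1 : ℝ), ∀ v ∈ C, inner ℝ u v / ‖v‖ ≤ κ := by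
  have hpos : ∀ v ∈ C, 0 < ‖v‖ := fun v hv =>
    norm_pos_iff.2 fun h0 => hray v hv (h0 ▸ SameRay.zero_right u)
  have hlt : ∀ v ∈ C, inner ℝ u v / ‖v‖ < 1 := fun v hv => by
    have hne : inner ℝ u v < ‖u‖ * ‖v‖ := inner_lt_norm_mul_iff_real.2 fun h =>
      hray v hv (sameRay_iff_norm_smul_eq.2 h.symm)
    rwa [div_lt_one (hpos v hv), ← one_mul ‖v‖, ← hu]
  have hcont : ContinuousOn (fun v => inner ℝ u v / ‖v‖) C :=
    ContinuousOn.div (by fun_prop) (by fun_prop) fun v hv => (hpos v hv).ne'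
  rcases C.eq_empty_or_nonempty with rfl | hne
  · simp
  obtain ⟨v₀, hv₀, hmax⟩ := hC.exists_isMaxOn hne hcont
  filter_upwards [nhdsWithin_le_nhds (lt_mem_nhds (hlt v₀ hv₀))] with κ hκ v hv
  exact (hmax hv).trans hκ.le

theorem chartInv_zero : chartInv 0 = vertical := by
  ext i
  fin_cases i <;> simp [chartInv, vertical]

theorem sameRay_vertical_iff {v : E4} (hv : v ≠ 0) :
    SameRay ℝ vertical v ↔ 0 < v 2 ∧ chart v = 0 := by
  constructor
  · intro h
    obtain ⟨c, hc, rfl⟩ := h.exists_pos_left (norm_ne_zero_iff.1 (by simp [norm_vertical])) hv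
    simpa [chart, vertical] using hc
  · rintro ⟨hpos, h0⟩
    rw [← smul_chartInv_chart hpos.ne', h0, chartInv_zero]
    exact SameRay.sameRay_pos_smul_right _ hpos

/-- The point with parameter `r` of the segment that joins a point of the first curve to the
antipode of a point of the second. -/
def chord (X Y : ℝ → E4) (p : ℝ × ℝ × ℝ) : E4 := (1 - p.2.2) • X p.1 - p.2.2 • Y p.2.1

/-- The integrand of the Gauss integral, with `linkCoeff` written as an integral along chords. -/
def chordIntegrand (h : E4 → ℝ) (X Y : ℝ → E4) (p : ℝ × ℝ × ℝ) : ℝ :=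
  h (chord X Y p) *
    (p.2.2 * (1 - p.2.2) * det4 (X p.1) (Y p.2.1) (deriv X p.1) (deriv Y p.2.1))

theorem setIntegral_Icc_eq_intervalIntegral {F : ℝ × ℝ × ℝ → ℝ} {a b : ℝ × ℝ × ℝ} (hab : a ≤ b)
    (hF : ContinuousOn F (Icc a b)) :
    ∫ p in Icc a b, F p =
      ∫ s in a.1..b.1, ∫ t in a.2.1..b.2.1, ∫ r in a.2.2..b.2.2, F (s, t, r) := by
  obtain ⟨a₁, a₂, a₃⟩ := a
  obtain ⟨b₁, b₂, b₃⟩ := b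
  obtain ⟨h₁, h₂, h₃⟩ : a₁ ≤ b₁ ∧ a₂ ≤ b₂ ∧ a₃ ≤ b₃ := hab
  simp only [intervalIntegral.integral_of_le h₁, intervalIntegral.integral_of_le h₂,
    intervalIntegral.integral_of_le h₃, ← integral_Icc_eq_integral_Ioc]
  have hint : IntegrableOn F (Icc a₁ b₁ ×ˢ Icc a₂ b₂ ×ˢ Icc a₃ b₃) := by
    rw [Icc_prod_Icc, Icc_prod_Icc]
    exact hF.integrableOn_compact isCompact_Icc
  rw [← Icc_prod_Icc, ← Icc_prod_Icc, Measure.volume_eq_prod, setIntegral_prod _ hint]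
  refine setIntegral_congr_fun measurableSet_Icc fun s hs => ?_
  rw [Measure.volume_eq_prod]
  refine setIntegral_prod _ (ContinuousOn.integrableOn_compact
    (isCompact_Icc.prod isCompact_Icc) (hF.comp (by fun_prop) ?_))
  exact fun p hp => ⟨⟨hs.1, hp.1.1, hp.2.1⟩, ⟨hs.2, hp.1.2, hp.2.2⟩⟩

section Chords

variable {X Y : ℝ → E4} (hX : IsLoop X) (hY : IsLoop Y)

include hX hY

theorem contDiff_chord : ContDiff ℝ 1 (chord X Y) := by
  have := hX.contDiff
  have := hY.contDiff
  unfold chord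
  fun_prop

theorem fderiv_chord (p : ℝ × ℝ × ℝ) :
    fderiv ℝ (chord X Y) p (1, 0, 0) = (1 - p.2.2) • deriv X p.1 ∧
      fderiv ℝ (chord X Y) p (0, 1, 0) = -(p.2.2 • deriv Y p.2.1) ∧
      fderiv ℝ (chord X Y) p (0, 0, 1) = -(X p.1 + Y p.2.1) := by
  have hX' : HasFDerivAt (fun p : ℝ × ℝ × ℝ => X p.1) _ p :=
    (hX.hasDerivAt p.1).hasFDerivAt.comp p hasFDerivAt_fst
  have hY' : HasFDerivAt (fun p : ℝ × ℝ × ℝ => Y p.2.1) _ p :=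
    (hY.hasDerivAt p.2.1).hasFDerivAt.comp p hasFDerivAt_snd.fst
  have hr : HasFDerivAt (fun p : ℝ × ℝ × ℝ => p.2.2) _ p :=
    (hasFDerivAt_snd (𝕜 := ℝ) (p := p)).snd
  have hchord : HasFDerivAt (chord X Y) _ p := ((hr.const_sub 1).smul hX').sub (hr.smul hY')
  rw [hchord.fderiv]
  refine ⟨?_, ?_, ?_⟩ <;> simp
  abel

theorem det_fderiv_chart_chord {p : ℝ × ℝ × ℝ} (hp : chord X Y p 2 ≠ 0) :
    (fderiv ℝ (fun x => chart (chord X Y x)) p).det * chord X Y p 2 ^ 4 =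
      p.2.2 * (1 - p.2.2) * det4 (X p.1) (Y p.2.1) (deriv X p.1) (deriv Y p.2.1) := by
  obtain ⟨hs, ht, hr⟩ := fderiv_chord hX hY p
  rw [det_fderiv_chart_comp ((contDiff_chord hX hY).differentiable one_ne_zero p) hp, hs, ht, hr]
  simp only [chord, det4_eq_minors, PiLp.sub_apply, PiLp.smul_apply, PiLp.neg_apply,
    PiLp.add_apply, smul_eq_mul]
  ring

theorem contDiffAt_chart_chord {p : ℝ × ℝ × ℝ} (hp : chord X Y p 2 ≠ 0) :
    ContDiffAt ℝ 1 (fun x => chart (chord X Y x)) p := by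
  have hcoord : ∀ i, ContDiffAt ℝ 1 (fun x => chord X Y x i) p := fun i =>
    (contDiff_euclidean.1 (contDiff_chord hX hY) i).contDiffAt
  have hquot : ∀ i, ContDiffAt ℝ 1 (fun x => chord X Y x i / chord X Y x 2) p := fun i =>
    (hcoord i).div (hcoord 2) hp
  exact (hquot 0).prodMk ((hquot 1).prodMk (hquot 3))

theorem chordIntegrand_coneKernel (θ : ℝ → ℝ) {p : ℝ × ℝ × ℝ} (hp : 0 < chord X Y p 2) :
    chordIntegrand (coneKernel θ vertical) X Y p =
      coneKernel θ vertical (chartInv (chart (chord X Y p))) *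
        (fderiv ℝ (fun x => chart (chord X Y x)) p).det := by
  rw [chordIntegrand, ← det_fderiv_chart_chord hX hY hp.ne', ← smul_chartInv_chart hp.ne',
    coneKernel_smul _ _ _ hp, smul_chartInv_chart hp.ne']
  field_simp

theorem exists_isOpen_setIntegral_chordIntegrand_eq {p : ℝ × ℝ × ℝ} (hr : p.2.2 ∈ Ioo 0 1)
    (hne : chord X Y p ≠ 0) (hp : SameRay ℝ vertical (chord X Y p))
    (hdet : det4 (X p.1) (Y p.2.1) (deriv X p.1) (deriv Y p.2.1) ≠ 0)
    {V : Set (ℝ × ℝ × ℝ)} (hV : V ∈ 𝓝 p) :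
    ∃ N ⊆ V, IsOpen N ∧ p ∈ N ∧ ∀ᶠ κ in 𝓝[<] (1 : ℝ), ∀ θ : ℝ → ℝ, (∀ x ≤ κ, θ x = 0) →
      ∫ x in N, chordIntegrand (coneKernel θ vertical) X Y x = coneMass θ *
        SignType.sign (det4 (X p.1) (Y p.2.1) (deriv X p.1) (deriv Y p.2.1)) := by
  obtain ⟨hpos, hzero⟩ := (sameRay_vertical_iff hne).1 hp
  have hr' : 0 < p.2.2 * (1 - p.2.2) := mul_pos hr.1 (sub_pos.2 hr.2)
  have hjac := det_fderiv_chart_chord hX hY hpos.ne'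
  have hsign := congrArg SignType.sign hjac
  rw [sign_mul, sign_mul, sign_pos (pow_pos hpos 4), sign_pos hr', mul_one, one_mul] at hsign
  have hpos_near : ∀ᶠ x in 𝓝 p, 0 < chord X Y x 2 := by
    have := (contDiff_chord hX hY).continuous
    have hcont : Continuous fun x => chord X Y x 2 := by fun_prop
    exact hcont.continuousAt.eventually_const_lt hpos
  have : (volume : Measure (ℝ × ℝ × ℝ)).IsAddHaarMeasure :=
    Measure.prod.instIsAddHaarMeasure (volume : Measure ℝ) (volume : Measure (ℝ × ℝ))
  obtain ⟨N, hNV, hNo, hpN, ε, hε, hint⟩ := exists_isOpen_setIntegral_comp_mul_det volume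
    (contDiffAt_chart_chord hX hY hpos.ne') hzero
    (left_ne_zero_of_mul (hjac.trans_ne (mul_ne_zero hr'.ne' hdet))) (inter_mem hV hpos_near)
  refine ⟨N, fun x hx => (hNV hx).1, hNo, hpN, ?_⟩
  filter_upwards [eventually_forall_coneKernel_chartInv_eq_zero hε] with κ hκ θ hθ
  rw [setIntegral_congr_fun hNo.measurableSet fun x hx =>
    chordIntegrand_coneKernel hX hY θ (hNV hx).2,
    hint (fun q => coneKernel θ vertical (chartInv q)) (hκ θ hθ), hsign, mul_comm, coneMass]

variable (hXY : UnalignedCurves X Y)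

include hXY

theorem continuousOn_chordIntegrand {h : E4 → ℝ} (hh : IsGaussKernel h) :
    ContinuousOn (chordIntegrand h X Y) {p | p.2.2 ∈ Icc 0 1} := by
  have := hX.continuous
  have := hY.continuous
  have := hX.continuous_deriv
  have := hY.continuous_deriv
  refine ContinuousOn.mul (hh.smooth.continuousOn.comp
    (contDiff_chord hX hY).continuous.continuousOn fun p hp => ?_) (by fun_prop)
  exact segment_ne_zero (hXY p.1 p.2.1) hp

theorem gaussIntegral_eq_setIntegral {h : E4 → ℝ} (hh : IsGaussKernel h) (s₀ t₀ : ℝ) :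
    gaussIntegral h X Y =
      ∫ p in Icc (s₀, t₀, 0) (s₀ + 1, t₀ + 1, 1), chordIntegrand h X Y p := by
  rw [setIntegral_Icc_eq_intervalIntegral (by simp)
    ((continuousOn_chordIntegrand hX hY hXY hh).mono fun p hp => ⟨hp.1.2.2, hp.2.2.2⟩)]
  have hr : ∀ s t, ∫ r in (0 : ℝ)..1, chordIntegrand h X Y (s, t, r) =
      linkCoeff h (X s, Y t) * det4 (X s) (Y t) (deriv X s) (deriv Y t) := fun s t => by
    rw [linkCoeff, segmentIntegral, ← intervalIntegral.integral_mul_const]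
    refine intervalIntegral.integral_congr fun r _ => ?_
    simp only [chordIntegrand, chord]
    ring
  have ht : ∀ s, Function.Periodic (fun t => linkCoeff h (X s, Y t) *
      det4 (X s) (Y t) (deriv X s) (deriv Y t)) 1 := fun s t => by
    simp only [hY.periodic t, hY.deriv_periodic t]
  have hs : Function.Periodic (fun s => ∫ t in (0 : ℝ)..1, linkCoeff h (X s, Y t) *
      det4 (X s) (Y t) (deriv X s) (deriv Y t)) 1 := fun s => by
    simp only [hX.periodic s, hX.deriv_periodic s]
  simp only [hr, (ht _).intervalIntegral_add_eq t₀ 0, zero_add]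
  rw [hs.intervalIntegral_add_eq s₀ 0, zero_add, gaussIntegral_eq hh hY hXY]

theorem eventually_gaussIntegral_coneKernel_eq_sum {s₀ t₀ : ℝ} {S : Finset (ℝ × ℝ × ℝ)}
    (hmem : ∀ p ∈ Icc (s₀, t₀, 0) (s₀ + 1, t₀ + 1, 1), SameRay ℝ vertical (chord X Y p) → p ∈ S)
    (hinterior : ∀ p ∈ S, p ∈ Ioo s₀ (s₀ + 1) ×ˢ Ioo t₀ (t₀ + 1) ×ˢ Ioo 0 1)
    (hray : ∀ p ∈ S, SameRay ℝ vertical (chord X Y p))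
    (hdet : ∀ p ∈ S, det4 (X p.1) (Y p.2.1) (deriv X p.1) (deriv Y p.2.1) ≠ 0) :
    ∀ᶠ κ in 𝓝[<] (1 : ℝ), ∀ θ : ℝ → ℝ, ContDiff ℝ 1 θ → (∀ x ≤ κ, θ x = 0) →
      gaussIntegral (coneKernel θ vertical) X Y = coneMass θ *
        ∑ p ∈ S, (SignType.sign (det4 (X p.1) (Y p.2.1) (deriv X p.1) (deriv Y p.2.1)) : ℝ) := by
  have hr : ∀ p ∈ S, p.2.2 ∈ Ioo (0 : ℝ) 1 := fun p hp => (hinterior p hp).2.2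
  set box : Set (ℝ × ℝ × ℝ) := Icc (s₀, t₀, 0) (s₀ + 1, t₀ + 1, 1)
  have hbox : ∀ p ∈ S, box ∈ 𝓝 p := fun p hp => mem_of_superset
    ((isOpen_Ioo.prod (isOpen_Ioo.prod isOpen_Ioo)).mem_nhds (hinterior p hp)) fun _ hx =>
      ⟨⟨hx.1.1.le, hx.2.1.1.le, hx.2.2.1.le⟩, ⟨hx.1.2.le, hx.2.1.2.le, hx.2.2.2.le⟩⟩
  obtain ⟨U, hU, hUdisj⟩ := S.finite_toSet.t2_separation
  have hlocal : ∀ p ∈ S, ∃ N ⊆ U p ∩ box, IsOpen N ∧ p ∈ N ∧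
      ∀ᶠ κ in 𝓝[<] (1 : ℝ), ∀ θ : ℝ → ℝ, (∀ x ≤ κ, θ x = 0) →
        ∫ x in N, chordIntegrand (coneKernel θ vertical) X Y x = coneMass θ *
          SignType.sign (det4 (X p.1) (Y p.2.1) (deriv X p.1) (deriv Y p.2.1)) := fun p hp => by
    exact exists_isOpen_setIntegral_chordIntegrand_eq hX hY (hr p hp)
      (segment_ne_zero (hXY _ _) (Ioo_subset_Icc_self (hr p hp))) (hray p hp) (hdet p hp)
      (inter_mem ((hU p).2.mem_nhds (hU p).1) (hbox p hp))
  choose! N hN hNo hpN hconc using hlocal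
  have haway : IsCompact (chord X Y '' (box \ ⋃ p ∈ S, N p)) :=
    (isCompact_Icc.diff (isOpen_biUnion hNo)).image (contDiff_chord hX hY).continuous
  have hnotray : ∀ v ∈ chord X Y '' (box \ ⋃ p ∈ S, N p), ¬SameRay ℝ vertical v := by
    rintro _ ⟨p, hp, rfl⟩ h
    exact hp.2 (mem_biUnion (hmem p hp.1 h) (hpN p (hmem p hp.1 h)))
  filter_upwards [(Filter.eventually_all_finset S).2 hconc,
    eventually_forall_inner_div_norm_le norm_vertical haway hnotray] with κ hκ hκ' θ hθ hθ0
  have hcont := (continuousOn_chordIntegrand hX hY hXY (isGaussKernel_coneKernel hθ vertical)).mono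
    fun (p : ℝ × ℝ × ℝ) (hp : p ∈ box) => ⟨hp.1.2.2, hp.2.2.2⟩
  rw [gaussIntegral_eq_setIntegral hX hY hXY (isGaussKernel_coneKernel hθ vertical) s₀ t₀,
    setIntegral_eq_sum_of_eq_zero (P := S) (N := N) measurableSet_Icc
      (hcont.integrableOn_compact isCompact_Icc) (fun p hp => (hNo p hp).measurableSet)
      (fun p hp x hx => (hN p hp hx).2) ?_ ?_, Finset.mul_sum]
  · exact Finset.sum_congr rfl fun p hp => hκ p hp θ hθ0
  · exact hUdisj.mono_on fun p hp x hx => (hN p hp hx).1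
  · intro x hx hxN
    have hxC : x ∈ box \ ⋃ p ∈ S, N p := ⟨hx, by simpa using hxN⟩
    rw [chordIntegrand, coneKernel, hθ0 _ (hκ' _ (mem_image_of_mem _ hxC)), zero_div, zero_mul]

end Chords

/-! ### The linking number of two curves -/

/-- The Gauss integrals of the two curves for all kernels concentrated near the vertical direction
are those of curves with linking number `n`. -/
def HasLinkNumber (X Y : ℝ → E4) (n : ℤ) : Prop :=
  ∀ᶠ κ in 𝓝[<] (1 : ℝ), ∀ θ : ℝ → ℝ, ContDiff ℝ 1 θ → (∀ x ≤ κ, θ x = 0) →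
    gaussIntegral (coneKernel θ vertical) X Y = -coneMass θ * n

theorem continuous_coneKernel_chartInv {θ : ℝ → ℝ} (hθ : Continuous θ) :
    Continuous fun q => coneKernel θ vertical (chartInv q) := by
  have hnorm : Continuous fun q => ‖chartInv q‖ := continuous_chartInv.norm
  have hne : ∀ q, ‖chartInv q‖ ≠ 0 := fun q => norm_ne_zero_iff.2 (chartInv_ne_zero q)
  exact (hθ.comp ((continuous_const.inner continuous_chartInv).div hnorm hne)).div
    (hnorm.pow 4) fun q => pow_ne_zero 4 (hne q)

theorem coneMass_pos {θ : ℝ → ℝ} (hθ : Continuous θ) (h0 : ∀ x, 0 ≤ θ x) (h1 : 0 < θ 1)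
    (hsupport : ∀ q, 1 ≤ ‖q‖ → coneKernel θ vertical (chartInv q) = 0) : 0 < coneMass θ := by
  refine (continuous_coneKernel_chartInv hθ).integral_pos_of_hasCompactSupport_nonneg_nonzero
    (HasCompactSupport.intro (isCompact_closedBall 0 1) fun q hq => hsupport q ?_)
    (fun q => div_nonneg (h0 _) (by positivity)) (x := 0) ?_
  · exact (not_le.1 fun h => hq (mem_closedBall_zero_iff.2 h)).le
  · rw [chartInv_zero, coneKernel, norm_vertical, inner_vertical]
    simpa [vertical] using h1.ne'

theorem eventually_exists_coneMass_pos : ∀ᶠ κ in 𝓝[<] (1 : ℝ), ∃ θ : ℝ → ℝ, ContDiff ℝ 1 θ ∧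
    (∀ x ≤ κ, θ x = 0) ∧ 0 < coneMass θ := by
  filter_upwards [eventually_forall_coneKernel_chartInv_eq_zero one_pos, self_mem_nhdsWithin]
    with κ hκ hκ1
  have hpos : 0 < 1 - κ := sub_pos.2 hκ1
  have hsmooth : ContDiff ℝ 1 fun x => Real.smoothTransition ((x - κ) / (1 - κ)) :=
    (Real.smoothTransition.contDiff (n := 1)).comp ((contDiff_id.sub contDiff_const).div_const _)
  have hzero : ∀ x ≤ κ, Real.smoothTransition ((x - κ) / (1 - κ)) = 0 := fun x hx =>
    Real.smoothTransition.zero_of_nonpos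
      (div_nonpos_of_nonpos_of_nonneg (by linarith) hpos.le)
  refine ⟨_, hsmooth, hzero, coneMass_pos hsmooth.continuous
    (fun _ => Real.smoothTransition.nonneg _) ?_ (hκ _ hzero)⟩
  rw [div_self hpos.ne', Real.smoothTransition.one]
  exact one_pos

theorem HasLinkNumber.unique {X Y : ℝ → E4} {m n : ℤ} (hm : HasLinkNumber X Y m)
    (hn : HasLinkNumber X Y n) : m = n := by
  obtain ⟨κ, hκm, hκn, θ, hθ, hzero, hpos⟩ :=
    (hm.and (hn.and eventually_exists_coneMass_pos)).exists
  have hmn := (hκm θ hθ hzero).symm.trans (hκn θ hθ hzero)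
  exact_mod_cast mul_left_cancel₀ (neg_ne_zero.2 hpos.ne') hmn

theorem HasLinkNumber.congr {X Y X' Y' : ℝ → E4} {n : ℤ} (h : HasLinkNumber X Y n)
    (heq : ∀ k, IsGaussKernel k → gaussIntegral k X' Y' = gaussIntegral k X Y) :
    HasLinkNumber X' Y' n := by
  filter_upwards [h] with κ hκ θ hθ hzero
  rw [heq _ (isGaussKernel_coneKernel hθ _), hκ θ hθ hzero]

theorem HasLinkNumber.symm {X Y : ℝ → E4} {n : ℤ} (hX : IsLoop X) (hY : IsLoop Y)
    (hXY : UnalignedCurves X Y) (h : HasLinkNumber X Y n) : HasLinkNumber Y X n := by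
  filter_upwards [h] with κ hκ θ hθ hzero
  rw [gaussIntegral_swap (isGaussKernel_coneKernel hθ _) hY hX hXY.symm, ← hκ θ hθ hzero]
  simp only [coneKernel_neg]
  exact gaussIntegral_coneKernel_eq hθ (norm_neg vertical) hX hY hXY

/-! ### Counting the crossings of curves in an affine 3-space -/

/-- The parameters in `[0, 1)` of the common points of the projections of two curves to the plane
of the first two coordinates. -/
def planeCrossings (X Y : ℝ → E4) : Set (ℝ × ℝ) :=
  {p | p.1 ∈ Ico (0 : ℝ) 1 ∧ p.2 ∈ Ico (0 : ℝ) 1 ∧ X p.1 0 = Y p.2 0 ∧ X p.1 1 = Y p.2 1}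

/-- The points of `planeCrossings X Y` at which `X` runs above `Y`. -/
def overCrossings (X Y : ℝ → E4) : Set (ℝ × ℝ) :=
  {p | p ∈ planeCrossings X Y ∧ Y p.2 2 < X p.1 2}

/-- The determinant of the velocities of the projections of two curves to the plane of the first
two coordinates. -/
def crossingDet (X Y : ℝ → E4) (p : ℝ × ℝ) : ℝ :=
  planeDet (deriv X p.1 0, deriv X p.1 1) (deriv Y p.2 0, deriv Y p.2 1)

theorem IsLoop.deriv_apply {X : ℝ → E4} (hX : IsLoop X) (i : Fin 4) (t : ℝ) :
    deriv (fun t => X t i) t = deriv X t i :=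
  ((EuclideanSpace.proj i : E4 →L[ℝ] ℝ).hasFDerivAt.comp_hasDerivAt t (hX.hasDerivAt t)).deriv

theorem fract_eq_self_of_mem_Icc {δ s : ℝ} (hδ : δ ∈ Ioo 0 1) (hs : s ∈ Icc (-δ) (-δ + 1))
    (hfract : Int.fract s < 1 - δ) : Int.fract s = s := by
  refine Int.fract_eq_self.2 ⟨?_, by linarith [hs.2, hδ.1]⟩
  by_contra! hneg
  have hfloor : ⌊s⌋ = -1 := by
    rw [Int.floor_eq_iff]
    push_cast
    exact ⟨by linarith [hs.1, hδ.2], by linarith⟩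
  rw [Int.fract, hfloor] at hfract
  push_cast at hfract
  linarith [hs.1]

section AffineCurves

variable {X Y : ℝ → E4} (hX3 : ∀ s, X s 3 = -1) (hY3 : ∀ t, Y t 3 = -1)

include hX3 hY3

theorem chord_apply_three (p : ℝ × ℝ × ℝ) : chord X Y p 3 = 2 * p.2.2 - 1 := by
  simp only [chord, PiLp.sub_apply, PiLp.smul_apply, smul_eq_mul, hX3, hY3]
  ring

theorem unalignedCurves_of_forall_ne (hne : ∀ s t, X s ≠ Y t) : UnalignedCurves X Y := by
  refine fun s t => mem_unalignedPairs_iff_segment_ne_zero.2 fun r _ h0 => hne s t ?_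
  have hr : r = 1 / 2 := by
    have hchord := chord_apply_three hX3 hY3 (s, t, r)
    rw [chord, h0, PiLp.zero_apply] at hchord
    linarith
  subst hr
  exact smul_right_injective E4 (one_half_pos (α := ℝ)).ne'
    ((congrArg (· • X s) (by norm_num)).trans (sub_eq_zero.1 h0))

theorem sameRay_vertical_chord_iff (hne : ∀ s t, X s ≠ Y t) {p : ℝ × ℝ × ℝ}
    (hr : p.2.2 ∈ Icc 0 1) :
    SameRay ℝ vertical (chord X Y p) ↔ p.2.2 = 1 / 2 ∧
      X p.1 0 = Y p.2.1 0 ∧ X p.1 1 = Y p.2.1 1 ∧ Y p.2.1 2 < X p.1 2 := by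
  obtain ⟨s, t, r⟩ := p
  have hne0 : chord X Y (s, t, r) ≠ 0 :=
    segment_ne_zero (unalignedCurves_of_forall_ne hX3 hY3 hne s t) hr
  rw [sameRay_vertical_iff hne0]
  have h3 := chord_apply_three hX3 hY3 (s, t, r)
  have hcoord : ∀ i, chord X Y (s, t, r) i = (1 - r) * X s i - r * Y t i := fun i => rfl
  constructor
  · rintro ⟨hpos, h0⟩
    simp only [chart, Prod.mk_eq_zero, div_eq_zero_iff, hpos.ne', or_false, h3] at h0
    rw [hcoord] at *
    obtain rfl : r = 1 / 2 := by linarith [h0.2.2]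
    rw [hcoord] at h0
    exact ⟨rfl, by linarith [h0.1], by linarith [h0.2.1], by linarith⟩
  · rintro ⟨rfl, h0, h1, h2⟩
    simp only [chart, h3, hcoord, h0, h1]
    norm_num
    linarith

theorem det4_eq_crossingDet (hX : IsLoop X) (hY : IsLoop Y) {s t : ℝ} (h0 : X s 0 = Y t 0)
    (h1 : X s 1 = Y t 1) :
    det4 (X s) (Y t) (deriv X s) (deriv Y t) = -((X s 2 - Y t 2) * crossingDet X Y (s, t)) := by
  have hX' : deriv X s 3 = 0 := by
    simp only [← hX.deriv_apply, hX3, deriv_const]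
  have hY' : deriv Y t 3 = 0 := by
    simp only [← hY.deriv_apply, hY3, deriv_const]
  simp only [det4_eq_minors, crossingDet, planeDet, h0, h1, hX3, hY3, hX', hY']
  ring

end AffineCurves

section CrossingCount

variable {X Y : ℝ → E4} {δ : ℝ}

theorem IsLoop.apply_fract {X : ℝ → E4} (hX : IsLoop X) (s : ℝ) : X (Int.fract s) = X s := by
  simpa only [Int.fract, mul_one] using hX.periodic.sub_int_mul_eq ⌊s⌋

theorem exists_forall_mem_planeCrossings_lt (hfin : (planeCrossings X Y).Finite) :
    ∃ δ ∈ Ioo (0 : ℝ) 1, ∀ p ∈ planeCrossings X Y, p.1 < 1 - δ ∧ p.2 < 1 - δ := by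
  have hev : ∀ᶠ δ in 𝓝[>] (0 : ℝ), ∀ p ∈ planeCrossings X Y, δ < 1 - p.1 ∧ δ < 1 - p.2 :=
    (Filter.eventually_all_finite hfin).2 fun p hp => nhdsWithin_le_nhds
      ((gt_mem_nhds (sub_pos.2 hp.1.2)).and (gt_mem_nhds (sub_pos.2 hp.2.1.2)))
  obtain ⟨δ, hδ, hδ01⟩ := (hev.and (Ioo_mem_nhdsGT one_pos)).exists
  exact ⟨δ, hδ01, fun p hp => ⟨lt_sub_comm.1 (hδ p hp).1, lt_sub_comm.1 (hδ p hp).2⟩⟩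

theorem mem_planeCrossings_of_mem_Icc (hX : IsLoop X) (hY : IsLoop Y) (hδ : δ ∈ Ioo 0 1)
    (hsep : ∀ p ∈ planeCrossings X Y, p.1 < 1 - δ ∧ p.2 < 1 - δ) {s t : ℝ}
    (hs : s ∈ Icc (-δ) (-δ + 1)) (ht : t ∈ Icc (-δ) (-δ + 1)) (h0 : X s 0 = Y t 0)
    (h1 : X s 1 = Y t 1) : (s, t) ∈ planeCrossings X Y := by
  have hmem : (Int.fract s, Int.fract t) ∈ planeCrossings X Y :=
    ⟨⟨Int.fract_nonneg s, Int.fract_lt_one s⟩, ⟨Int.fract_nonneg t, Int.fract_lt_one t⟩,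
      by simpa only [hX.apply_fract, hY.apply_fract] using ⟨h0, h1⟩⟩
  rwa [fract_eq_self_of_mem_Icc hδ hs (hsep _ hmem).1,
    fract_eq_self_of_mem_Icc hδ ht (hsep _ hmem).2] at hmem

theorem sign_det4_of_mem_overCrossings (hX3 : ∀ s, X s 3 = -1) (hY3 : ∀ t, Y t 3 = -1)
    (hX : IsLoop X) (hY : IsLoop Y) {p : ℝ × ℝ} (hp : p ∈ overCrossings X Y) :
    SignType.sign (det4 (X p.1) (Y p.2) (deriv X p.1) (deriv Y p.2)) =
      -SignType.sign (crossingDet X Y p) := by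
  obtain ⟨⟨-, -, h0, h1⟩, h2⟩ := hp
  rw [det4_eq_crossingDet hX3 hY3 hX hY h0 h1, Left.sign_neg, sign_mul,
    sign_pos (sub_pos.2 h2), one_mul]

theorem hasLinkNumber_finsum_sign_crossingDet (hX : IsLoop X) (hY : IsLoop Y)
    (hX3 : ∀ s, X s 3 = -1) (hY3 : ∀ t, Y t 3 = -1) (hne : ∀ s t, X s ≠ Y t)
    (hfin : (planeCrossings X Y).Finite) (htr : ∀ p ∈ planeCrossings X Y, crossingDet X Y p ≠ 0) :
    HasLinkNumber X Y
      (∑ᶠ p ∈ overCrossings X Y, (SignType.sign (crossingDet X Y p) : ℤ)) := by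
  classical
  have hO : (overCrossings X Y).Finite := hfin.subset fun _ hp => hp.1
  obtain ⟨δ, hδ, hsep⟩ := exists_forall_mem_planeCrossings_lt hfin
  let mid : ℝ × ℝ → ℝ × ℝ × ℝ := fun p => (p.1, p.2, 1 / 2)
  have hmid : Function.Injective mid := fun p q h => by
    simp only [mid, Prod.mk.injEq, and_true] at h
    exact Prod.ext h.1 h.2
  have hhalf : (1 / 2 : ℝ) ∈ Icc 0 1 := by norm_num
  have hS : ∀ {p}, p ∈ hO.toFinset.image mid → ∃ q ∈ overCrossings X Y, mid q = p := fun hp => by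
    simpa only [Finset.mem_image, hO.mem_toFinset] using hp
  have hsum := eventually_gaussIntegral_coneKernel_eq_sum hX hY
    (unalignedCurves_of_forall_ne hX3 hY3 hne) (s₀ := -δ) (t₀ := -δ) (S := hO.toFinset.image mid)
    ?mem ?interior ?ray ?det
  · filter_upwards [hsum] with κ hκ θ hθ hzero
    rw [hκ θ hθ hzero, Finset.sum_image hmid.injOn, finsum_mem_eq_finite_toFinset_sum _ hO,
      Finset.sum_congr rfl fun p hp => by
        rw [sign_det4_of_mem_overCrossings hX3 hY3 hX hY (hO.mem_toFinset.1 hp)]]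
    simp
  case mem =>
    rintro ⟨s, t, r⟩ ⟨⟨hs, ht, hr⟩, hs', ht', hr'⟩ hray
    obtain ⟨rfl, h0, h1, h2⟩ := (sameRay_vertical_chord_iff hX3 hY3 hne ⟨hr, hr'⟩).1 hray
    exact Finset.mem_image_of_mem mid (hO.mem_toFinset.2
      ⟨mem_planeCrossings_of_mem_Icc hX hY hδ hsep ⟨hs, hs'⟩ ⟨ht, ht'⟩ h0 h1, h2⟩)
  case interior =>
    intro p hp
    obtain ⟨q, hq, rfl⟩ := hS hp
    obtain ⟨hq1, hq2⟩ := hsep q hq.1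
    exact ⟨⟨by linarith [hδ.1, hq.1.1.1], by linarith⟩,
      ⟨by linarith [hδ.1, hq.1.2.1.1], by linarith⟩, by norm_num [mid]⟩
  case ray =>
    intro p hp
    obtain ⟨q, hq, rfl⟩ := hS hp
    exact (sameRay_vertical_chord_iff hX3 hY3 hne hhalf).2 ⟨rfl, hq.1.2.2.1, hq.1.2.2.2, hq.2⟩
  case det =>
    intro p hp
    obtain ⟨q, hq, rfl⟩ := hS hp
    rw [← sign_ne_zero, sign_det4_of_mem_overCrossings hX3 hY3 hX hY hq]
    simpa using htr q hq.1

end CrossingCount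

/-! ### Diagrams -/

/-- The knot as a curve in Euclidean 4-space. -/
def Knot.curve (K : Knot) (t : ℝ) : E4 := K t

theorem Knot.isLoop (K : Knot) : IsLoop K.curve where
  periodic t := by simp only [Knot.curve, K.periodic t]
  contDiff := K.smooth.of_le (by exact_mod_cast le_top)

theorem Knot.norm_curve (K : Knot) (t : ℝ) : ‖K.curve t‖ = 1 := norm_eq_of_mem_sphere (K t)

theorem Knot.Disjoint.symm {J K : Knot} (h : J.Disjoint K) : K.Disjoint J :=
  fun s t => (h t s).symm

theorem Knot.Disjoint.curve_ne {J K : Knot} (h : J.Disjoint K) (s t : ℝ) :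
    J.curve s ≠ K.curve t := Subtype.coe_ne_coe.2 (h s t)

theorem Knot.Disjoint.unalignedCurves {J K : Knot} (h : J.Disjoint K) :
    UnalignedCurves J.curve K.curve := fun s t =>
  (not_sameRay_iff_of_norm_eq ((J.norm_curve s).trans (K.norm_curve t).symm)).2 (h.curve_ne s t)

/-- The rotation as an isometry of Euclidean 4-space. -/
def Rotation.toLinearIsometry (A : Rotation) : E4 →ₗᵢ[ℝ] E4 where
  toLinearMap := Matrix.toEuclideanLin A.1
  norm_map' x := by
    have hA : A.1.conjTranspose * A.1 = 1 :=
      (Matrix.mem_orthogonalGroup_iff' _ _).1 (Matrix.mem_specialOrthogonalGroup_iff.1 A.2).1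
    rw [← sq_eq_sq₀ (norm_nonneg _) (norm_nonneg _), ← real_inner_self_eq_norm_sq,
      ← LinearMap.adjoint_inner_left, ← Matrix.toEuclideanLin_conjTranspose_eq_adjoint,
      ← LinearMap.comp_apply, ← Matrix.toLpLin_mul_same, hA, Matrix.toLpLin_one,
      LinearMap.id_apply, real_inner_self_eq_norm_sq]

theorem Rotation.toLinearIsometry_curve_apply (A : Rotation) (K : Knot) (t : ℝ) (i : Fin 4) :
    A.toLinearIsometry (K.curve t) i = rotate A (K t) i := rfl

theorem Rotation.det_toLinearIsometry (A : Rotation) :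
    LinearMap.det A.toLinearIsometry.toLinearMap = 1 :=
  (LinearMap.det_toLpLin _ _).trans (Matrix.mem_specialOrthogonalGroup_iff.1 A.2).2

theorem Rotation.contDiff_rotate (A : Rotation) (K : Knot) (i : Fin 4) :
    ContDiff ℝ ∞ fun t => rotate A (K t) i :=
  contDiff_euclidean.1 (A.toLinearIsometry.contDiff.comp K.smooth) i

theorem Rotation.rotate_apply_le_one (A : Rotation) (x : S3) (i : Fin 4) : rotate A x i ≤ 1 := by
  have h := PiLp.norm_apply_le (A.toLinearIsometry (x : E4)) i
  rw [A.toLinearIsometry.norm_map, norm_eq_of_mem_sphere x] at h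
  exact (le_abs_self _).trans h

/-- The centre of the stereographic projection in `stereo`. -/
def pole : E4 := EuclideanSpace.single 3 1

theorem norm_pole : ‖pole‖ = 1 := by
  rw [pole, PiLp.norm_single, norm_one]

/-- The stereographic image of the knot `K` rotated by `A`, as a curve in the affine 3-space of the
points with last coordinate `-1`; the height `-1` makes it proportional to `A K - pole`. -/
def stereoCurve (A : Rotation) (K : Knot) (t : ℝ) : E4 :=
  !₂[stereo A (K t) 0, stereo A (K t) 1, stereo A (K t) 2, -1]

section StereoCurve

variable {A : Rotation} {K : Knot}

theorem toLinearIsometry_curve_sub_pole {t : ℝ} (hK : rotate A (K t) 3 ≠ 1) :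
    A.toLinearIsometry (K.curve t) - pole = (1 - rotate A (K t) 3) • stereoCurve A K t := by
  have h : 1 - rotate A (K t) 3 ≠ 0 := sub_ne_zero.2 hK.symm
  ext i
  rw [PiLp.sub_apply, Rotation.toLinearIsometry_curve_apply]
  fin_cases i <;> simp [stereoCurve, stereo, pole, mul_div_cancel₀ _ h]

theorem toLinearIsometry_curve_ne_pole {t : ℝ} (hK : rotate A (K t) 3 ≠ 1) :
    A.toLinearIsometry (K.curve t) ≠ pole := fun h => hK <| by
  rw [← Rotation.toLinearIsometry_curve_apply, h, pole, PiLp.single_apply, if_pos rfl]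

theorem contDiff_stereoCurve (hK : ∀ t, rotate A (K t) 3 ≠ 1) : ContDiff ℝ ∞ (stereoCurve A K) := by
  have hstereo : ∀ i, ContDiff ℝ ∞ fun t => stereo A (K t) i := fun i =>
    (A.contDiff_rotate K i.castSucc).div (contDiff_const.sub (A.contDiff_rotate K 3)) fun t =>
      sub_ne_zero.2 (hK t).symm
  refine contDiff_euclidean.2 fun i => ?_
  fin_cases i
  exacts [hstereo 0, hstereo 1, hstereo 2, contDiff_const]

theorem isLoop_stereoCurve (hK : ∀ t, rotate A (K t) 3 ≠ 1) : IsLoop (stereoCurve A K) where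
  periodic t := by simp only [stereoCurve, K.periodic t]
  contDiff := (contDiff_stereoCurve hK).of_le (by exact_mod_cast le_top)

theorem deriv_shadow (hK : ∀ t, rotate A (K t) 3 ≠ 1) (t : ℝ) :
    deriv (shadow A K) t = (deriv (stereoCurve A K) t 0, deriv (stereoCurve A K) t 1) := by
  have hcoord : ∀ i, HasDerivAt (fun t => stereoCurve A K t i) (deriv (stereoCurve A K) t i) t :=
    fun i => (EuclideanSpace.proj i : E4 →L[ℝ] ℝ).hasFDerivAt.comp_hasDerivAt t
      ((isLoop_stereoCurve hK).hasDerivAt t)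
  exact ((hcoord 0).prodMk (hcoord 1)).deriv

theorem shadow_eq_iff {J : Knot} {s t : ℝ} : shadow A J s = shadow A K t ↔
    stereoCurve A J s 0 = stereoCurve A K t 0 ∧ stereoCurve A J s 1 = stereoCurve A K t 1 :=
  Prod.ext_iff

theorem crossings_eq (A : Rotation) (J K : Knot) :
    crossings A J K = planeCrossings (stereoCurve A J) (stereoCurve A K) :=
  Set.ext fun _ => and_congr_right' (and_congr_right' shadow_eq_iff)

theorem stereoCurve_ne {J : Knot} {s t : ℝ} (hJ : rotate A (J s) 3 ≠ 1)
    (hK : rotate A (K t) 3 ≠ 1) (hne : J s ≠ K t) : stereoCurve A J s ≠ stereoCurve A K t := by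
  intro heq
  have hunaligned := sub_mem_unalignedPairs_of_norm_eq (c := pole)
    (x := A.toLinearIsometry (J.curve s)) (y := A.toLinearIsometry (K.curve t))
    (by simp only [LinearIsometry.norm_map, Knot.norm_curve])
    (by rw [LinearIsometry.norm_map, Knot.norm_curve, norm_pole])
    (toLinearIsometry_curve_ne_pole hJ) (toLinearIsometry_curve_ne_pole hK)
    (A.toLinearIsometry.injective.ne (Subtype.coe_ne_coe.2 hne))
  rw [toLinearIsometry_curve_sub_pole hJ, toLinearIsometry_curve_sub_pole hK, heq] at hunaligned
  exact hunaligned (((SameRay.refl _).nonneg_smul_left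
    (sub_nonneg.2 (A.rotate_apply_le_one _ _))).nonneg_smul_right
    (sub_nonneg.2 (A.rotate_apply_le_one _ _)))

end StereoCurve

section Link

variable {A : Rotation} {J K : Knot} (hJ : ∀ t, rotate A (J t) 3 ≠ 1)
  (hK : ∀ t, rotate A (K t) 3 ≠ 1) (hJK : J.Disjoint K)

include hJ hK hJK

theorem gaussIntegral_stereoCurve {θ : ℝ → ℝ} (hθ : ContDiff ℝ 1 θ) :
    gaussIntegral (coneKernel θ vertical) (stereoCurve A J) (stereoCurve A K) =
      gaussIntegral (coneKernel θ vertical) J.curve K.curve := by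
  have hker := isGaussKernel_coneKernel hθ vertical
  have hunaligned := unalignedCurves_of_forall_ne (X := stereoCurve A J) (Y := stereoCurve A K)
    (fun _ => rfl) (fun _ => rfl) fun s t => stereoCurve_ne (hJ s) (hK t) (hJK s t)
  have hscale : ∀ L : Knot, ContDiff ℝ 1 fun t => 1 - rotate A (L t) 3 := fun L =>
    contDiff_const.sub ((A.contDiff_rotate L 3).of_le (by exact_mod_cast le_top))
  have hscale_periodic : ∀ L : Knot, Function.Periodic (fun t => 1 - rotate A (L t) 3) 1 :=
    fun L t => by simp only [L.periodic t]
  have hscale_pos : ∀ L : Knot, (∀ t, rotate A (L t) 3 ≠ 1) → ∀ t, 0 < 1 - rotate A (L t) 3 :=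
    fun L hL t => sub_pos.2 ((A.rotate_apply_le_one _ _).lt_of_ne (hL t))
  rw [← gaussIntegral_smul hker (isLoop_stereoCurve hJ) (isLoop_stereoCurve hK)
    hunaligned (hscale J) (hscale K) (hscale_periodic J) (hscale_periodic K) (hscale_pos J hJ)
    (hscale_pos K hK)]
  simp only [← toLinearIsometry_curve_sub_pole (hJ _), ← toLinearIsometry_curve_sub_pole (hK _)]
  have hnorm : ∀ (L : Knot) t, ‖A.toLinearIsometry (L.curve t)‖ = 1 := fun L t => by
    rw [LinearIsometry.norm_map, Knot.norm_curve]
  have hmap : ∀ L : Knot, IsLoop fun t => A.toLinearIsometry (L.curve t) := fun L =>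
    L.isLoop.clm_comp A.toLinearIsometry.toContinuousLinearMap
  have hmap_unaligned : UnalignedCurves (fun t => A.toLinearIsometry (J.curve t))
      fun t => A.toLinearIsometry (K.curve t) :=
    hJK.unalignedCurves.clm_comp (L := A.toLinearIsometry.toContinuousLinearMap)
      A.toLinearIsometry.injective
  rw [gaussIntegral_sub_const hker (hmap J) (hmap K) (hnorm J) (hnorm K) norm_pole.le
      (fun t => toLinearIsometry_curve_ne_pole (hJ t))
      (fun t => toLinearIsometry_curve_ne_pole (hK t))
      (fun s t => A.toLinearIsometry.injective.ne (hJK.curve_ne s t)),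
    gaussIntegral_coneKernel_eq hθ (A.toLinearIsometry.norm_map vertical).symm (hmap J) (hmap K)
      hmap_unaligned,
    gaussIntegral_coneKernel_map hθ _ _ J.isLoop K.isLoop hJK.unalignedCurves,
    A.det_toLinearIsometry, one_mul]

end Link

/-- The condition on a projection of two knots under which their crossings can be counted: it is
transversal at the finitely many crossings between `J` and `K`. Unlike in `IsDiagram`, there is no
condition on self-crossings. -/
structure IsTransversal (A : Rotation) (J K : Knot) : Prop where
  misses_left : ∀ t, rotate A (J t) 3 ≠ 1
  misses_right : ∀ t, rotate A (K t) 3 ≠ 1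
  finite : (crossings A J K).Finite
  transversal : ∀ p ∈ crossings A J K,
    planeDet (deriv (shadow A J) p.1) (deriv (shadow A K) p.2) ≠ 0

theorem swap_mem_crossings {A : Rotation} {J K : Knot} {p : ℝ × ℝ} :
    p.swap ∈ crossings A K J ↔ p ∈ crossings A J K :=
  ⟨fun h => ⟨h.2.1, h.1, h.2.2.symm⟩, fun h => ⟨h.2.1, h.1, h.2.2.symm⟩⟩

theorem planeDet_swap (v w : ℝ × ℝ) : planeDet w v = -planeDet v w := by
  unfold planeDet; ring

theorem IsTransversal.symm {A : Rotation} {J K : Knot} (h : IsTransversal A J K) :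
    IsTransversal A K J where
  misses_left := h.misses_right
  misses_right := h.misses_left
  finite := h.finite.of_injOn (f := Prod.swap) (fun _ hp => swap_mem_crossings.2 hp)
    Prod.swap_injective.injOn
  transversal p hp := by
    rw [planeDet_swap]
    exact neg_ne_zero.2 (h.transversal p.swap (swap_mem_crossings.2 hp))

theorem IsDiagram.isTransversal {A : Rotation} {J K : Knot} (h : IsDiagram A ![J, K]) :
    IsTransversal A J K := by
  have hmem : ∀ p ∈ crossings A J K,
      (((0 : Fin 2), p.1), ((1 : Fin 2), p.2)) ∈ doublePoints A ![J, K] := fun p hp =>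
    ⟨hp.1, hp.2.1, fun heq => zero_ne_one (congrArg Prod.fst heq), hp.2.2⟩
  have hinj : Function.Injective fun p : ℝ × ℝ => (((0 : Fin 2), p.1), ((1 : Fin 2), p.2)) :=
    fun p q heq => Prod.ext (congrArg (fun x => x.1.2) heq) (congrArg (fun x => x.2.2) heq)
  refine ⟨h.misses_pole 0, h.misses_pole 1, h.finite.of_injOn hmem hinj.injOn, fun p hp => ?_⟩
  have htrans := h.transversal _ (hmem p hp)
  exact htrans

/-- The sum of the signs of the crossings at which `J` runs above `K`. -/
def overSum (A : Rotation) (J K : Knot) : ℤ :=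
  ∑ᶠ p ∈ {p : ℝ × ℝ | p ∈ crossings A J K ∧ height A K p.2 < height A J p.1},
    (SignType.sign (planeDet (deriv (shadow A J) p.1) (deriv (shadow A K) p.2)) : ℤ)

section Transversal

variable {A : Rotation} {J K : Knot} (h : IsTransversal A J K) (hJK : J.Disjoint K)

include h hJK

theorem IsTransversal.height_ne {p : ℝ × ℝ} (hp : p ∈ crossings A J K) :
    height A J p.1 ≠ height A K p.2 := fun h2 => by
  obtain ⟨h0, h1⟩ := shadow_eq_iff.1 hp.2.2
  refine stereoCurve_ne (h.misses_left _) (h.misses_right _) (hJK p.1 p.2) (PiLp.ext fun i => ?_)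
  fin_cases i
  exacts [h0, h1, h2, rfl]

theorem IsTransversal.hasLinkNumber : HasLinkNumber J.curve K.curve (overSum A J K) := by
  have hsign : ∀ p, planeDet (deriv (shadow A J) p.1) (deriv (shadow A K) p.2) =
      crossingDet (stereoCurve A J) (stereoCurve A K) p := fun p => by
    rw [deriv_shadow h.misses_left, deriv_shadow h.misses_right, crossingDet]
  have hcount := hasLinkNumber_finsum_sign_crossingDet (isLoop_stereoCurve h.misses_left)
    (isLoop_stereoCurve h.misses_right) (fun _ => rfl) (fun _ => rfl)
    (fun s t => stereoCurve_ne (h.misses_left s) (h.misses_right t) (hJK s t))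
    (crossings_eq A J K ▸ h.finite) fun p hp => hsign p ▸ h.transversal p (crossings_eq A J K ▸ hp)
  have hover : overSum A J K = ∑ᶠ p ∈ overCrossings (stereoCurve A J) (stereoCurve A K),
      (SignType.sign (crossingDet (stereoCurve A J) (stereoCurve A K) p) : ℤ) := by
    simp only [overSum, hsign, crossings_eq]
    rfl
  filter_upwards [hcount] with κ hκ θ hθ hzero
  rw [← gaussIntegral_stereoCurve h.misses_left h.misses_right hJK hθ, hκ θ hθ hzero, hover]

theorem IsTransversal.crossingSum_eq : crossingSum A J K = overSum A J K + overSum A K J := by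
  have hsplit : crossings A J K =
      {p : ℝ × ℝ | p ∈ crossings A J K ∧ height A K p.2 < height A J p.1} ∪
      {p : ℝ × ℝ | p ∈ crossings A J K ∧ height A J p.1 < height A K p.2} := by
    ext p
    simp only [mem_union, mem_ofPred_eq, ← and_or_left]
    exact ⟨fun hp => ⟨hp, (h.height_ne hJK hp).lt_or_gt.symm⟩, And.left⟩
  rw [crossingSum, hsplit, finsum_mem_union (disjoint_left.2 fun p hp hp' => lt_asymm hp.2 hp'.2)
    (h.finite.subset fun p hp => hp.1) (h.finite.subset fun p hp => hp.1)]
  congr 1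
  · exact finsum_mem_congr rfl fun p hp => if_pos hp.2
  · exact finsum_mem_eq_of_bijOn Prod.swap ⟨fun p hp => ⟨swap_mem_crossings.2 hp.1, hp.2⟩,
      Prod.swap_injective.injOn, fun p hp => ⟨p.swap, ⟨swap_mem_crossings.2 hp.1, hp.2⟩,
        p.swap_swap⟩⟩ fun p hp => if_neg (not_lt_of_gt hp.2)

theorem IsTransversal.crossingSum_eq_two_mul {n : ℤ} (hn : HasLinkNumber J.curve K.curve n) :
    crossingSum A J K = 2 * n := by
  have hover : overSum A J K = n := (h.hasLinkNumber hJK).unique hn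
  have hunder : overSum A K J = n := ((h.symm.hasLinkNumber hJK.symm).symm K.isLoop J.isLoop
    hJK.symm.unalignedCurves).unique hn
  rw [h.crossingSum_eq hJK, hover, hunder, two_mul]

end Transversal

theorem Knot.Disjoint.hasLinkNumber_lk {J K : Knot} (hJK : J.Disjoint K)
    (hdiagram : ∃ A, IsDiagram A ![J, K]) : HasLinkNumber J.curve K.curve (lk J K) := by
  have htrans := hdiagram.choose_spec.isTransversal
  have hover := htrans.hasLinkNumber hJK
  rwa [lk, dif_pos hdiagram, htrans.crossingSum_eq_two_mul hJK hover,
    Int.mul_ediv_cancel_left _ two_ne_zero]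

/-! ### Reversal, isotopy and crossing changes -/

theorem gaussIntegral_comp_neg (h : E4 → ℝ) {X : ℝ → E4} (hX : IsLoop X) (Y : ℝ → E4) :
    gaussIntegral h (fun t => X (-t)) Y = -gaussIntegral h X Y := by
  have hperiodic : Function.Periodic (fun s => linkForm h Y (X s) (deriv X s)) 1 := fun s => by
    simp only [hX.periodic s, hX.deriv_periodic s]
  have hshift := hperiodic.intervalIntegral_add_eq (-1) 0
  rw [neg_add_cancel, zero_add] at hshift
  simp only [gaussIntegral, deriv_comp_neg, map_neg]
  rw [intervalIntegral.integral_neg, intervalIntegral.integral_comp_neg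
    fun s => linkForm h Y (X s) (deriv X s), neg_zero, hshift]

theorem HasLinkNumber.comp_neg_left {X Y : ℝ → E4} (hX : IsLoop X) {n : ℤ}
    (h : HasLinkNumber X Y n) : HasLinkNumber (fun t => X (-t)) Y (-n) := by
  filter_upwards [h] with κ hκ θ hθ hzero
  rw [gaussIntegral_comp_neg _ hX, hκ θ hθ hzero, Int.cast_neg, mul_neg]

theorem Knot.Disjoint.reverse_left {J K : Knot} (h : J.Disjoint K) : J.reverse.Disjoint K :=
  fun s t => h (-s) t

theorem HasLinkNumber.reverse_left {J K : Knot} {n : ℤ} (h : HasLinkNumber J.curve K.curve n) :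
    HasLinkNumber J.reverse.curve K.curve (-n) := h.comp_neg_left J.isLoop

theorem HasLinkNumber.reverse_right {J K : Knot} (hJK : J.Disjoint K) {n : ℤ}
    (h : HasLinkNumber J.curve K.curve n) : HasLinkNumber J.curve K.reverse.curve (-n) :=
  (h.symm J.isLoop K.isLoop hJK.unalignedCurves).reverse_left.symm K.reverse.isLoop J.isLoop
    hJK.symm.reverse_left.unalignedCurves

theorem Knot.contMDiff (K : Knot) : ContMDiff 𝓘(ℝ, ℝ) (𝓡 3) ∞ K :=
  K.smooth.contMDiff.codRestrict_sphere fun t => (K t).2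

theorem gaussIntegral_eq_of_isotopy {h : E4 → ℝ} (hh : IsGaussKernel h) {J K J' K' : Knot}
    (hJK : J.Disjoint K) {H : ℝ → Diffeomorph (𝓡 3) (𝓡 3) S3 S3 ∞}
    (hH : ContMDiff (𝓘(ℝ, ℝ).prod (𝓡 3)) (𝓡 3) ∞ (fun p : ℝ × S3 => H p.1 p.2))
    (h0 : ∀ x, H 0 x = x) (hJ : ∀ t, H 1 (J t) = J' t) (hK : ∀ t, H 1 (K t) = K' t) :
    gaussIntegral h J'.curve K'.curve = gaussIntegral h J.curve K.curve := by
  have hcontinuous : ∀ L : Knot, Continuous (Function.uncurry fun τ t => ((H τ (L t) : S3) : E4)) :=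
    fun L => continuous_subtype_val.comp (hH.continuous.comp
      (continuous_fst.prodMk (L.contMDiff.continuous.comp continuous_snd)))
  have hsmooth : ∀ (L : Knot) (τ : ℝ), ContMDiff 𝓘(ℝ, ℝ) 𝓘(ℝ, E4) ∞
      fun t => ((H τ (L t) : S3) : E4) := fun L τ =>
    contMDiff_coe_sphere.comp ((H τ).contMDiff.comp L.contMDiff)
  have hloop : ∀ (L : Knot) (τ : ℝ), IsLoop fun t => ((H τ (L t) : S3) : E4) := fun L τ =>
    ⟨fun t => by simp only [L.periodic t], (hsmooth L τ).contDiff.of_le (by exact_mod_cast le_top)⟩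
  have hunaligned : ∀ τ, UnalignedCurves (fun t => ((H τ (J t) : S3) : E4))
      fun t => ((H τ (K t) : S3) : E4) := fun τ s t =>
    (not_sameRay_iff_of_norm_eq ((norm_eq_of_mem_sphere _).trans
      (norm_eq_of_mem_sphere _).symm)).2 fun heq =>
        hJK s t ((H τ).injective (Subtype.coe_injective heq))
  have heq := gaussIntegral_eq_of_homotopy hh (hcontinuous J) (hcontinuous K) (hloop J) (hloop K)
    hunaligned 1 0
  simp only [hJ, hK, h0] at heq
  exact heq

theorem AmbientIsotopic.disjoint {J K : Knot} {L : Fin 2 → Knot} (h : AmbientIsotopic ![J, K] L)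
    (hJK : J.Disjoint K) : (L 0).Disjoint (L 1) := by
  obtain ⟨H, -, -, h1⟩ := h
  intro s t heq
  rw [← h1 0 s, ← h1 1 t] at heq
  exact hJK s t ((H 1).injective heq)

theorem AmbientIsotopic.hasLinkNumber {J K : Knot} {L : Fin 2 → Knot}
    (h : AmbientIsotopic ![J, K] L) (hJK : J.Disjoint K) {n : ℤ}
    (hn : HasLinkNumber J.curve K.curve n) : HasLinkNumber (L 0).curve (L 1).curve n := by
  obtain ⟨H, hH, h0, h1⟩ := h
  exact hn.congr fun k hk => gaussIntegral_eq_of_isotopy hk hJK hH h0 (h1 0) (h1 1)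

theorem DiffersByCrossingChange.crossingSum_eq {A : Rotation} {L L' : Fin 2 → Knot}
    (h : DiffersByCrossingChange A L L' 0) :
    crossingSum A (L 0) (L 1) = crossingSum A (L' 0) (L' 1) := by
  obtain ⟨-, -, hshadow', s₀, t₀, -, -, -, hheight⟩ := h
  have hshadow : ∀ j, shadow A (L j) = shadow A (L' j) := fun j => funext (hshadow' j)
  have hcrossings : crossings A (L 0) (L 1) = crossings A (L' 0) (L' 1) := by
    simp only [crossings, hshadow]
  refine finsum_mem_congr hcrossings fun p hp => ?_
  rw [← hcrossings] at hp
  have hswap : height A (L 1) p.2 < height A (L 0) p.1 ↔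
      height A (L' 1) p.2 < height A (L' 0) p.1 :=
    hheight (1, p.2) (0, p.1)
      ⟨hp.2.1, hp.1, fun heq => one_ne_zero (congrArg Prod.fst heq), hp.2.2.symm⟩
      (fun heq => one_ne_zero (congrArg (fun x => x.1.1) heq))
      (fun heq => one_ne_zero (congrArg (fun x => x.1.1) heq))
  simp only [crossingSign, hshadow, hswap]

theorem IsCrossingChange.linkNumber_eq {J K M : Knot} (h : IsCrossingChange J K M)
    (hJ : J.Disjoint M) (hK : K.Disjoint M) {m n : ℤ} (hm : HasLinkNumber J.curve M.curve m)
    (hn : HasLinkNumber K.curve M.curve n) : m = n := by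
  obtain ⟨A, L, L', hL, hL', hchange⟩ := h
  have htrans : ∀ L : Fin 2 → Knot, IsDiagram A L → IsTransversal A (L 0) (L 1) := fun L h => by
    have hvec : ![L 0, L 1] = L := List.ofFn_injective rfl
    exact (hvec ▸ h).isTransversal
  have hsum : 2 * m = 2 * n := by
    rw [← (htrans L hchange.1).crossingSum_eq_two_mul (hL.disjoint hJ) (hL.hasLinkNumber hJ hm),
      ← (htrans L' hchange.2.1).crossingSum_eq_two_mul (hL'.disjoint hK)
        (hL'.hasLinkNumber hK hn), hchange.crossingSum_eq]
  exact mul_left_cancel₀ two_ne_zero hsum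

/-! ### Connected sums -/

theorem PrimitiveOn.sub_eq_sub {E α β : Type*} [NormedAddCommGroup E] [NormedSpace ℝ E]
    [TopologicalSpace α] [TopologicalSpace β] {η : E → E →L[ℝ] ℝ} {X : α → E} {Y : β → E}
    {F : α → ℝ} {G : β → ℝ} {S : Set α} {T : Set β} (hF : PrimitiveOn η X F S)
    (hG : PrimitiveOn η Y G T) (hX : ContinuousOn X S) {s t : ℝ} (hst : s ≤ t) {γ : ℝ → α}
    {δ : ℝ → β} (hγ : ContinuousOn γ (Icc s t)) (hδ : ContinuousOn δ (Icc s t))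
    (hγS : MapsTo γ (Icc s t) S) (hδT : MapsTo δ (Icc s t) T)
    (h : ∀ u ∈ Icc s t, X (γ u) = Y (δ u)) : F (γ t) - F (γ s) = G (δ t) - G (δ s) := by
  have hGX := (hG.comp hδ hδT).congr_map (D' := X ∘ γ) fun u hu => (h u hu).symm
  have hconst := (hF.comp hγ hγS).sub_eq_const isPreconnected_Icc (hX.comp hγ hγS) hGX
    (left_mem_Icc.2 hst) (right_mem_Icc.2 hst)
  simp only [Function.comp_apply] at hconst
  linarith

theorem exists_primitiveOn_linkForm {k : E4 → ℝ} (hk : IsGaussKernel k) {X Y : ℝ → E4}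
    (hX : IsLoop X) (hY : IsLoop Y) (hXY : UnalignedCurves X Y) :
    ∃ G : ℝ → ℝ, PrimitiveOn (linkForm k Y) X G univ ∧
      ∀ a, G (a + 1) - G a = gaussIntegral k X Y := by
  have hη := continuousOn_linkForm hk hY
  have hcont : Continuous fun s => linkForm k Y (X s) (deriv X s) :=
    (hη.comp_continuous hX.continuous hXY).clm_apply hX.continuous_deriv
  have hperiodic : Function.Periodic (fun s => linkForm k Y (X s) (deriv X s)) 1 := fun s => by
    simp only [hX.periodic s, hX.deriv_periodic s]
  refine ⟨_, primitiveOn_integral (locallyExact_linkForm hk hY) hη hX.contDiff hXY, fun a => ?_⟩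
  rw [intervalIntegral.integral_interval_sub_left (hcont.intervalIntegrable _ _)
    (hcont.intervalIntegrable _ _), hperiodic.intervalIntegral_add_eq a 0, zero_add, gaussIntegral]

theorem exists_mem_Icc_eq_add_mul {s t x : ℝ} (h : s < t) (hx : x ∈ Icc s t) :
    ∃ u ∈ Icc (0 : ℝ) 1, s + u * (t - s) = x := by
  rwa [← segment_eq_Icc h.le, segment_eq_image'] at hx

theorem Traces.mem_range {f g : ℝ → S3} {s t u v : ℝ} (h : Traces f s t g u v) {x : ℝ}
    (hx : x ∈ Icc s t) : f x ∈ range g := by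
  obtain ⟨φ, -, -, -, -, h⟩ := h
  exact ⟨φ x, (h x hx).symm⟩

theorem exists_forall_sub_eq_sub_of_disc {k : E4 → ℝ} (hk : IsGaussKernel k) {D : ℝ × ℝ → S3}
    (M : Knot) (hDcont : ContinuousOn D unitSquare) (hD : ∀ q ∈ unitSquare, D q ∉ range M) :
    ∃ F : ℝ × ℝ → ℝ, ∀ (γ : ℝ → ℝ × ℝ) (L : Knot) (G : ℝ → ℝ) (u v : ℝ), Continuous γ →
      MapsTo γ (Icc 0 1) unitSquare → PrimitiveOn (linkForm k M.curve) L.curve G univ →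
      (∀ t ∈ Icc (0 : ℝ) 1, D (γ t) = L (u + t * (v - u))) → F (γ 1) - F (γ 0) = G v - G u := by
  have hDcurve : ContinuousOn (fun q => (D q : E4)) unitSquare :=
    continuous_subtype_val.comp_continuousOn hDcont
  obtain ⟨F, hF⟩ := (locallyExact_linkForm hk M.isLoop).exists_primitiveOn_square hDcurve
    fun q hq t => (not_sameRay_iff_of_norm_eq ((norm_eq_of_mem_sphere _).trans
      (M.norm_curve t).symm)).2 (Subtype.coe_ne_coe.2 fun heq => hD q hq ⟨t, heq.symm⟩)
  refine ⟨F, fun γ L G u v hγ hmaps hG heq => ?_⟩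
  simpa only [one_mul, zero_mul, add_zero, add_sub_cancel] using
    hF.sub_eq_sub hG hDcurve zero_le_one hγ.continuousOn (by fun_prop) hmaps
      (mapsTo_univ (fun t => u + t * (v - u)) _) fun t ht => congrArg Subtype.val (heq t ht)

section ConnectedSum

variable {D : ℝ × ℝ → S3} {K₁ K₂ K K₃ : Knot} (h : IsConnectedSumAlong D K₁ K₂ K)
  (h₁ : K₁.Disjoint K₃) (h₂ : K₂.Disjoint K₃) (hD : ∀ q ∈ unitSquare, D q ∉ range K₃)

include h h₁ h₂ hD

theorem IsConnectedSumAlong.disjoint : K.Disjoint K₃ := by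
  obtain ⟨-, -, -, -, a, b, c, d, p₀, p₁, p₂, p₃, -, -, -, -, -, hp₁, -, hp₃, -, -, harc₁, hlower,
    harc₂, hupper⟩ := h
  intro s t heq
  obtain ⟨x, hx, hsx⟩ := K.periodic.exists_mem_Ico one_pos s p₀
  rw [hsx] at heq
  rcases le_total x p₁ with hx₁ | hx₁
  · obtain ⟨y, hy⟩ := harc₁.mem_range ⟨hx.1, hx₁⟩
    exact h₁ y t (hy.trans heq)
  rcases le_total x p₂ with hx₂ | hx₂
  · obtain ⟨u, hu, rfl⟩ := exists_mem_Icc_eq_add_mul hp₁ ⟨hx₁, hx₂⟩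
    exact hD (u, 0) ⟨hu, left_mem_Icc.2 zero_le_one⟩ ⟨t, by rw [← heq, hlower u hu]⟩
  rcases le_total x p₃ with hx₃ | hx₃
  · obtain ⟨y, hy⟩ := harc₂.mem_range ⟨hx₂, hx₃⟩
    exact h₂ y t (hy.trans heq)
  · obtain ⟨u, hu, rfl⟩ := exists_mem_Icc_eq_add_mul hp₃ ⟨hx₃, hx.2.le⟩
    exact hD (1 - u, 1) ⟨Icc.mem_iff_one_sub_mem.1 hu, right_mem_Icc.2 zero_le_one⟩
      ⟨t, by rw [← heq, hupper u hu]⟩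

theorem IsConnectedSumAlong.gaussIntegral_eq_add {k : E4 → ℝ} (hk : IsGaussKernel k) :
    gaussIntegral k K.curve K₃.curve =
      gaussIntegral k K₁.curve K₃.curve + gaussIntegral k K₂.curve K₃.curve := by
  obtain ⟨G, hG, hG_period⟩ := exists_primitiveOn_linkForm hk K.isLoop K₃.isLoop
    (h.disjoint h₁ h₂ hD).unalignedCurves
  obtain ⟨G₁, hG₁, hG₁_period⟩ := exists_primitiveOn_linkForm hk K₁.isLoop K₃.isLoop
    h₁.unalignedCurves
  obtain ⟨G₂, hG₂, hG₂_period⟩ := exists_primitiveOn_linkForm hk K₂.isLoop K₃.isLoop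
    h₂.unalignedCurves
  obtain ⟨hDcont, -, -, -, a, b, c, d, p₀, p₁, p₂, p₃, -, -, -, -, hp₀, -, hp₂, -, hleft, hright,
    ⟨φ₁, hφ₁, -, hφ₁s, hφ₁t, harc₁⟩, hlower, ⟨φ₂, hφ₂, -, hφ₂s, hφ₂t, harc₂⟩, hupper⟩ := h
  obtain ⟨F, hF⟩ := exists_forall_sub_eq_sub_of_disc hk K₃ hDcont hD
  have h0 : (0 : ℝ) ∈ Icc (0 : ℝ) 1 := left_mem_Icc.2 zero_le_one
  have h1 : (1 : ℝ) ∈ Icc (0 : ℝ) 1 := right_mem_Icc.2 zero_le_one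
  have hKcont : ContinuousOn K.curve univ := K.isLoop.continuous.continuousOn
  have hleft' := hF (fun t => (0, t)) K₁ G₁ a b (by fun_prop) (fun t ht => ⟨h0, ht⟩) hG₁ hleft
  have hright' := hF (fun t => (1, 1 - t)) K₂ G₂ c d (by fun_prop)
    (fun t ht => ⟨h1, Icc.mem_iff_one_sub_mem.1 ht⟩) hG₂ hright
  have hlower' := hF (fun t => (t, 0)) K G p₁ p₂ (by fun_prop) (fun t ht => ⟨ht, h0⟩) hG
    fun t ht => (hlower t ht).symm
  have hupper' := hF (fun t => (1 - t, 1)) K G p₃ (p₀ + 1) (by fun_prop)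
    (fun t ht => ⟨Icc.mem_iff_one_sub_mem.1 ht, h1⟩) hG fun t ht => (hupper t ht).symm
  have harc₁' := hG.sub_eq_sub hG₁ hKcont hp₀.le continuousOn_id hφ₁ (mapsTo_univ _ _)
    (mapsTo_univ _ _) fun u hu => congrArg Subtype.val (harc₁ u hu)
  have harc₂' := hG.sub_eq_sub hG₂ hKcont hp₂.le continuousOn_id hφ₂ (mapsTo_univ _ _)
    (mapsTo_univ _ _) fun u hu => congrArg Subtype.val (harc₂ u hu)
  simp only [id_eq, hφ₁s, hφ₁t, hφ₂s, hφ₂t, sub_self, sub_zero] at harc₁' harc₂' hright' hupper'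
  linarith [hG_period p₀, hG₁_period a, hG₂_period c]

theorem IsConnectedSumAlong.hasLinkNumber {m n : ℤ} (hm : HasLinkNumber K₁.curve K₃.curve m)
    (hn : HasLinkNumber K₂.curve K₃.curve n) : HasLinkNumber K.curve K₃.curve (m + n) := by
  filter_upwards [hm, hn] with κ hκm hκn θ hθ hzero
  rw [h.gaussIntegral_eq_add h₁ h₂ hD (isGaussKernel_coneKernel hθ _), hκm θ hθ hzero,
    hκn θ hθ hzero, Int.cast_add, mul_add]

end ConnectedSum

/-! ### Generic oblique projections of space curves -/

/-- The projection of 3-space, written as plane times height, to the horizontal plane along the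
direction `(v, 1)`. -/
def obliqueProj (v : ℝ × ℝ) : (ℝ × ℝ) × ℝ →L[ℝ] ℝ × ℝ :=
  .fst ℝ _ _ - (ContinuousLinearMap.snd ℝ _ _).smulRight v

theorem obliqueProj_apply (v : ℝ × ℝ) (w : (ℝ × ℝ) × ℝ) : obliqueProj v w = w.1 - w.2 • v := rfl

/-- The vector `v` for which `(v, 1)` is parallel to the vector `w` of 3-space; it has the junk
value `0` for horizontal `w`. -/
def direction (w : (ℝ × ℝ) × ℝ) : ℝ × ℝ := w.2⁻¹ • w.1

theorem direction_eq_iff {w : (ℝ × ℝ) × ℝ} (hw : w.2 ≠ 0) {v : ℝ × ℝ} :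
    direction w = v ↔ obliqueProj v w = 0 := by
  rw [direction, inv_smul_eq_iff₀ hw, obliqueProj_apply, sub_eq_zero]

theorem hasFDerivAt_direction {w : (ℝ × ℝ) × ℝ} (hw : w.2 ≠ 0) :
    HasFDerivAt direction (w.2⁻¹ • obliqueProj (direction w)) w := by
  refine ((hasFDerivAt_inv hw).comp w hasFDerivAt_snd |>.smul hasFDerivAt_fst).congr_fderiv ?_
  ext <;> simp [obliqueProj_apply, direction] <;> field_simp

theorem planeDet_smul_smul (a b : ℝ) (v w : ℝ × ℝ) :
    planeDet (a • v) (b • w) = a * b * planeDet v w := by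
  simp only [planeDet, Prod.smul_fst, Prod.smul_snd, smul_eq_mul]; ring

theorem det_eq_planeDet (L : ℝ × ℝ →L[ℝ] ℝ × ℝ) : L.det = planeDet (L (1, 0)) (L (0, 1)) := by
  rw [ContinuousLinearMap.det, ← LinearMap.det_toMatrix (Module.Basis.finTwoProd ℝ),
    Matrix.det_fin_two]
  simp [LinearMap.toMatrix_apply, planeDet, mul_comm]

theorem planeDet_map (L : ℝ × ℝ →L[ℝ] ℝ × ℝ) (v w : ℝ × ℝ) :
    planeDet (L v) (L w) = L.det * planeDet v w := by
  have hmap : ∀ v : ℝ × ℝ, L v = v.1 • L (1, 0) + v.2 • L (0, 1) := fun v => by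
    rw [← map_smul, ← map_smul, ← map_add]
    simp
  rw [det_eq_planeDet, hmap v, hmap w]
  simp only [planeDet, Prod.fst_add, Prod.snd_add, Prod.smul_fst, Prod.smul_snd, smul_eq_mul]
  ring

theorem volume_image_eq_zero_of_differentiableOn {f : ℝ → ℝ × ℝ} {S : Set ℝ}
    (hf : DifferentiableOn ℝ f S) : volume (f '' S) = 0 := by
  have hnull : volume (S ×ˢ ({0} : Set ℝ)) = 0 := by
    rw [Measure.volume_eq_prod, Measure.prod_prod, Real.volume_singleton, mul_zero]
  have := Measure.prod.instIsAddHaarMeasure (volume : Measure ℝ) (volume : Measure ℝ)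
  have himage := addHaar_image_eq_zero_of_differentiableOn_of_addHaar_eq_zero
    (volume.prod volume) (hf.comp differentiableOn_fst fun p (hp : p ∈ S ×ˢ {0}) => hp.1) hnull
  rwa [image_comp, fst_image_prod _ (singleton_nonempty 0)] at himage

theorem ae_obliqueProj_deriv_ne_zero {γ : ℝ → (ℝ × ℝ) × ℝ} (hγ : ContDiff ℝ 2 γ)
    (himm : ∀ t, deriv γ t ≠ 0) : ∀ᵐ v, ∀ t, obliqueProj v (deriv γ t) ≠ 0 := by
  have hderiv : Differentiable ℝ (deriv γ) :=
    ((contDiff_succ_iff_deriv (n := 1)).1 hγ).2.2.differentiable one_ne_zero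
  have hdir : DifferentiableOn ℝ (direction ∘ deriv γ) {t | (deriv γ t).2 ≠ 0} := fun t ht =>
    ((hasFDerivAt_direction ht).differentiableAt.comp t (hderiv t)).differentiableWithinAt
  filter_upwards [measure_eq_zero_iff_ae_notMem.1 (volume_image_eq_zero_of_differentiableOn hdir)]
    with v hv t hzero
  have hne : (deriv γ t).2 ≠ 0 := fun hz => himm t <| by
    rw [obliqueProj_apply, hz, zero_smul, sub_zero] at hzero
    exact Prod.ext hzero hz
  exact hv ⟨t, hne, (direction_eq_iff hne).2 hzero⟩

theorem hasFDerivAt_fst_sub_snd {E : Type*} [NormedAddCommGroup E] [NormedSpace ℝ E]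
    {f g : ℝ → E} {v w : E} {s t : ℝ} (hf : HasDerivAt f v s) (hg : HasDerivAt g w t) :
    HasFDerivAt (fun p : ℝ × ℝ => f p.1 - g p.2)
      ((ContinuousLinearMap.fst ℝ ℝ ℝ).smulRight v -
        (ContinuousLinearMap.snd ℝ ℝ ℝ).smulRight w) (s, t) := by
  refine ((hf.hasFDerivAt.comp (s, t) (hasFDerivAt_fst (𝕜 := ℝ) (p := (s, t)))).sub
    (hg.hasFDerivAt.comp (s, t) (hasFDerivAt_snd (𝕜 := ℝ) (p := (s, t))))).congr_fderiv ?_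
  ext <;> simp

section Chords

variable {γ δ ε : ℝ → (ℝ × ℝ) × ℝ}

theorem hasFDerivAt_direction_chord {s t : ℝ} (hγ : DifferentiableAt ℝ γ s)
    (hδ : DifferentiableAt ℝ δ t) (hst : (γ s - δ t).2 ≠ 0) :
    HasFDerivAt (fun p : ℝ × ℝ => direction (γ p.1 - δ p.2))
      (((γ s - δ t).2⁻¹ • obliqueProj (direction (γ s - δ t))).comp
        ((ContinuousLinearMap.fst ℝ ℝ ℝ).smulRight (deriv γ s) -
          (ContinuousLinearMap.snd ℝ ℝ ℝ).smulRight (deriv δ t))) (s, t) :=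
  HasFDerivAt.comp (f := fun p : ℝ × ℝ => γ p.1 - δ p.2) (s, t) (hasFDerivAt_direction hst)
    (hasFDerivAt_fst_sub_snd hγ.hasDerivAt hδ.hasDerivAt)

theorem ae_planeDet_obliqueProj_ne_zero (hγ : Differentiable ℝ γ) (hδ : Differentiable ℝ δ) :
    ∀ᵐ v, ∀ s t, (γ s).2 ≠ (δ t).2 → obliqueProj v (γ s) = obliqueProj v (δ t) →
      planeDet (obliqueProj v (deriv γ s)) (obliqueProj v (deriv δ t)) ≠ 0 := by
  set F : ℝ × ℝ → ℝ × ℝ := fun p => direction (γ p.1 - δ p.2)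
  have hF : ∀ s t, (γ s - δ t).2 ≠ 0 → HasFDerivAt F _ (s, t) := fun s t hst =>
    hasFDerivAt_direction_chord (hγ s) (hδ t) hst
  have := Measure.prod.instIsAddHaarMeasure (volume : Measure ℝ) (volume : Measure ℝ)
  -- Sard's theorem for the map which sends two parameters to the direction of their chord
  have hsard := addHaar_image_eq_zero_of_det_fderivWithin_eq_zero (volume.prod volume)
    (s := {p | (γ p.1 - δ p.2).2 ≠ 0 ∧ (fderiv ℝ F p).det = 0})
    (fun p hp => (hF p.1 p.2 hp.1).differentiableAt.hasFDerivAt.hasFDerivWithinAt)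
    fun p hp => hp.2
  filter_upwards [measure_eq_zero_iff_ae_notMem.1 hsard] with v hv s t hheight hproj hdet
  have hst : (γ s - δ t).2 ≠ 0 := sub_ne_zero.2 hheight
  have hdir : direction (γ s - δ t) = v :=
    (direction_eq_iff hst).2 (by rw [map_sub, hproj, sub_self])
  refine hv ⟨(s, t), ⟨hst, ?_⟩, hdir⟩
  have hcolumns : fderiv ℝ F (s, t) (1, 0) = (γ s - δ t).2⁻¹ • obliqueProj v (deriv γ s) ∧
      fderiv ℝ F (s, t) (0, 1) = (-(γ s - δ t).2⁻¹) • obliqueProj v (deriv δ t) := by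
    rw [(hF s t hst).fderiv, hdir]
    simp
  rw [det_eq_planeDet, hcolumns.1, hcolumns.2, planeDet_smul_smul, hdet, mul_zero]

theorem eventually_ne_of_planeDet_ne_zero {f g : ℝ → ℝ × ℝ} {s t : ℝ} {v w : ℝ × ℝ}
    (hf : HasDerivAt f v s) (hg : HasDerivAt g w t) (h : planeDet v w ≠ 0) :
    ∀ᶠ p in 𝓝[≠] (s, t), f p.1 ≠ g p.2 := by
  refine ((hasFDerivAt_fst_sub_snd hf hg).eventually_ne (c := 0) ?_).mono
    fun p hp heq => hp (sub_eq_zero.2 heq)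
  refine (LinearMap.injective_iff_antilipschitz (𝕜 := ℝ) (ContinuousLinearMap.toLinearMap _)).1
    ((injective_iff_map_eq_zero _).2 fun p hp => ?_) |>.imp fun _ hC => hC.2
  have h₁ : p.1 * v.1 - p.2 * w.1 = 0 := by simpa using congrArg Prod.fst hp
  have h₂ : p.1 * v.2 - p.2 * w.2 = 0 := by simpa using congrArg Prod.snd hp
  refine Prod.ext ((mul_eq_zero.1 ?_).resolve_right h) ((mul_eq_zero.1 ?_).resolve_right h)
  · unfold planeDet
    linear_combination w.2 * h₁ - w.1 * h₂
  · unfold planeDet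
    linear_combination v.2 * h₁ - v.1 * h₂

/-- The line with direction `(v, 1)` through `γ s` meets `δ` in `δ t` and `ε` in `ε u`, and along it
the projections of `δ` and `ε` cross transversally there. -/
structure IsTrisecant (γ δ ε : ℝ → (ℝ × ℝ) × ℝ) (s t u : ℝ) (v : ℝ × ℝ) : Prop where
  height_ne_left : (γ s - δ t).2 ≠ 0
  height_ne_right : (γ s - ε u).2 ≠ 0
  proj_left : obliqueProj v (γ s - δ t) = 0
  proj_right : obliqueProj v (γ s - ε u) = 0
  transversal : planeDet (obliqueProj v (deriv δ t)) (obliqueProj v (deriv ε u)) ≠ 0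

theorem countable_of_eventually_notMem {X : Type*} [TopologicalSpace X]
    [SecondCountableTopology X] {S : Set X} (h : ∀ x ∈ S, ∀ᶠ y in 𝓝[≠] x, y ∉ S) :
    S.Countable := by
  obtain ⟨C, -, hC, hS⟩ := TopologicalSpace.countable_cover_nhdsWithin
    (f := fun x => ({x} : Set X)) (s := S) fun x hx =>
      mem_nhdsWithin_iff_eventually.2 <| (eventually_nhdsWithin_iff.1 (h x hx)).mono
        fun y hy hyS => by_contra fun hne => hy hne hyS
  rw [biUnion_of_singleton] at hS
  exact hC.mono hS

theorem measurableSet_image_of_isLocallyClosed {X Y : Type*} [TopologicalSpace X]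
    [LocallyCompactSpace X] [SecondCountableTopology X] [TopologicalSpace Y] [T2Space Y]
    [MeasurableSpace Y] [OpensMeasurableSpace Y] {f : X → Y} (hf : Continuous f) {S : Set X}
    (hS : IsLocallyClosed S) : MeasurableSet (f '' S) := by
  have := hS.locallyCompactSpace
  obtain ⟨C, hC, hCS⟩ := (isSigmaCompact_iff_sigmaCompactSpace.2
    (inferInstance : SigmaCompactSpace S)).image hf
  exact hCS ▸ MeasurableSet.iUnion fun n => (hC n).measurableSet

theorem countable_trisecants (hδ : Differentiable ℝ δ) (hε : Differentiable ℝ ε) (s : ℝ) :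
    {q : ℝ × ℝ | ∃ v, IsTrisecant γ δ ε s q.1 q.2 v}.Countable := by
  refine countable_of_eventually_notMem fun ⟨t, u⟩ ⟨v, h⟩ => ?_
  have hleft := (hasFDerivAt_direction h.height_ne_left).comp_hasDerivAt t
    ((hδ t).hasDerivAt.const_sub (γ s))
  have hright := (hasFDerivAt_direction h.height_ne_right).comp_hasDerivAt u
    ((hε u).hasDerivAt.const_sub (γ s))
  rw [(direction_eq_iff h.height_ne_left).2 h.proj_left] at hleft
  rw [(direction_eq_iff h.height_ne_right).2 h.proj_right] at hright
  have htransversal : planeDet (((γ s - δ t).2⁻¹ • obliqueProj v) (-deriv δ t))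
      (((γ s - ε u).2⁻¹ • obliqueProj v) (-deriv ε u)) ≠ 0 := by
    simp only [smul_apply, map_neg, ← neg_smul, planeDet_smul_smul]
    exact mul_ne_zero (mul_ne_zero (neg_ne_zero.2 (inv_ne_zero h.height_ne_left))
      (neg_ne_zero.2 (inv_ne_zero h.height_ne_right))) h.transversal
  filter_upwards [eventually_ne_of_planeDet_ne_zero hleft hright htransversal] with p hp ⟨w, hw⟩
  exact hp (((direction_eq_iff hw.height_ne_left).2 hw.proj_left).trans
    ((direction_eq_iff hw.height_ne_right).2 hw.proj_right).symm)

theorem isLocallyClosed_trisecants (hγ : Continuous γ) (hδ : ContDiff ℝ 1 δ)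
    (hε : ContDiff ℝ 1 ε) : IsLocallyClosed {p : (ℝ × ℝ) × ℝ × (ℝ × ℝ) |
      IsTrisecant γ δ ε p.1.1 p.1.2 p.2.1 p.2.2} := by
  have := hδ.continuous
  have := hε.continuous
  have := hδ.continuous_deriv le_rfl
  have := hε.continuous_deriv le_rfl
  have hopen : IsOpen {p : (ℝ × ℝ) × ℝ × (ℝ × ℝ) | (γ p.1.1 - δ p.1.2).2 ≠ 0 ∧
      (γ p.1.1 - ε p.2.1).2 ≠ 0 ∧ planeDet (obliqueProj p.2.2 (deriv δ p.1.2))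
        (obliqueProj p.2.2 (deriv ε p.2.1)) ≠ 0} := by
    simp only [planeDet, obliqueProj_apply]
    refine (isOpen_ne_fun ?_ ?_).inter ((isOpen_ne_fun ?_ ?_).inter (isOpen_ne_fun ?_ ?_)) <;>
      fun_prop
  have hclosed : IsClosed {p : (ℝ × ℝ) × ℝ × (ℝ × ℝ) | obliqueProj p.2.2 (γ p.1.1 - δ p.1.2) = 0 ∧
      obliqueProj p.2.2 (γ p.1.1 - ε p.2.1) = 0} := by
    simp only [obliqueProj_apply]
    refine (isClosed_eq ?_ ?_).inter (isClosed_eq ?_ ?_) <;> fun_prop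
  convert hopen.isLocallyClosed.inter hclosed.isLocallyClosed using 1
  exact Set.ext fun p => ⟨fun h => ⟨⟨h.1, h.2, h.5⟩, h.3, h.4⟩,
    fun h => ⟨h.1.1, h.1.2.1, h.2.1, h.2.2, h.1.2.2⟩⟩

theorem volume_trisecants (hγ : Continuous γ) (hδ : ContDiff ℝ 1 δ) (hε : ContDiff ℝ 1 ε) :
    volume {p : ℝ × ℝ | ∃ u v, IsTrisecant γ δ ε p.1 p.2 u v} = 0 := by
  set T := {p : ℝ × ℝ | ∃ u v, IsTrisecant γ δ ε p.1 p.2 u v}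
  have himage : T = Prod.fst '' {p : (ℝ × ℝ) × ℝ × (ℝ × ℝ) |
      IsTrisecant γ δ ε p.1.1 p.1.2 p.2.1 p.2.2} :=
    Set.ext fun p => ⟨fun ⟨u, v, h⟩ => ⟨(p, u, v), h, rfl⟩, by
      rintro ⟨⟨p, u, v⟩, h, rfl⟩
      exact ⟨u, v, h⟩⟩
  have hmeas : MeasurableSet T := himage ▸
    measurableSet_image_of_isLocallyClosed continuous_fst (isLocallyClosed_trisecants hγ hδ hε)
  have hslice : ∀ s, (Prod.mk s ⁻¹' T).Countable := fun s =>
    (countable_trisecants (γ := γ) (hδ.differentiable one_ne_zero)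
      (hε.differentiable one_ne_zero) s).image Prod.fst |>.mono (by
        rintro t ⟨u, v, h⟩
        exact ⟨(t, u), ⟨v, h⟩, rfl⟩)
  rw [Measure.volume_eq_prod, Measure.measure_prod_null hmeas]
  exact Eventually.of_forall fun s => (hslice s).measure_zero _

theorem ae_obliqueProj_no_triple (hγ : ContDiff ℝ 1 γ) (hδ : ContDiff ℝ 1 δ)
    (hε : ContDiff ℝ 1 ε) : ∀ᵐ v, ∀ s t u, (γ s).2 ≠ (δ t).2 → (γ s).2 ≠ (ε u).2 →
      (δ t).2 ≠ (ε u).2 → obliqueProj v (γ s) = obliqueProj v (δ t) →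
      obliqueProj v (γ s) ≠ obliqueProj v (ε u) := by
  have hdiff : DifferentiableOn ℝ (fun p : ℝ × ℝ => direction (γ p.1 - δ p.2))
      {p : ℝ × ℝ | ∃ u v, IsTrisecant γ δ ε p.1 p.2 u v} := fun p ⟨u, v, h⟩ =>
    (hasFDerivAt_direction_chord (hγ.differentiable one_ne_zero _)
      (hδ.differentiable one_ne_zero _) h.height_ne_left).differentiableAt.differentiableWithinAt
  have := Measure.prod.instIsAddHaarMeasure (volume : Measure ℝ) (volume : Measure ℝ)
  have hnull := addHaar_image_eq_zero_of_differentiableOn_of_addHaar_eq_zero (volume.prod volume)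
    hdiff (volume_trisecants hγ.continuous hδ hε)
  filter_upwards [measure_eq_zero_iff_ae_notMem.1 hnull, ae_planeDet_obliqueProj_ne_zero
    (hδ.differentiable one_ne_zero) (hε.differentiable one_ne_zero)]
    with v hv htransversal s t u hst hsu htu hprojst hprojsu
  have h : IsTrisecant γ δ ε s t u v :=
    { height_ne_left := sub_ne_zero.2 hst
      height_ne_right := sub_ne_zero.2 hsu
      proj_left := by rw [map_sub, hprojst, sub_self]
      proj_right := by rw [map_sub, hprojsu, sub_self]
      transversal := htransversal t u htu (hprojst.symm.trans hprojsu) }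
  exact hv ⟨(s, t), ⟨u, v, h⟩, (direction_eq_iff h.height_ne_left).2 h.proj_left⟩

end Chords

/-! ### Existence of diagrams -/

theorem deriv_stereoCurve_ne_zero {A : Rotation} {K : Knot} (hK : ∀ t, rotate A (K t) 3 ≠ 1)
    (t : ℝ) : deriv (stereoCurve A K) t ≠ 0 := by
  intro hzero
  set r : ℝ → ℝ := fun t => 1 - rotate A (K t) 3
  set W := stereoCurve A K
  have hr : HasDerivAt r (deriv r t) t := ((contDiff_const.sub
    (A.contDiff_rotate K 3)).differentiable (by simp) t).hasDerivAt
  have hcurve : ∀ t, A.toLinearIsometry (K.curve t) = r t • W t + pole := fun t =>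
    sub_eq_iff_eq_add.1 (toLinearIsometry_curve_sub_pole (hK t))
  have hderiv : A.toLinearIsometry (deriv K.curve t) = deriv r t • W t := by
    have hW := (isLoop_stereoCurve hK).hasDerivAt t
    have hsmul := (hr.smul hW).add_const pole
    rw [hzero, smul_zero, zero_add] at hsmul
    exact (A.toLinearIsometry.toContinuousLinearMap.hasFDerivAt.comp_hasDerivAt t
      (K.isLoop.hasDerivAt t)).unique (hsmul.congr_of_eventuallyEq (.of_forall hcurve))
  have hsphere : inner ℝ (r t • W t + pole) (r t • W t + pole) = 1 := by
    rw [← hcurve, real_inner_self_eq_norm_sq, A.toLinearIsometry.norm_map, K.norm_curve, one_pow]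
  have horth : deriv r t * inner ℝ (r t • W t + pole) (W t) = 0 := by
    have hself := (K.isLoop.hasDerivAt t).inner ℝ (K.isLoop.hasDerivAt t)
    simp only [real_inner_self_eq_norm_sq, K.norm_curve] at hself
    have hconst := hself.unique (hasDerivAt_const t _)
    rw [← inner_smul_right, ← hderiv, ← hcurve, A.toLinearIsometry.inner_map_map]
    linarith [real_inner_comm (K.curve t) (deriv K.curve t)]
  have hpole : inner ℝ pole (W t) = -1 := by
    simp [pole, W, stereoCurve, EuclideanSpace.inner_single_left]
  have hone : inner ℝ (r t • W t + pole) (W t) = 1 := by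
    have hr0 : r t ≠ 0 := sub_ne_zero.2 (hK t).symm
    refine mul_left_cancel₀ hr0 ?_
    rw [inner_add_right, inner_smul_right, inner_add_left _ pole pole, real_inner_smul_left,
      real_inner_comm _ (W t), hpole, real_inner_self_eq_norm_sq pole, norm_pole] at hsphere
    linarith
  refine K.immersive t ?_
  rw [hone, mul_one] at horth
  rw [horth, zero_smul] at hderiv
  exact (map_eq_zero_iff _ A.toLinearIsometry.injective).1 hderiv

theorem exists_specialOrthogonal_row_eq {n : ℕ} {w : Fin (n + 1) → EuclideanSpace ℝ (Fin (n + 1))}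
    {s : Set (Fin (n + 1))} (hw : Orthonormal ℝ (s.domRestrict w)) (hs : 0 ∉ s) :
    ∃ A ∈ Matrix.specialOrthogonalGroup (Fin (n + 1)) ℝ, ∀ i ∈ s, A i = (w i).ofLp := by
  obtain ⟨b, hb⟩ := hw.exists_orthonormalBasis_extension_of_card_eq (by simp)
  set M : Matrix (Fin (n + 1)) (Fin (n + 1)) ℝ := Matrix.of fun i => (b i).ofLp
  have hM : M * M.transpose = 1 := by
    ext i j
    exact (orthonormal_iff_ite.1 b.orthonormal j i).trans (by simp [Matrix.one_apply, eq_comm])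
  have hdet : M.det * M.det = 1 := by
    rw [← Matrix.det_one (n := Fin (n + 1)) (R := ℝ), ← hM, Matrix.det_mul, Matrix.det_transpose]
  -- `D` corrects the sign of the determinant in the row `0`, which is not prescribed.
  set d : Fin (n + 1) → ℝ := Function.update 1 0 M.det
  set D : Matrix (Fin (n + 1)) (Fin (n + 1)) ℝ := Matrix.diagonal d
  have hD : D * D.transpose = 1 := by
    rw [Matrix.diagonal_transpose, Matrix.diagonal_mul_diagonal, ← Matrix.diagonal_one]
    congr 1
    ext i
    rcases eq_or_ne i 0 with rfl | hi
    · simpa [d] using hdet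
    · simp [d, hi]
  refine ⟨D * M, Matrix.mem_specialOrthogonalGroup_iff.2
    ⟨mul_mem ((Matrix.mem_orthogonalGroup_iff _ _).2 hD)
      ((Matrix.mem_orthogonalGroup_iff _ _).2 hM), ?_⟩, fun i hi => ?_⟩
  · rw [Matrix.det_mul, Matrix.det_diagonal, Fin.prod_univ_succ]
    simpa [d] using hdet
  · have hdi : d i = 1 := Function.update_of_ne (ne_of_mem_of_not_mem hi hs) _ _
    ext j
    refine (Matrix.diagonal_mul d M i j).trans ?_
    rw [hdi, one_mul, ← hb i hi]
    rfl

/-- The cones over the knots are smooth images of the plane, so they have Hausdorff dimension at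
most `2`. -/
theorem exists_norm_eq_one_forall_curve_ne {ι : Type} [Finite ι] (L : ι → Knot) :
    ∃ p : E4, ‖p‖ = 1 ∧ ∀ i t, (L i).curve t ≠ p := by
  have hdim : dimH (⋃ i, range fun q : ℝ × ℝ => q.1 • (L i).curve q.2) <
      Module.finrank ℝ E4 := by
    rw [dimH_iUnion, finrank_euclideanSpace_fin]
    refine lt_of_le_of_lt (b := ((2 : ℕ) : ENNReal)) (iSup_le fun i => ?_) (by norm_num)
    have hcone : ContDiff ℝ 1 fun q : ℝ × ℝ => q.1 • (L i).curve q.2 :=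
      contDiff_fst.smul ((L i).isLoop.contDiff.comp contDiff_snd)
    simpa using hcone.dimH_range_le
  obtain ⟨w, hw0, hw⟩ := (dense_compl_of_dimH_lt_finrank hdim).inter_open_nonempty {0}ᶜ
    isOpen_compl_singleton ⟨pole, norm_ne_zero_iff.1 (by simp [norm_pole])⟩
  refine ⟨‖w‖⁻¹ • w, norm_smul_inv_norm hw0, fun i t h => hw (mem_iUnion.2 ⟨i, (‖w‖, t), ?_⟩)⟩
  simp only [h, smul_inv_smul₀ (norm_ne_zero_iff.2 hw0)]

theorem exists_rotation_misses_pole {ι : Type} [Finite ι] (L : ι → Knot) :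
    ∃ A : Rotation, ∀ i t, rotate A (L i t) 3 ≠ 1 := by
  obtain ⟨p, hp, hpL⟩ := exists_norm_eq_one_forall_curve_ne L
  have hw : Orthonormal ℝ (({3} : Set (Fin 4)).domRestrict fun _ => p) :=
    ⟨fun _ => hp, fun i j hij => (hij (Subsingleton.elim i j)).elim⟩
  obtain ⟨A, hA, hrow⟩ := exists_specialOrthogonal_row_eq hw (by decide)
  refine ⟨⟨A, hA⟩, fun i t h => hpL i t ?_⟩
  have hinner : rotate ⟨A, hA⟩ (L i t) 3 = inner ℝ ((L i).curve t) p := by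
    simp only [rotate, Matrix.mulVec, hrow 3 rfl]
    rfl
  rwa [hinner, inner_eq_one_iff_of_norm_eq_one ((L i).norm_curve t) hp] at h

theorem exists_specialOrthogonal_tilt_rows (v : ℝ × ℝ) :
    ∃ R ∈ Matrix.specialOrthogonalGroup (Fin 4) ℝ, ∃ c : ℝ, c ≠ 0 ∧
      R 2 = c • ![v.1, v.2, 1, 0] ∧ R 3 = ![0, 0, 0, 1] := by
  set n : E4 := !₂[v.1, v.2, 1, 0]
  have hn : n ≠ 0 := fun h => by simpa [n] using congrArg (fun x : E4 => x 2) h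
  have horth : inner ℝ n pole = 0 := by simp [n, pole, EuclideanSpace.inner_single_right]
  have hw : Orthonormal ℝ (({2, 3} : Set (Fin 4)).domRestrict ![0, 0, ‖n‖⁻¹ • n, pole]) := by
    constructor
    · rintro ⟨i, rfl | rfl⟩
      exacts [norm_smul_inv_norm hn, norm_pole]
    · rintro ⟨i, rfl | rfl⟩ ⟨j, rfl | rfl⟩ hij
      exacts [(hij rfl).elim, by simp [real_inner_smul_left, horth],
        by simp [real_inner_smul_right, real_inner_comm n, horth], (hij rfl).elim]
  obtain ⟨R, hR, hrow⟩ := exists_specialOrthogonal_row_eq hw (by decide)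
  refine ⟨R, hR, ‖n‖⁻¹, inv_ne_zero (norm_ne_zero_iff.2 hn), hrow 2 (by simp),
    (hrow 3 (by simp)).trans ?_⟩
  ext i
  fin_cases i <;> simp [pole]

theorem exists_specialOrthogonal_mulVec_eq_obliqueProj (v : ℝ × ℝ) :
    ∃ R ∈ Matrix.specialOrthogonalGroup (Fin 4) ℝ, ∃ L : ℝ × ℝ →L[ℝ] ℝ × ℝ, L.det ≠ 0 ∧
      ∀ x, R.mulVec x 3 = x 3 ∧
        (R.mulVec x 0, R.mulVec x 1) = L (obliqueProj v ((x 0, x 1), x 2)) := by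
  obtain ⟨R, hR, c, hc, h2, h3⟩ := exists_specialOrthogonal_tilt_rows v
  obtain ⟨horth, hdet⟩ := Matrix.mem_specialOrthogonalGroup_iff.1 hR
  have hinner : ∀ i j, i ≠ j → R i 0 * R j 0 + R i 1 * R j 1 + R i 2 * R j 2 + R i 3 * R j 3 = 0 :=
    fun i j hij => by
      have hij' := congr_fun₂ ((Matrix.mem_orthogonalGroup_iff _ _).1 horth) i j
      simpa [Matrix.mul_apply, Fin.sum_univ_four, Matrix.one_apply, hij] using hij'
  have hcol3 : ∀ i, i ≠ 3 → R i 3 = 0 := fun i hi => by simpa [h3] using hinner i 3 hi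
  have hcol2 : ∀ i, i ≠ 2 → i ≠ 3 → R i 2 = -(R i 0 * v.1 + R i 1 * v.2) := fun i hi hi' => by
    have hi2 := hinner i 2 hi
    simp only [h2, hcol3 i hi', Pi.smul_apply, smul_eq_mul, Matrix.cons_val] at hi2
    refine mul_left_cancel₀ hc ?_
    linear_combination hi2
  set row : Fin 4 → ℝ × ℝ →L[ℝ] ℝ := fun i =>
    R i 0 • ContinuousLinearMap.fst ℝ ℝ ℝ + R i 1 • ContinuousLinearMap.snd ℝ ℝ ℝ
  refine ⟨R, hR, (row 0).prod (row 1), fun hL => ?_, fun x => ⟨?_, ?_⟩⟩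
  · have hL' : R 0 0 * R 1 1 - R 1 0 * R 0 1 = 0 := by
      simpa [det_eq_planeDet, planeDet, row] using hL
    have hexpand : R.det = c * (1 + v.1 ^ 2 + v.2 ^ 2) * (R 0 0 * R 1 1 - R 1 0 * R 0 1) := by
      simp [Matrix.det_succ_row_zero, Fin.sum_univ_succ, Fin.succAbove, h2, h3, hcol3, hcol2]
      ring
    simp [hdet, hL'] at hexpand
  · simp [Matrix.mulVec, dotProduct, Fin.sum_univ_four, h3]
  · simp [Matrix.mulVec, dotProduct, Fin.sum_univ_four, hcol3, hcol2, row, obliqueProj_apply]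
    constructor <;> ring

theorem exists_shadow_eq_obliqueProj (A : Rotation) (v : ℝ × ℝ) :
    ∃ (B : Rotation) (L : ℝ × ℝ →L[ℝ] ℝ × ℝ), L.det ≠ 0 ∧
      (∀ x, rotate B x 3 = rotate A x 3) ∧
      ∀ K t, shadow B K t = L (obliqueProj v (shadow A K t, height A K t)) := by
  obtain ⟨R, hR, L, hL, hRL⟩ := exists_specialOrthogonal_mulVec_eq_obliqueProj v
  have hmul : ∀ x, rotate (⟨R, hR⟩ * A) x = R.mulVec (rotate A x) := fun x => by
    simp [rotate]
  refine ⟨⟨R, hR⟩ * A, L, hL, fun x => hmul x ▸ (hRL _).1, fun K t => ?_⟩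
  have hscale := congrArg ((1 - rotate A (K t) 3)⁻¹ • ·) (hRL (rotate A (K t))).2
  simp only [← map_smul] at hscale
  convert hscale using 2
  · simp [shadow, stereo, hmul, (hRL _).1, div_eq_inv_mul]
  · simp [shadow, height, stereo, div_eq_inv_mul]

/-- The stereographic image of a knot in 3-space, written as plane times height. -/
def spaceCurve (A : Rotation) (K : Knot) (t : ℝ) : (ℝ × ℝ) × ℝ := (shadow A K t, height A K t)

section SpaceCurve

variable {A : Rotation} {J K : Knot}

theorem hasDerivAt_spaceCurve (hK : ∀ t, rotate A (K t) 3 ≠ 1) (t : ℝ) :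
    HasDerivAt (spaceCurve A K) ((deriv (stereoCurve A K) t 0, deriv (stereoCurve A K) t 1),
      deriv (stereoCurve A K) t 2) t := by
  have hcoord : ∀ i, HasDerivAt (fun t => stereoCurve A K t i) (deriv (stereoCurve A K) t i) t :=
    fun i => (EuclideanSpace.proj i : E4 →L[ℝ] ℝ).hasFDerivAt.comp_hasDerivAt t
      ((isLoop_stereoCurve hK).hasDerivAt t)
  exact ((hcoord 0).prodMk (hcoord 1)).prodMk (hcoord 2)

theorem contDiff_spaceCurve (hK : ∀ t, rotate A (K t) 3 ≠ 1) : ContDiff ℝ ∞ (spaceCurve A K) := by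
  have hcoord : ∀ i, ContDiff ℝ ∞ fun t => stereoCurve A K t i := fun i =>
    (EuclideanSpace.proj i : E4 →L[ℝ] ℝ).contDiff.comp (contDiff_stereoCurve hK)
  exact ((hcoord 0).prodMk (hcoord 1)).prodMk (hcoord 2)

theorem deriv_spaceCurve_ne_zero (hK : ∀ t, rotate A (K t) 3 ≠ 1) (t : ℝ) :
    deriv (spaceCurve A K) t ≠ 0 := by
  intro hzero
  rw [(hasDerivAt_spaceCurve hK t).deriv, Prod.mk_eq_zero, Prod.mk_eq_zero] at hzero
  have hlast : HasDerivAt (fun _ => (-1 : ℝ)) (deriv (stereoCurve A K) t 3) t :=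
    (EuclideanSpace.proj 3 : E4 →L[ℝ] ℝ).hasFDerivAt.comp_hasDerivAt t
      ((isLoop_stereoCurve hK).hasDerivAt t)
  refine deriv_stereoCurve_ne_zero hK t (PiLp.ext fun i => ?_)
  fin_cases i
  exacts [hzero.1.1, hzero.1.2, hzero.2, hlast.unique (hasDerivAt_const t _)]

theorem height_ne_of_obliqueProj_eq {s t : ℝ} (hJ : rotate A (J s) 3 ≠ 1)
    (hK : rotate A (K t) 3 ≠ 1) (hne : J s ≠ K t) {v : ℝ × ℝ}
    (h : obliqueProj v (spaceCurve A J s) = obliqueProj v (spaceCurve A K t)) :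
    (spaceCurve A J s).2 ≠ (spaceCurve A K t).2 := fun hheight => by
  rw [obliqueProj_apply, obliqueProj_apply, hheight, sub_left_inj] at h
  obtain ⟨h0, h1⟩ := shadow_eq_iff.1 h
  refine stereoCurve_ne hJ hK hne (PiLp.ext fun i => ?_)
  fin_cases i
  exacts [h0, h1, hheight, rfl]

end SpaceCurve

/-- A projection in general position. In contrast to `IsDiagram`, the conditions concern all
parameters, without reference to a fundamental domain; that there are only finitely many crossings
is then a consequence. -/
structure IsGenericProjection {ι : Type} (A : Rotation) (L : ι → Knot) : Prop where
  misses_pole : ∀ i t, rotate A (L i t) 3 ≠ 1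
  immersion : ∀ i t, deriv (shadow A (L i)) t ≠ 0
  transversal : ∀ i j s t, L i s ≠ L j t → shadow A (L i) s = shadow A (L j) t →
    planeDet (deriv (shadow A (L i)) s) (deriv (shadow A (L j)) t) ≠ 0
  no_triple : ∀ i j k s t u, L i s ≠ L j t → L i s ≠ L k u → L j t ≠ L k u →
    shadow A (L i) s = shadow A (L j) t → shadow A (L i) s ≠ shadow A (L k) u

theorem exists_isGenericProjection {ι : Type} [Finite ι] (L : ι → Knot) :
    ∃ A, IsGenericProjection A L := by
  obtain ⟨A, hpole⟩ := exists_rotation_misses_pole L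
  have hsmooth : ∀ (n : ℕ) i, ContDiff ℝ n (spaceCurve A (L i)) := fun n i =>
    contDiff_infty.1 (contDiff_spaceCurve (hpole i)) n
  have hdiff : ∀ i, Differentiable ℝ (spaceCurve A (L i)) := fun i =>
    (hsmooth 1 i).differentiable one_ne_zero
  obtain ⟨v, himmersion, htransversal, htriple⟩ := ((ae_all_iff.2 fun i =>
    ae_obliqueProj_deriv_ne_zero (hsmooth 2 i) (deriv_spaceCurve_ne_zero (hpole i))).and
    ((ae_all_iff.2 fun i => ae_all_iff.2 fun j =>
      ae_planeDet_obliqueProj_ne_zero (hdiff i) (hdiff j)).and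
    (ae_all_iff.2 fun i => ae_all_iff.2 fun j => ae_all_iff.2 fun k =>
      ae_obliqueProj_no_triple (hsmooth 1 i) (hsmooth 1 j) (hsmooth 1 k)))).exists
  obtain ⟨B, T, hT, hB, hshadow⟩ := exists_shadow_eq_obliqueProj A v
  have hTinj : Function.Injective T := (T.toContinuousLinearEquivOfDetNeZero hT).injective
  have hproj : ∀ {i j s t}, shadow B (L i) s = shadow B (L j) t →
      obliqueProj v (spaceCurve A (L i) s) = obliqueProj v (spaceCurve A (L j) t) := fun h =>
    hTinj (by rwa [hshadow, hshadow] at h)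
  have hheight : ∀ {i j s t}, L i s ≠ L j t → shadow B (L i) s = shadow B (L j) t →
      (spaceCurve A (L i) s).2 ≠ (spaceCurve A (L j) t).2 := fun hne h =>
    height_ne_of_obliqueProj_eq (hpole _ _) (hpole _ _) hne (hproj h)
  have hderiv : ∀ i t, deriv (shadow B (L i)) t =
      T (obliqueProj v (deriv (spaceCurve A (L i)) t)) := fun i t => by
    rw [funext (hshadow (L i))]
    exact ((T ∘L obliqueProj v).hasFDerivAt.comp_hasDerivAt t (hdiff i t).hasDerivAt).deriv
  refine ⟨B, fun i t => hB (L i t) ▸ hpole i t, fun i t => ?_, fun i j s t hne h => ?_,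
    fun i j k s t u hij hik hjk h h' => ?_⟩
  · rw [hderiv]
    exact (map_ne_zero_iff T hTinj).2 (himmersion i t)
  · rw [hderiv, hderiv, planeDet_map]
    exact mul_ne_zero hT (htransversal i j s t (hheight hne h) (hproj h))
  · exact htriple i j k s t u (hheight hij h) (hheight hik h') (hheight hjk (h.symm.trans h'))
      (hproj h) (hproj h')

theorem eventually_eq_of_hasStrictDerivAt {E : Type*} [NormedAddCommGroup E] [NormedSpace ℝ E]
    {f : ℝ → E} {v : E} {s : ℝ} (hf : HasStrictDerivAt f v s) (hv : v ≠ 0) :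
    ∀ᶠ p in 𝓝 (s, s), f p.1 = f p.2 → p.1 = p.2 := by
  have hsmall := (hasStrictFDerivAt_iff_isLittleO.1 hf.hasStrictFDerivAt).def
    (half_pos (norm_pos_iff.2 hv))
  filter_upwards [hsmall] with p hp heq
  by_contra hne
  have hdist : 0 < ‖p.1 - p.2‖ := norm_pos_iff.2 (sub_ne_zero.2 hne)
  have hbound : ‖p.1 - p.2‖ * ‖v‖ ≤ ‖v‖ / 2 * ‖p.1 - p.2‖ := by
    simpa [heq, norm_smul] using hp
  nlinarith [norm_pos_iff.2 hv]

theorem finite_of_eventually_notMem {X : Type*} [TopologicalSpace X] {S C : Set X}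
    (hC : IsCompact C) (hS : S ⊆ C) (h : ∀ x ∈ C, ∀ᶠ y in 𝓝[≠] x, y ∉ S) : S.Finite := by
  by_contra hinf
  obtain ⟨x, hx, hacc⟩ := Set.Infinite.exists_accPt_of_subset_isCompact hinf hC hS
  exact accPt_iff_frequently_nhdsNE.1 hacc (h x hx)

section Diagram

variable {ι : Type} {A : Rotation} {L : ι → Knot}

theorem apply_ne_of_ne (hL : ∀ i j, i ≠ j → (L i).Disjoint (L j)) {x y : ι × ℝ}
    (hx : x.2 ∈ Ico (0 : ℝ) 1) (hy : y.2 ∈ Ico (0 : ℝ) 1) (hxy : x ≠ y) :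
    L x.1 x.2 ≠ L y.1 y.2 := by
  obtain ⟨i, s⟩ := x
  obtain ⟨j, t⟩ := y
  rcases eq_or_ne i j with rfl | hij
  · intro h
    obtain ⟨n, hn⟩ := (L i).injective _ _ h
    have hlt : n < 1 := by exact_mod_cast hn ▸ (by linarith [hx.2, hy.1] : s - t < 1)
    have hgt : -1 < n := by exact_mod_cast hn ▸ (by linarith [hx.1, hy.2] : -1 < s - t)
    obtain rfl : n = 0 := by omega
    rw [Int.cast_zero, sub_eq_zero] at hn
    exact hxy (Prod.ext rfl hn)
  · exact hL i j hij s t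

theorem IsGenericProjection.contDiff_shadow (h : IsGenericProjection A L) (i : ι) :
    ContDiff ℝ ∞ (shadow A (L i)) :=
  contDiff_fst.comp (contDiff_spaceCurve (h.misses_pole i))

theorem IsGenericProjection.eventually_shadow_ne_self (h : IsGenericProjection A L) (i : ι)
    (t : ℝ) (n : ℤ) : ∀ᶠ q in 𝓝[≠] (t + n, t), L i q.1 ≠ L i q.2 →
      shadow A (L i) q.1 ≠ shadow A (L i) q.2 := by
  have hshift : ∀ s, L i (s + n) = L i s := fun s => by simpa using (L i).periodic.int_mul n s
  have hinj := eventually_eq_of_hasStrictDerivAt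
    ((h.contDiff_shadow i).contDiffAt.hasStrictDerivAt (x := t + n) (by simp))
    (h.immersion i (t + n))
  have htendsto : Tendsto (fun q : ℝ × ℝ => (q.1, q.2 + n)) (𝓝 (t + n, t)) (𝓝 (t + n, t + n)) :=
    (by fun_prop : Continuous fun q : ℝ × ℝ => (q.1, q.2 + (n : ℝ))).tendsto _
  filter_upwards [nhdsWithin_le_nhds (htendsto.eventually hinj)] with q hq hne heq
  refine hne ((congrArg (L i) (hq ?_)).trans (hshift q.2))
  rw [heq]
  simp only [shadow, hshift]

theorem IsGenericProjection.eventually_shadow_ne (h : IsGenericProjection A L)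
    (hL : ∀ i j, i ≠ j → (L i).Disjoint (L j)) (i j : ι) (p : ℝ × ℝ) :
    ∀ᶠ q in 𝓝[≠] p, L i q.1 ≠ L j q.2 → shadow A (L i) q.1 ≠ shadow A (L j) q.2 := by
  obtain ⟨s, t⟩ := p
  have hsmooth := fun k => h.contDiff_shadow k
  have hderiv : ∀ k t, HasDerivAt (shadow A (L k)) (deriv (shadow A (L k)) t) t := fun k t =>
    ((hsmooth k).differentiable (by simp) t).hasDerivAt
  by_cases hpoint : L i s = L j t
  · obtain rfl : i = j := by_contra fun hij => hL i j hij s t hpoint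
    obtain ⟨n, hn⟩ := (L i).injective _ _ hpoint
    rw [eq_add_of_sub_eq' hn]
    exact h.eventually_shadow_ne_self i t n
  by_cases hshadow : shadow A (L i) s = shadow A (L j) t
  · exact (eventually_ne_of_planeDet_ne_zero (hderiv i s) (hderiv j t)
      (h.transversal i j s t hpoint hshadow)).mono fun q hq _ => hq
  · have hopen : IsOpen {q : ℝ × ℝ | shadow A (L i) q.1 ≠ shadow A (L j) q.2} :=
      isOpen_ne_fun ((hsmooth i).continuous.comp continuous_fst)
        ((hsmooth j).continuous.comp continuous_snd)
    exact nhdsWithin_le_nhds (Filter.mem_of_superset (hopen.mem_nhds hshadow) fun q hq _ => hq)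

theorem IsGenericProjection.isDiagram [Finite ι] (h : IsGenericProjection A L)
    (hL : ∀ i j, i ≠ j → (L i).Disjoint (L j)) : IsDiagram A L where
  misses_pole := h.misses_pole
  immersion := h.immersion
  finite := by
    have hfinite : ∀ i j, {p : ℝ × ℝ | p ∈ Ico (0 : ℝ) 1 ×ˢ Ico (0 : ℝ) 1 ∧ L i p.1 ≠ L j p.2 ∧
        shadow A (L i) p.1 = shadow A (L j) p.2}.Finite := fun i j =>
      finite_of_eventually_notMem (isCompact_Icc.prod isCompact_Icc)
        (fun p hp => prod_mono Ico_subset_Icc_self Ico_subset_Icc_self hp.1) fun p _ =>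
        (h.eventually_shadow_ne hL i j p).mono fun q hq hmem => hq hmem.2.1 hmem.2.2
    refine (finite_iUnion fun i => finite_iUnion fun j =>
      (hfinite i j).image fun p : ℝ × ℝ => ((i, p.1), (j, p.2))).subset fun q hq => ?_
    exact mem_iUnion₂.2 ⟨q.1.1, q.2.1, (q.1.2, q.2.2), ⟨⟨hq.1, hq.2.1⟩,
      apply_ne_of_ne hL hq.1 hq.2.1 hq.2.2.1, hq.2.2.2⟩, rfl⟩
  transversal q hq :=
    h.transversal _ _ _ _ (apply_ne_of_ne hL hq.1 hq.2.1 hq.2.2.1) hq.2.2.2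
  no_triple x y z hy hz := by
    by_contra hyz
    exact h.no_triple _ _ _ _ _ _ (apply_ne_of_ne hL hy.1 hy.2.1 hy.2.2.1)
      (apply_ne_of_ne hL hz.1 hz.2.1 hz.2.2.1) (apply_ne_of_ne hL hy.2.1 hz.2.1 hyz)
      hy.2.2.2 hz.2.2.2

end Diagram

theorem Knot.Disjoint.exists_isDiagram {J K : Knot} (h : J.Disjoint K) :
    ∃ A, IsDiagram A ![J, K] := by
  obtain ⟨A, hA⟩ := exists_isGenericProjection ![J, K]
  refine ⟨A, hA.isDiagram fun i j hij => ?_⟩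
  fin_cases i <;> fin_cases j
  exacts [absurd rfl hij, h, h.symm, absurd rfl hij]

theorem Knot.Disjoint.hasLinkNumber {J K : Knot} (h : J.Disjoint K) :
    HasLinkNumber J.curve K.curve (lk J K) :=
  h.hasLinkNumber_lk h.exists_isDiagram

end KnotTheory

end

theorem mainTheorem12 :
    -- the linking number is well defined: diagrams exist, and all of them compute it
    (∀ K₁ K₂ : Knot, K₁.Disjoint K₂ →
      (∃ A, IsDiagram A ![K₁, K₂]) ∧
      ∀ A, IsDiagram A ![K₁, K₂] → crossingSum A K₁ K₂ = 2 * lk K₁ K₂) ∧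
    -- additivity under connected sum, the disc being disjoint from the third knot
    (∀ (K₁ K₂ K₃ K : Knot) (D : ℝ × ℝ → S3),
      K₁.Disjoint K₂ → K₁.Disjoint K₃ → K₂.Disjoint K₃ →
      IsConnectedSumAlong D K₁ K₂ K →
      (∀ q ∈ unitSquare, D q ∉ Set.range K₃) →
      lk K K₃ = lk K₁ K₃ + lk K₂ K₃) ∧
    -- reversal of the orientation of one component
    (∀ K₁ K₂ : Knot, K₁.Disjoint K₂ →
      lk K₁ K₂.reverse = - lk K₁ K₂ ∧ lk K₁.reverse K₂ = - lk K₁ K₂) ∧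
    -- invariance under a crossing change
    (∀ K₁ K₂ K₃ : Knot, K₁.Disjoint K₃ → K₂.Disjoint K₃ →
      IsCrossingChange K₁ K₂ K₃ → lk K₁ K₃ = lk K₂ K₃) := by
  refine ⟨fun J K h => ⟨h.exists_isDiagram, fun A hA =>
      hA.isTransversal.crossingSum_eq_two_mul h h.hasLinkNumber⟩,
    fun K₁ K₂ K₃ K D _ h₁ h₂ h hD => ?_, fun J K h => ⟨?_, ?_⟩,
    fun K₁ K₂ K₃ h₁ h₂ h => h.linkNumber_eq h₁ h₂ h₁.hasLinkNumber h₂.hasLinkNumber⟩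
  · exact (h.disjoint h₁ h₂ hD).hasLinkNumber.unique
      (h.hasLinkNumber h₁ h₂ hD h₁.hasLinkNumber h₂.hasLinkNumber)
  · exact h.symm.reverse_left.symm.hasLinkNumber.unique (h.hasLinkNumber.reverse_right h)
  · exact h.reverse_left.hasLinkNumber.unique h.hasLinkNumber.reverse_left
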